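/- **Setting.** Fix $p\ge 1$. For each $n$ let $Z_{ij}=Z^{(n)}_{ij}\in\mathbb R^p$ ($1\le i\ne j\le n$) be deterministic covariates such that $q=q_n:=\max_{i\ne j}\|Z_{ij}\|_\infty$ is bounded in $n$, and let $\theta^*=(\alpha^*_1,\dots,\alpha^*_n,\beta^*_1,\dots,\beta^*_{n-1})\in\mathbb R^{2n-1}$ (with $\beta^*_n:=0$) and $\gamma^*\in\mathbb R^p$ be the true parameters (all may depend on $n$). For parameters $(\theta,\gamma)$, with $\beta_n:=0$, write $x_{ij}=Z_{ij}^T\gamma+\alpha_i+\beta_j$, $p_{ij}(\theta,\gamma)=e^{x_{ij}}/(1+e^{x_{ij}})$ and $w_{ij}(\theta,\gamma)=e^{x_{ij}}/(1+e^{x_{ij}})^2$. Let $a_{ij}\in\{0,1\}$, $i\neq j$, with $P(a_{ij}=1)=p_{ij}(\theta^*,\gamma^*)$, and let $e_1^\pm,\dots,e_n^\pm$ be discrete Laplace variables, $P(e_i^{\pm}=x)=\frac{1-r_n}{1+r_n}r_n^{|x|}$ for $x\in\mathbb Z$, with $r_n=e^{-\epsilon_n/2}$, $\epsilon_n>0$;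 all $a_{ij}$, $e_i^+$, $e_i^-$ are independent. Put $\kappa_n=2(\log\frac1{r_n})^{-1}=4/\epsilon_n$, $\tilde d_i=\sum_{j\ne i}a_{ij}+e_i^+$, $\tilde b_j=\sum_{i\neq j}a_{ij}+e_j^-$. The estimator $(\hat\theta,\hat\gamma)$ is a solution $(\theta,\gamma)\in\mathbb R^{2n-1}\times\mathbb R^p$ of $$\tilde d_i=\sum_{j\ne i}p_{ij}(\theta,\gamma)\ (1\le i\le n),\qquad \tilde b_j=\sum_{i\ne j}p_{ij}(\theta,\gamma)\ (1\le j\le n-1),\qquad \sum_{i\ne j}Z_{ij}a_{ij}=\sum_{i\neq j}Z_{ij}\,p_{ij}(\theta,\gamma)$$ whenever a solution exists (and an arbitrary measurable choice otherwise). Let $T_{ij}\in\mathbb R^{2n-1}$ be the coefficient vector of the linear form $\theta\mapsto\alpha_i+\beta_j$, and $$V=(v_{r,c})=\sum_{i\ne j}w_{ij}T_{ij}T_{ij}^T,\quad V_{\gamma\theta}=\sum_{i\ne j}w_{ij}Z_{ij}T_{ij}^T,\quad V_{\gamma\gamma}=\sum_{i\ne j}w_{ij}Z_{ij}Z_{ij}^T,\quad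 H=V_{\gamma\gamma}-V_{\gamma\theta}V^{-1}V_{\gamma\theta}^T$$ as functions of $(\theta,\gamma)$. Put $v_{2n,r}=v_{r,r}-\sum_{c\neq r}v_{r,c}$ and $v_{2n,2n}=\sum_{r=1}^{2n-1}v_{2n,r}$; let $S=(s_{r,c})$ with $s_{r,c}=\delta_{r,c}/v_{r,r}+1/v_{2n,2n}$ if $r,c\le n$ or $r,c>n$, and $s_{r,c}=-1/v_{2n,2n}$ otherwise. Below $v_{r,c}$, $v_{2n,2n}$ are evaluated at $(\theta^*,\gamma^*)$, and $S^*$ is $S$ at $(\theta^*,\gamma^*)$. Let $\epsilon_{n1},\epsilon_{n2}>0$ and $\rho_n=\max_{i\ne j}|\alpha_i^*+\beta_j^*|+2\epsilon_{n1}+pq\|\gamma^*\|_\infty+pq\,\epsilon_{n2}$. Assume that for all large $n$ and all $\theta$ with $\|\theta-\theta^*\|_\infty\le\epsilon_{n1}$ the matrix $H(\theta,\gamma^*)$ is positive definite and $\|H^{-1}(\theta,\gamma^*)\|_\infty\le\lambda_n/n^2$ (maximum absolute row sum). **Theorem 2.** Assume $$\lambda_n^2\,q\,e^{18\rho_n}(1+\kappa_n)^2=o(n/\log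 n),\qquad \lambda_n q^2e^{12\rho_n}(1+\kappa_n)^2=o(n^{1/2}/\log n).$$ Then $(\hat\theta,\hat\gamma)$ exists with probability tending to one, and, for every fixed $k\ge1$: (i) If $\kappa_ne^{\rho_n}\sqrt{\log n}=o(1)$, the vector of the first $k$ coordinates of $\hat\theta-\theta^*$ is asymptotically multivariate normal with mean $0$ and covariance matrix the upper left $k\times k$ block of $S^*$. (ii) Let $s_n^2=\mathrm{Var}\big(\sum_{i=1}^ne_i^+-\sum_{i=1}^{n-1}e_i^-\big)$; then $s_n^2=2(2n-1)\frac{e^{-2/\kappa_n}}{(1-e^{-2/\kappa_n})^2}$. If $s_n/v_{2n,2n}^{1/2}\to c$ for some constant $c$, the vector of the first $k$ coordinates of $\hat\theta-\theta^*$ is asymptotically $k$-variate normal with mean $0$ and covariance matrix $$\mathrm{diag}\Big(\frac1{v_{1,1}},\dots,\frac1{v_{k,k}}\Big)+\Big(\frac1{v_{2n,2n}}+\frac{s_n^2}{v_{2n,2n}^2}\Big)\mathbf 1_k\mathbf 1_k^T .$$ Here "$X_n$ is asymptotically normal with mean $0$ and covariance $\Sigma_n$" means that $\Sigma_n$ is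 positive definite for large $n$ and $\Sigma_n^{-1/2}X_n$ converges in distribution to the standard normal law on $\mathbb R^k$. -/

import Mathlib

open MeasureTheory ProbabilityTheory Filter Topology Asymptotics

noncomputable section

namespace PrivateBeta

variable {n p : ℕ}

/-- Index set of the `2n - 1` coordinates of `θ = (α₁, …, αₙ, β₁, …, βₙ₋₁)`. -/
abbrev Idx (n : ℕ) : Type := Fin n ⊕ Fin (n - 1)

/-- The node among `1, …, n` that carries the in-parameter number `j ≤ n - 1`. -/
def inNode (j : Fin (n - 1)) : Fin n := Fin.castLE (Nat.sub_le n 1) j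

/-- The in-parameters `β₁, …, βₙ` of `θ`, with the identification `βₙ = 0`. -/
def beta (θ : Idx n → ℝ) (j : Fin n) : ℝ :=
  if h : (j : ℕ) < n - 1 then θ (Sum.inr ⟨j, h⟩) else 0

/-- `αᵢ + βⱼ`. -/
def degreeEffect (θ : Idx n → ℝ) (i j : Fin n) : ℝ := θ (Sum.inl i) + beta θ j

/-- `Zᵢⱼᵀ γ + αᵢ + βⱼ`. -/
def logit (Z : Fin n → Fin n → Fin p → ℝ) (θ : Idx n → ℝ) (γ : Fin p → ℝ) (i j : Fin n) : ℝ :=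
  Z i j ⬝ᵥ γ + degreeEffect θ i j

/-- The edge probability `eˣ / (1 + eˣ)`, `x = Zᵢⱼᵀ γ + αᵢ + βⱼ`. -/
def edgeProb (Z : Fin n → Fin n → Fin p → ℝ) (θ : Idx n → ℝ) (γ : Fin p → ℝ)
    (i j : Fin n) : ℝ :=
  Real.exp (logit Z θ γ i j) / (1 + Real.exp (logit Z θ γ i j))

/-- The edge variance `eˣ / (1 + eˣ)²`, `x = Zᵢⱼᵀ γ + αᵢ + βⱼ`. -/
def edgeWeight (Z : Fin n → Fin n → Fin p → ℝ) (θ : Idx n → ℝ) (γ : Fin p → ℝ)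
    (i j : Fin n) : ℝ :=
  Real.exp (logit Z θ γ i j) / (1 + Real.exp (logit Z θ γ i j)) ^ 2

/-- Ordered pairs of distinct nodes: the possible directed edges. -/
abbrev Edge (n : ℕ) : Type := {e : Fin n × Fin n // e.1 ≠ e.2}

/-- The parameter `e^{-ε/2}` of the discrete Laplace noise for the privacy parameter `ε`. -/
def laplaceParam (ε : ℝ) : ℝ := Real.exp (-ε / 2)

/-- `κ = 4 / ε = 2 (log (1 / α))⁻¹` with `α = e^{-ε/2}`. -/
def kappa (ε : ℝ) : ℝ := 4 / ε

/-- All the random sources of the model: the edges, the noises `e⁺` and the noises `e⁻`. -/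
def sources {Ω : Type*} (a : Fin n → Fin n → Ω → ℤ) (eOut eIn : Fin n → Ω → ℤ) :
    Edge n ⊕ (Fin n ⊕ Fin n) → Ω → ℤ :=
  Sum.elim (fun e => a e.1.1 e.1.2) (Sum.elim eOut eIn)

/-- The random directed graph `a` with covariates `Z` and parameters `(θ, γ)`, together with the
discrete Laplace noises `e⁺`, `e⁻` of parameter `e^{-ε/2}`: all edges and all noises are
independent. The diagonal of `a` plays no role (there are no loops). -/
structure IsModel {Ω : Type*} [MeasurableSpace Ω] (P : Measure Ω)
    (Z : Fin n → Fin n → Fin p → ℝ) (θ : Idx n → ℝ) (γ : Fin p → ℝ) (ε : ℝ)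
    (a : Fin n → Fin n → Ω → ℤ) (eOut eIn : Fin n → Ω → ℤ) : Prop where
  measurable_sources : ∀ s, Measurable (sources a eOut eIn s)
  indep : iIndepFun (sources a eOut eIn) P
  edge_one : ∀ i j, i ≠ j → P.real {ω | a i j ω = 1} = edgeProb Z θ γ i j
  edge_zero : ∀ i j, i ≠ j → P.real {ω | a i j ω = 0} = 1 - edgeProb Z θ γ i j
  noise_out : ∀ i (x : ℤ), P.real {ω | eOut i ω = x} =
    (1 - laplaceParam ε) / (1 + laplaceParam ε) * laplaceParam ε ^ x.natAbs
  noise_in : ∀ i (x : ℤ), P.real {ω | eIn i ω = x} =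
    (1 - laplaceParam ε) / (1 + laplaceParam ε) * laplaceParam ε ^ x.natAbs

/-- The released noisy out-degree of node `i`. -/
def noisyOutDegree (A : Fin n → Fin n → ℤ) (eOut : Fin n → ℤ) (i : Fin n) : ℤ :=
  ∑ j ∈ Finset.univ.erase i, A i j + eOut i

/-- The released noisy in-degree of node `j`. -/
def noisyInDegree (A : Fin n → Fin n → ℤ) (eIn : Fin n → ℤ) (j : Fin n) : ℤ :=
  ∑ i ∈ Finset.univ.erase j, A i j + eIn j

/-- `(θ, γ)` solves the moment equations for the graph `A` and the noises `e⁺`, `e⁻`. -/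
def IsMomentSolution (Z : Fin n → Fin n → Fin p → ℝ) (A : Fin n → Fin n → ℤ)
    (eOut eIn : Fin n → ℤ) (θ : Idx n → ℝ) (γ : Fin p → ℝ) : Prop :=
  (∀ i : Fin n, (noisyOutDegree A eOut i : ℝ) =
    ∑ j ∈ Finset.univ.erase i, edgeProb Z θ γ i j) ∧
  (∀ j : Fin (n - 1), (noisyInDegree A eIn (inNode j) : ℝ) =
    ∑ i ∈ Finset.univ.erase (inNode j), edgeProb Z θ γ i (inNode j)) ∧
  ∑ i, ∑ j ∈ Finset.univ.erase i, (A i j : ℝ) • Z i j =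
    ∑ i, ∑ j ∈ Finset.univ.erase i, edgeProb Z θ γ i j • Z i j

/-- The coefficient vector of `αᵢ + βⱼ` as a linear form in `θ`. -/
def design (i j : Fin n) : Idx n → ℝ :=
  Sum.elim (fun k => if k = i then 1 else 0) (fun k => if inNode k = j then 1 else 0)

/-- `V = -∂F/∂θᵀ`, the Jacobian in `θ` of the expected degrees `(d₁, …, dₙ, b₁, …, bₙ₋₁)`. -/
def V (Z : Fin n → Fin n → Fin p → ℝ) (θ : Idx n → ℝ) (γ : Fin p → ℝ) :
    Matrix (Idx n) (Idx n) ℝ :=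
  Matrix.of fun r c => ∑ i, ∑ j ∈ Finset.univ.erase i,
    edgeWeight Z θ γ i j * design i j r * design i j c

/-- `-∂Q/∂θᵀ`; its transpose is `-∂F/∂γᵀ`. -/
def Vmixed (Z : Fin n → Fin n → Fin p → ℝ) (θ : Idx n → ℝ) (γ : Fin p → ℝ) :
    Matrix (Fin p) (Idx n) ℝ :=
  Matrix.of fun r c => ∑ i, ∑ j ∈ Finset.univ.erase i,
    edgeWeight Z θ γ i j * Z i j r * design i j c

/-- `-∂Q/∂γᵀ`. -/
def Vcov (Z : Fin n → Fin n → Fin p → ℝ) (θ : Idx n → ℝ) (γ : Fin p → ℝ) :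
    Matrix (Fin p) (Fin p) ℝ :=
  Matrix.of fun r c => ∑ i, ∑ j ∈ Finset.univ.erase i,
    edgeWeight Z θ γ i j * Z i j r * Z i j c

/-- The profile information matrix of `γ`: up to the sign that makes it positive definite,
`∂Q/∂γᵀ - ∂Q/∂θᵀ [∂F/∂θᵀ]⁻¹ ∂F/∂γᵀ`. -/
def H (Z : Fin n → Fin n → Fin p → ℝ) (θ : Idx n → ℝ) (γ : Fin p → ℝ) :
    Matrix (Fin p) (Fin p) ℝ :=
  Vcov Z θ γ - Vmixed Z θ γ * (V Z θ γ)⁻¹ * (Vmixed Z θ γ).transpose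

/-- The matrix norm induced by the maximum norm: the largest absolute row sum. -/
def rowSumNorm (A : Matrix (Fin p) (Fin p) ℝ) : ℝ := ⨆ r, ∑ c, |A r c|

/-- `q = max_{i ≠ j} ‖Zᵢⱼ‖_∞`. -/
def covBound (Z : Fin n → Fin n → Fin p → ℝ) : ℝ := ⨆ e : Edge n, ‖Z e.1.1 e.1.2‖

/-- `ρ = max_{i ≠ j} |αᵢ + βⱼ| + 2 ε₁ + p q ‖γ‖_∞ + p q ε₂`. -/
def rho (Z : Fin n → Fin n → Fin p → ℝ) (θ : Idx n → ℝ) (γ : Fin p → ℝ) (ε₁ ε₂ : ℝ) : ℝ :=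
  (⨆ e : Edge n, |degreeEffect θ e.1.1 e.1.2|) + 2 * ε₁
    + p * covBound Z * ‖γ‖ + p * covBound Z * ε₂

/-- `v_{2n,2n} = ∑_r v_{2n,r}`, where `v_{2n,r} = v_{r,r} - ∑_{c ≠ r} v_{r,c}`. -/
def vLast (W : Matrix (Idx n) (Idx n) ℝ) : ℝ :=
  ∑ r, (W r r - ∑ c ∈ Finset.univ.erase r, W r c)

/-- The explicit approximation `S` of the inverse of `W`. -/
def S (W : Matrix (Idx n) (Idx n) ℝ) : Matrix (Idx n) (Idx n) ℝ :=
  Matrix.of fun r c =>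
    match r, c with
    | Sum.inl i, Sum.inl j => (if i = j then 1 / W (Sum.inl i) (Sum.inl i) else 0) + 1 / vLast W
    | Sum.inl _, Sum.inr _ => -(1 / vLast W)
    | Sum.inr _, Sum.inl _ => -(1 / vLast W)
    | Sum.inr i, Sum.inr j => (if i = j then 1 / W (Sum.inr i) (Sum.inr i) else 0) + 1 / vLast W

/-- Positions of the first `k ≤ n` coordinates of `θ`. -/
def lead {k : ℕ} (h : k ≤ n) (i : Fin k) : Idx n := Sum.inl (Fin.castLE h i)

/-- The first `k` coordinates of `x`; the value for `n < k` is irrelevant as `n → ∞`. -/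
def firstCoords (k : ℕ) (x : Idx n → ℝ) : EuclideanSpace ℝ (Fin k) :=
  if h : k ≤ n then WithLp.toLp 2 (fun i => x (lead h i)) else 0

/-- The upper left `k × k` block of `S`; the value for `n < k` is irrelevant as `n → ∞`. -/
def blockS (k : ℕ) (W : Matrix (Idx n) (Idx n) ℝ) : Matrix (Fin k) (Fin k) ℝ :=
  if h : k ≤ n then (S W).submatrix (lead h) (lead h) else 1

/-- `diag(1/v₁₁, …, 1/v_kk) + (1/v_{2n,2n} + s²/v_{2n,2n}²) 1 1ᵀ`; the value for `n < k` is
irrelevant as `n → ∞`. -/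
def noisyBlock (k : ℕ) (W : Matrix (Idx n) (Idx n) ℝ) (sSq : ℝ) : Matrix (Fin k) (Fin k) ℝ :=
  if h : k ≤ n then
    Matrix.diagonal (fun i => 1 / W (lead h i) (lead h i))
      + (1 / vLast W + sSq / vLast W ^ 2) • Matrix.vecMulVec 1 1
  else 1

/-- The variance `s²` of `∑_{i ≤ n} eᵢ⁺ - ∑_{i ≤ n - 1} eᵢ⁻`. -/
def noiseVariance {Ω : Type*} [MeasurableSpace Ω] (P : Measure Ω) (eOut eIn : Fin n → Ω → ℤ) : ℝ :=
  variance (fun ω => ∑ i, (eOut i ω : ℝ) - ∑ i : Fin (n - 1), (eIn (inNode i) ω : ℝ)) P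

open scoped MatrixOrder in
/-- The random vectors `X n` are asymptotically `k`-variate normal with mean `0` and covariance
matrices `C n`: eventually `C n` is positive definite, and `(C n)^{-1/2} X n` converges in
distribution to the standard normal law on `ℝᵏ`. -/
def AsymptoticallyNormal {k : ℕ} {Ω : ℕ → Type*} [∀ n, MeasurableSpace (Ω n)]
    (P : ∀ n, Measure (Ω n)) [∀ n, IsProbabilityMeasure (P n)]
    (X : ∀ n, Ω n → EuclideanSpace ℝ (Fin k)) (C : ℕ → Matrix (Fin k) (Fin k) ℝ) : Prop :=
  (∀ᶠ n in atTop, (C n).PosDef) ∧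
  TendstoInDistribution
    (fun n ω => Matrix.toEuclideanCLM (𝕜 := ℝ) (CFC.sqrt (C n))⁻¹ (X n ω)) atTop
    (id : EuclideanSpace ℝ (Fin k) → EuclideanSpace ℝ (Fin k)) P
    (stdGaussian (EuclideanSpace ℝ (Fin k)))

end PrivateBeta

end

/-! The moment equations are the score equations of a logistic regression with linear predictor α_i
+ β_j + Zᵀγ on the edge (i, j), the degrees being blurred by noise. All estimates live in one
weighted form `bil` on functions of ordered pairs, whose weights are the edge variances at the true
parameter. In it V is the Gram matrix of the design, H the Gram matrix of the covariates projected
off the design (`H_apply`), and the form itself is the covariance of linear edge statistics. Put R =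
e^ρ. The weights lie between 1/(4R) and 1/4, and since every off-diagonal pair carries weight, the
functions α_i + β_j have a spectral gap (`sum_addFun_sq_le`, `sum_sq_le_centered`): in the centred
gauge ∑α = ∑β, the energy controls n/R times the squared ℓ² norm of the coefficients, up to a
constant.

Existence. The solution is the minimiser, over a fixed box around the truth, of the negative
log-likelihood plus a penalty on the gauge defect ∑α - ∑β. On the box the secant slopes of the
logistic function are within a factor 3 of the weights. Moving the minimiser towards the truth
bounds its energy by the dual norm of the score (`scorePair_sq_le`); moving one node parameter at a
time turns this into sup-norm bounds (`exists_score_solution`). These are smaller than the box, so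
the minimiser is interior, and the invisible direction (1, -1, 0) shows that the penalty vanishes.
Monotonicity of the logistic function gives uniqueness (`IsMomentSolution.unique`), hence the
estimator is this solution. The score is small enough with probability tending to one, by Hoeffding
for the degrees and Markov and Chebyshev for the noises and the projected covariate scores
(`measureReal_not_isGood_le`).

Linearisation. Testing the equations with a column of H⁻¹ bounds γ' - γ (`abs_gamma_sub_le`);
testing with a column of V⁻¹ writes the error of one out-parameter as a linear statistic plus a
quadratic remainder (`abs_theta_sub_sub_le`). A column of V⁻¹ is the column of S plus an error of
energy O(R⁴/n²) (`bil_colErr_self_le`), whose statistic has variance O((1 + σ²)R⁵/n²), with σ² the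
variance of one noise, while the leading variance is at least of order 1/n. The remainder is of
order `rate` / √n.

Limit. The column of S for node i only sees the edges of row i and of column n, but it has
±1/v_{2n,2n} in all 2n - 1 noise coordinates. Thus all out-parameters share the noise term (∑e⁺ -
∑e⁻)/v_{2n,2n}, the origin of the rank-one term s²/v² in the covariance (`dotProduct_sCol_sCol`); in
case (i) it is negligible, in case (ii) it is kept. A factor-by-factor comparison of characteristic
functions gives Gaussian limits along all directions of fixed variance, which suffices
(`asymptoticallyNormal_of_charFun`). Both cases are instances of `asymptoticallyNormal_firstCoords`.
-/

noncomputable section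

open scoped Matrix

namespace PrivateBeta

section

/-! ### The logistic function -/

/-- The logistic function `eˣ / (1 + eˣ)`. -/
def sigm (x : ℝ) : ℝ := Real.exp x / (1 + Real.exp x)

/-- The derivative `eˣ / (1 + eˣ)²` of the logistic function. -/
def sigw (x : ℝ) : ℝ := Real.exp x / (1 + Real.exp x) ^ 2

/-- The antiderivative `log (1 + eˣ)` of the logistic function. -/
def softplus (x : ℝ) : ℝ := Real.log (1 + Real.exp x)

lemma hasDerivAt_softplus (x : ℝ) : HasDerivAt softplus (sigm x) x := by
  have h : HasDerivAt (fun y => 1 + Real.exp y) (Real.exp x) x :=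
    (Real.hasDerivAt_exp x).const_add 1
  exact h.log (by positivity)

lemma hasDerivAt_sigm (x : ℝ) : HasDerivAt sigm (sigw x) x := by
  have h : HasDerivAt (fun y => 1 + Real.exp y) (Real.exp x) x :=
    (Real.hasDerivAt_exp x).const_add 1
  have h2 := (Real.hasDerivAt_exp x).div h (by positivity)
  convert! h2 using 1
  simp only [sigw]
  congr 1
  ring

lemma sigw_pos (x : ℝ) : 0 < sigw x := by unfold sigw; positivity

lemma sigw_le (x : ℝ) : sigw x ≤ 1 / 4 := by
  unfold sigw
  rw [div_le_div_iff₀ (by positivity) (by norm_num)]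
  nlinarith [sq_nonneg (Real.exp x - 1)]

lemma sigm_pos (x : ℝ) : 0 < sigm x := by unfold sigm; positivity

lemma sigm_lt_one (x : ℝ) : sigm x < 1 := by
  unfold sigm
  rw [div_lt_one (by positivity)]
  linarith

lemma sigw_eq (x : ℝ) : sigw x = sigm x * (1 - sigm x) := by
  unfold sigw sigm
  have : (1 + Real.exp x) ≠ 0 := by positivity
  field_simp
  ring

/-- The logarithm of `sigw` has derivative 1 - 2σ, so it is 1-Lipschitz; the proof cross-multiplies
for each sign of t. Because the weights are multiplicatively stable, estimates near the truth can
use the weights at the truth without losing a further factor e^ρ. -/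
lemma sigw_add_le (x t : ℝ) : sigw (x + t) ≤ Real.exp |t| * sigw x := by
  unfold sigw
  rw [Real.exp_add, ← mul_div_assoc, div_le_div_iff₀ (by positivity) (by positivity)]
  set a := Real.exp x with ha
  have ha0 : 0 < a := Real.exp_pos x
  rcases le_total 0 t with ht | ht
  · rw [abs_of_nonneg ht]
    have h1 : 1 ≤ Real.exp t := Real.one_le_exp ht
    set b := Real.exp t
    have : (1 + a) ^ 2 ≤ (1 + a * b) ^ 2 := by
      apply pow_le_pow_left₀ (by positivity)
      nlinarith
    nlinarith [mul_pos ha0 (lt_of_lt_of_le one_pos h1)]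
  · rw [abs_of_nonpos ht, Real.exp_neg]
    have h1 : Real.exp t ≤ 1 := Real.exp_le_one_iff.2 ht
    have hb0 := Real.exp_pos t
    set b := Real.exp t
    have : b ^ 2 * (1 + a) ^ 2 ≤ (1 + a * b) ^ 2 := by
      rw [← mul_pow]
      apply pow_le_pow_left₀ (by positivity)
      nlinarith
    rw [mul_assoc (b⁻¹), inv_mul_eq_div, le_div_iff₀ hb0]
    nlinarith

lemma le_sigw_add (x t : ℝ) : Real.exp (-|t|) * sigw x ≤ sigw (x + t) := by
  have h := sigw_add_le (x + t) (-t)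
  rw [add_neg_cancel_right, abs_neg] at h
  rw [Real.exp_neg, inv_mul_le_iff₀ (Real.exp_pos _)]
  exact h

lemma exp_neg_abs_le_sigw (x : ℝ) : Real.exp (-|x|) / 4 ≤ sigw x := by
  have h := le_sigw_add 0 x
  have h0 : sigw 0 = 1 / 4 := by unfold sigw; norm_num
  rw [zero_add, h0] at h
  linarith

lemma sigm_strictMono : StrictMono sigm :=
  strictMono_of_hasDerivAt_pos hasDerivAt_sigm sigw_pos

/-- Mean value form of the increments of the logistic function. -/
lemma exists_sigm_sub_eq (x t : ℝ) (ht : |t| ≤ 1) :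
    ∃ v, sigm (x + t) - sigm x = v * t ∧ sigw x / 3 ≤ v ∧ v ≤ 3 * sigw x ∧
      |v - sigw x| ≤ 2 * |t| * sigw x := by
  have key : ∃ s, |s| ≤ |t| ∧ sigm (x + t) - sigm x = sigw (x + s) * t := by
    rcases lt_trichotomy t 0 with h | h | h
    · obtain ⟨c, hc, hc'⟩ := exists_hasDerivAt_eq_slope sigm sigw (show x + t < x by linarith)
        (fun y _ => (hasDerivAt_sigm y).continuousAt.continuousWithinAt)
        (fun y _ => hasDerivAt_sigm y)
      refine ⟨c - x, ?_, ?_⟩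
      · rw [abs_of_neg h, abs_of_neg (by linarith [hc.2])]; linarith [hc.1]
      · rw [add_sub_cancel, hc', eq_comm, div_mul_eq_mul_div, div_eq_iff (by linarith)]; ring
    · exact ⟨0, by simp, by simp [h]⟩
    · obtain ⟨c, hc, hc'⟩ := exists_hasDerivAt_eq_slope sigm sigw (show x < x + t by linarith)
        (fun y _ => (hasDerivAt_sigm y).continuousAt.continuousWithinAt)
        (fun y _ => hasDerivAt_sigm y)
      refine ⟨c - x, ?_, ?_⟩
      · rw [abs_of_pos h, abs_of_pos (by linarith [hc.1])]; linarith [hc.2]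
      · rw [add_sub_cancel, hc', eq_comm, div_mul_eq_mul_div, div_eq_iff (by linarith)]; ring
  obtain ⟨s, hs, he⟩ := key
  have hw := sigw_pos x
  have hu := sigw_add_le x s
  have hl := le_sigw_add x s
  have hs1 : |s| ≤ 1 := hs.trans ht
  -- The factor 3 in both comparisons of the secant slope with the weight is e rounded up.
  have he3 : Real.exp |s| ≤ 3 := by
    have := Real.exp_le_exp.2 hs1
    linarith [Real.exp_one_lt_d9]
  have he3' : 1 / 3 ≤ Real.exp (-|s|) := by
    rw [Real.exp_neg, one_div]
    exact inv_anti₀ (Real.exp_pos _) he3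
  have h2 : Real.exp |s| - 1 ≤ 2 * |s| := by
    have := Real.abs_exp_sub_one_le (x := |s|) (by rwa [abs_abs])
    rw [abs_abs] at this
    exact (le_abs_self _).trans this
  have h3 : -|s| + 1 ≤ Real.exp (-|s|) := Real.add_one_le_exp _
  refine ⟨sigw (x + s), he, by nlinarith, by nlinarith, ?_⟩
  have h4 : |sigw (x + s) - sigw x| ≤ 2 * |s| * sigw x := by
    rw [abs_le]
    constructor
    · nlinarith [abs_nonneg s]
    · nlinarith [abs_nonneg s]
  refine h4.trans ?_
  gcongr

lemma abs_sigm_sub_sub_le (x t : ℝ) (ht : |t| ≤ 1) :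
    |sigm (x + t) - sigm x - sigw x * t| ≤ 2 * (sigw x * t ^ 2) := by
  obtain ⟨v, h1, -, -, h4⟩ := exists_sigm_sub_eq x t ht
  rw [h1, ← sub_mul, abs_mul, ← sq_abs t]
  nlinarith [abs_nonneg t]

/-! ### Weighted sums over the edges -/

variable {n p : ℕ}

/-- Symmetric bilinear form on functions on ordered pairs of nodes, with weights `W`. -/
def bil (W f g : Fin n → Fin n → ℝ) : ℝ := ∑ i, ∑ j, W i j * (f i j * g i j)

/-- Weights of the ordered pairs of nodes that vanish on the diagonal and lie between `m > 0` and
`1 / 4` off the diagonal. -/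
structure IsWeight (W : Fin n → Fin n → ℝ) (m : ℝ) : Prop where
  pos : 0 < m
  diag : ∀ i, W i i = 0
  lower : ∀ i j, i ≠ j → m ≤ W i j
  upper : ∀ i j, W i j ≤ 1 / 4

section bil

variable {W : Fin n → Fin n → ℝ} {m : ℝ}

lemma IsWeight.nonneg (hW : IsWeight W m) (i j : Fin n) : 0 ≤ W i j := by
  rcases eq_or_ne i j with rfl | h
  · rw [hW.diag]
  · exact hW.pos.le.trans (hW.lower i j h)

lemma bil_comm (W f g : Fin n → Fin n → ℝ) : bil W f g = bil W g f := by
  simp only [bil, mul_comm (f _ _)]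

lemma bil_add_left (W f f' g : Fin n → Fin n → ℝ) :
    bil W (f + f') g = bil W f g + bil W f' g := by
  simp only [bil, Pi.add_apply, add_mul, mul_add, Finset.sum_add_distrib]

lemma bil_smul_left (W : Fin n → Fin n → ℝ) (c : ℝ) (f g : Fin n → Fin n → ℝ) :
    bil W (c • f) g = c * bil W f g := by
  simp only [bil, Pi.smul_apply, smul_eq_mul, Finset.mul_sum]
  refine Finset.sum_congr rfl fun i _ => Finset.sum_congr rfl fun j _ => by ring

lemma bil_neg_left (W f g : Fin n → Fin n → ℝ) : bil W (-f) g = -bil W f g := by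
  have := bil_smul_left W (-1) f g
  simpa using this

lemma bil_sub_left (W f f' g : Fin n → Fin n → ℝ) :
    bil W (f - f') g = bil W f g - bil W f' g := by
  rw [sub_eq_add_neg, bil_add_left, bil_neg_left, sub_eq_add_neg]

lemma bil_add_right (W f g g' : Fin n → Fin n → ℝ) :
    bil W f (g + g') = bil W f g + bil W f g' := by
  rw [bil_comm, bil_add_left, bil_comm W g, bil_comm W g']

lemma bil_sub_right (W f g g' : Fin n → Fin n → ℝ) :
    bil W f (g - g') = bil W f g - bil W f g' := by
  rw [bil_comm, bil_sub_left, bil_comm W g, bil_comm W g']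

lemma bil_smul_right (W : Fin n → Fin n → ℝ) (c : ℝ) (f g : Fin n → Fin n → ℝ) :
    bil W f (c • g) = c * bil W f g := by
  rw [bil_comm, bil_smul_left, bil_comm]

lemma bil_sum_right {ι : Type*} (s : Finset ι) (W f : Fin n → Fin n → ℝ)
    (g : ι → Fin n → Fin n → ℝ) : bil W f (∑ l ∈ s, g l) = ∑ l ∈ s, bil W f (g l) := by
  classical
  induction s using Finset.induction_on with
  | empty => simp [bil]
  | insert a s ha ih => rw [Finset.sum_insert ha, Finset.sum_insert ha, bil_add_right, ih]

lemma bil_sum_left {ι : Type*} (s : Finset ι) (W f : Fin n → Fin n → ℝ)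
    (g : ι → Fin n → Fin n → ℝ) : bil W (∑ l ∈ s, g l) f = ∑ l ∈ s, bil W (g l) f := by
  rw [bil_comm, bil_sum_right]
  exact Finset.sum_congr rfl fun l _ => bil_comm _ _ _

lemma bil_self_nonneg (hW : IsWeight W m) (f : Fin n → Fin n → ℝ) : 0 ≤ bil W f f :=
  Finset.sum_nonneg fun i _ => Finset.sum_nonneg fun j _ =>
    mul_nonneg (hW.nonneg i j) (mul_self_nonneg _)

/-- Cauchy–Schwarz through the discriminant: the form is only semidefinite, as the weights vanish on
the diagonal. -/
lemma bil_sq_le (hW : IsWeight W m) (f g : Fin n → Fin n → ℝ) :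
    bil W f g ^ 2 ≤ bil W f f * bil W g g := by
  have h : ∀ t : ℝ, 0 ≤ bil W g g * (t * t) + 2 * bil W f g * t + bil W f f := by
    intro t
    have := bil_self_nonneg hW (f + t • g)
    rw [bil_add_left, bil_add_right, bil_add_right, bil_smul_left, bil_smul_left, bil_smul_right,
      bil_smul_right, bil_comm W g f] at this
    linarith
  have := discrim_le_zero h
  unfold discrim at this
  nlinarith

lemma abs_bil_le (hW : IsWeight W m) (f g : Fin n → Fin n → ℝ) :
    |bil W f g| ≤ √(bil W f f) * √(bil W g g) := by
  rw [← Real.sqrt_mul (bil_self_nonneg hW f)]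
  exact Real.abs_le_sqrt (bil_sq_le hW f g)

lemma bil_add_self_le (hW : IsWeight W m) (f g : Fin n → Fin n → ℝ) :
    bil W (f + g) (f + g) ≤ 2 * bil W f f + 2 * bil W g g := by
  have := bil_self_nonneg hW (f - g)
  rw [bil_sub_left, bil_sub_right, bil_sub_right, bil_comm W g f] at this
  rw [bil_add_left, bil_add_right, bil_add_right, bil_comm W g f]
  linarith

lemma bil_self_le_of_abs_le (hW : IsWeight W m) (f : Fin n → Fin n → ℝ) {b : ℝ}
    (hf : ∀ i j, i ≠ j → |f i j| ≤ b) : bil W f f ≤ n ^ 2 * b ^ 2 / 4 := by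
  have : ∀ i j, W i j * (f i j * f i j) ≤ b ^ 2 / 4 := by
    intro i j
    rcases eq_or_ne i j with rfl | h
    · rw [hW.diag]; simp; positivity
    · have h1 : f i j * f i j ≤ b ^ 2 := by
        rw [← sq, ← sq_abs]; exact pow_le_pow_left₀ (abs_nonneg _) (hf i j h) 2
      nlinarith [hW.upper i j, hW.nonneg i j, mul_self_nonneg (f i j)]
  calc bil W f f ≤ ∑ _i : Fin n, ∑ _j : Fin n, b ^ 2 / 4 :=
        Finset.sum_le_sum fun i _ => Finset.sum_le_sum fun j _ => this i j
    _ = n ^ 2 * b ^ 2 / 4 := by simp; ring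

/-! ### Additive functions of the two end points -/

/-- The function `(i, j) ↦ αᵢ + βⱼ`. -/
def addFun (α β : Fin n → ℝ) (i j : Fin n) : ℝ := α i + β j

/-- The diagonal carries no weight and is recovered along a path of three edges: α_i + β_i = (α_i +
β_{i+1}) - (α_{i+2} + β_{i+1}) + (α_{i+2} + β_i), with cyclic indices, whose pairs are off the
diagonal because n ≥ 3. Cauchy–Schwarz gives a factor 3, and each of the three families is a
subfamily of the off-diagonal sum, whence 9. -/
lemma sum_diag_le (hn : 3 ≤ n) (α β : Fin n → ℝ) :
    ∑ i, (α i + β i) ^ 2 ≤ 9 * ∑ i, ∑ j, if i = j then 0 else (α i + β j) ^ 2 := by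
  obtain ⟨k, rfl⟩ : ∃ k, n = k + 3 := ⟨n - 3, by omega⟩
  have s1 : ∀ i : Fin (k + 3), i ≠ i + 1 := by
    intro i h
    have := congrArg Fin.val h
    rw [Fin.val_add] at this
    have hi := i.2
    simp only [Fin.val_one] at this
    rcases Nat.lt_or_ge (i.1 + 1) (k + 3) with h1 | h1
    · rw [Nat.mod_eq_of_lt h1] at this; omega
    · have : i.1 + 1 = k + 3 := by omega
      simp_all
  have s2 : ∀ i : Fin (k + 3), i + 1 + 1 ≠ i := by
    intro i h
    have := congrArg Fin.val h
    rw [Fin.val_add, Fin.val_add] at this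
    have hi := i.2
    simp only [Fin.val_one] at this
    rcases Nat.lt_or_ge (i.1 + 1) (k + 3) with h1 | h1
    · rw [Nat.mod_eq_of_lt h1] at this
      rcases Nat.lt_or_ge (i.1 + 1 + 1) (k + 3) with h2 | h2
      · rw [Nat.mod_eq_of_lt h2] at this; omega
      · have h3 : i.1 + 1 + 1 = k + 3 := by omega
        rw [h3, Nat.mod_self] at this; omega
    · have h3 : i.1 + 1 = k + 3 := by omega
      rw [h3, Nat.mod_self, Nat.mod_eq_of_lt (by omega)] at this; omega
  set O := ∑ i : Fin (k + 3), ∑ j, if i = j then 0 else (α i + β j) ^ 2 with hO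
  have hnn : ∀ i j : Fin (k + 3), 0 ≤ if i = j then 0 else (α i + β j) ^ 2 := by
    intro i j; split_ifs <;> positivity
  have h1 : ∑ i, (α i + β (i + 1)) ^ 2 ≤ O := by
    refine Finset.sum_le_sum fun i _ => ?_
    have := Finset.single_le_sum (fun j _ => hnn i j) (Finset.mem_univ (i + 1))
    rwa [if_neg (s1 i)] at this
  have h2 : ∑ i, (α (i + 1 + 1) + β (i + 1)) ^ 2 ≤ O := by
    rw [hO, Finset.sum_comm]
    refine (Equiv.sum_comp (Equiv.addRight (1 : Fin (k + 3)))
      (fun l => (α (l + 1) + β l) ^ 2)).trans_le ?_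
    refine Finset.sum_le_sum fun i _ => ?_
    have := Finset.single_le_sum (fun j _ => hnn j i) (Finset.mem_univ (i + 1))
    rwa [if_neg (s1 i).symm] at this
  have h3 : ∑ i, (α (i + 1 + 1) + β i) ^ 2 ≤ O := by
    rw [hO, Finset.sum_comm]
    refine Finset.sum_le_sum fun i _ => ?_
    have := Finset.single_le_sum (fun j _ => hnn j i) (Finset.mem_univ (i + 1 + 1))
    rwa [if_neg (s2 i)] at this
  have h4 : ∑ i, (α i + β i) ^ 2 ≤ ∑ i, 3 * ((α i + β (i + 1)) ^ 2
      + (α (i + 1 + 1) + β (i + 1)) ^ 2 + (α (i + 1 + 1) + β i) ^ 2) := by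
    refine Finset.sum_le_sum fun i _ => ?_
    nlinarith [sq_nonneg ((α i + β (i + 1)) + (α (i + 1 + 1) + β (i + 1))),
      sq_nonneg ((α i + β (i + 1)) - (α (i + 1 + 1) + β i)),
      sq_nonneg ((α (i + 1 + 1) + β i) + (α (i + 1 + 1) + β (i + 1)))]
  rw [← Finset.mul_sum, Finset.sum_add_distrib, Finset.sum_add_distrib] at h4
  linarith

lemma sum_offDiag_le_bil (hW : IsWeight W m) (f : Fin n → Fin n → ℝ) :
    m * ∑ i, ∑ j, (if i = j then 0 else f i j ^ 2) ≤ bil W f f := by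
  rw [Finset.mul_sum]
  refine Finset.sum_le_sum fun i _ => ?_
  rw [Finset.mul_sum]
  refine Finset.sum_le_sum fun j _ => ?_
  split_ifs with h
  · subst h; rw [hW.diag]; simp
  · rw [← sq]; exact mul_le_mul_of_nonneg_right (hW.lower i j h) (sq_nonneg _)

/-- The spectral gap of the design. The constant 10 is 1 for the off-diagonal entries and 9 for the
diagonal ones. -/
lemma sum_addFun_sq_le (hn : 3 ≤ n) (hW : IsWeight W m) (α β : Fin n → ℝ) :
    ∑ i, ∑ j, (α i + β j) ^ 2 ≤ 10 / m * bil W (addFun α β) (addFun α β) := by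
  have h1 := sum_diag_le hn α β
  have h2 := sum_offDiag_le_bil hW (addFun α β)
  unfold addFun at h2 ⊢
  have h3 : ∑ i, ∑ j, (α i + β j) ^ 2 =
      ∑ i, (α i + β i) ^ 2 + ∑ i, ∑ j, (if i = j then 0 else (α i + β j) ^ 2) := by
    rw [← Finset.sum_add_distrib]
    refine Finset.sum_congr rfl fun i _ => ?_
    have : ∀ j, (α i + β j) ^ 2 = (if i = j then (α i + β j) ^ 2 else 0)
        + (if i = j then 0 else (α i + β j) ^ 2) := by
      intro j; split_ifs <;> simp
    rw [Finset.sum_congr rfl fun j _ => this j, Finset.sum_add_distrib]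
    simp
  rw [h3, div_mul_eq_mul_div, le_div_iff₀ hW.pos]
  nlinarith [hW.pos]

lemma sum_addFun_sq_eq (α β : Fin n → ℝ) :
    ∑ i, ∑ j, (α i + β j) ^ 2 =
      n * (∑ i, α i ^ 2 + ∑ j, β j ^ 2) + 2 * ((∑ i, α i) * ∑ j, β j) := by
  have : ∀ i j, (α i + β j) ^ 2 = α i ^ 2 + 2 * (α i * β j) + β j ^ 2 := by intros; ring
  simp only [this, Finset.sum_add_distrib, Finset.sum_const, Finset.card_univ, Fintype.card_fin,
    nsmul_eq_mul, ← Finset.mul_sum, Finset.sum_mul_sum]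
  ring

/-- The energy ignores the shift (α + t, β - t), so coercivity needs the gauge defect. Expanding
∑∑(α_i + β_j)² leaves the cross term 2(∑α)(∑β), and -2AB ≤ (A - B)². -/
lemma sum_sq_le_centered (hn : 3 ≤ n) (hW : IsWeight W m) (α β : Fin n → ℝ) :
    n * (∑ i, α i ^ 2 + ∑ j, β j ^ 2) ≤
      10 / m * bil W (addFun α β) (addFun α β) + (∑ i, α i - ∑ j, β j) ^ 2 := by
  have h1 := sum_addFun_sq_le hn hW α β
  rw [sum_addFun_sq_eq] at h1
  nlinarith [sq_nonneg (∑ i, α i), sq_nonneg (∑ j, β j)]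

end bil

end

section

/-! ### The design and the information matrices -/

variable {n p : ℕ}

/-- The edge weights, set to `0` on the diagonal. -/
def wgt (Z : Fin n → Fin n → Fin p → ℝ) (θ : Idx n → ℝ) (γ : Fin p → ℝ) (i j : Fin n) : ℝ :=
  if i = j then 0 else edgeWeight Z θ γ i j

/-- The `l`-th covariate as a function on pairs of nodes. -/
def covFun (Z : Fin n → Fin n → Fin p → ℝ) (l : Fin p) (i j : Fin n) : ℝ := Z i j l

/-- The `r`-th column of the design. -/
def designFun (r : Idx n) (i j : Fin n) : ℝ := design i j r

lemma sum_erase_eq (i : Fin n) (f : Fin n → ℝ) :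
    ∑ j ∈ Finset.univ.erase i, f j = ∑ j, if i = j then 0 else f j := by
  rw [← Finset.add_sum_erase _ _ (Finset.mem_univ i), if_pos rfl, zero_add]
  exact Finset.sum_congr rfl fun j hj => (if_neg (Finset.ne_of_mem_erase hj).symm).symm

lemma inNode_val (j : Fin (n - 1)) : (inNode j : ℕ) = j := rfl

lemma beta_inNode (x : Idx n → ℝ) (j : Fin (n - 1)) : beta x (inNode j) = x (Sum.inr j) := by
  simp [beta, inNode_val]

lemma degreeEffect_eq_addFun (x : Idx n → ℝ) :
    degreeEffect x = addFun (fun i => x (Sum.inl i)) (beta x) := rfl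

lemma sum_inNode_ite (x : Idx n → ℝ) (j : Fin n) :
    ∑ k : Fin (n - 1), (if inNode k = j then 1 else 0) * x (Sum.inr k) = beta x j := by
  by_cases h : (j : ℕ) < n - 1
  · rw [Finset.sum_eq_single ⟨j, h⟩]
    · have : inNode ⟨j, h⟩ = j := rfl
      simp [this, beta, h]
    · intro b _ hb
      have : inNode b ≠ j := by
        intro h'
        apply hb
        have := congrArg Fin.val h'
        exact Fin.ext this
      simp [this]
    · simp
  · have : ∀ k : Fin (n - 1), inNode k ≠ j := by
      intro k h'
      apply h
      rw [← h']
      exact k.2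
    simp [beta, h, this]

lemma degreeEffect_eq_sum (x : Idx n → ℝ) : degreeEffect x = ∑ r, x r • designFun r := by
  funext i j
  simp only [Finset.sum_apply, Pi.smul_apply, smul_eq_mul, Fintype.sum_sum_type, designFun, design,
    Sum.elim_inl, Sum.elim_inr, degreeEffect]
  rw [← sum_inNode_ite x j]
  simp [mul_comm]

lemma degreeEffect_add (x y : Idx n → ℝ) :
    degreeEffect (x + y) = degreeEffect x + degreeEffect y := by
  simp only [degreeEffect_eq_sum, Pi.add_apply, add_smul, Finset.sum_add_distrib]

lemma degreeEffect_smul (c : ℝ) (x : Idx n → ℝ) :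
    degreeEffect (c • x) = c • degreeEffect x := by
  simp only [degreeEffect_eq_sum, Pi.smul_apply, smul_assoc, Finset.smul_sum]

lemma degreeEffect_sub (x y : Idx n → ℝ) :
    degreeEffect (x - y) = degreeEffect x - degreeEffect y := by
  simp only [degreeEffect_eq_sum, Pi.sub_apply, sub_smul, Finset.sum_sub_distrib]

lemma degreeEffect_sum {ι : Type*} (s : Finset ι) (x : ι → Idx n → ℝ) :
    degreeEffect (∑ l ∈ s, x l) = ∑ l ∈ s, degreeEffect (x l) := by
  classical
  induction s using Finset.induction_on with
  | empty => simp [degreeEffect_eq_sum]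
  | insert a s ha ih => rw [Finset.sum_insert ha, Finset.sum_insert ha, degreeEffect_add, ih]

section info

variable (Z : Fin n → Fin n → Fin p → ℝ) (θ : Idx n → ℝ) (γ : Fin p → ℝ)

lemma sum_erase_weight (f g : Fin n → Fin n → ℝ) :
    ∑ i, ∑ j ∈ Finset.univ.erase i, edgeWeight Z θ γ i j * f i j * g i j
      = bil (wgt Z θ γ) f g := by
  refine Finset.sum_congr rfl fun i _ => ?_
  rw [sum_erase_eq]
  refine Finset.sum_congr rfl fun j _ => ?_
  unfold wgt
  split_ifs <;> ring

/-- The matrices V, `Vmixed` and `Vcov` are the blocks of a single Gram matrix, that of the design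
columns and the covariates. Inverting V therefore amounts to an orthogonal projection. -/
lemma V_apply (r c : Idx n) :
    V Z θ γ r c = bil (wgt Z θ γ) (designFun r) (designFun c) :=
  sum_erase_weight Z θ γ (designFun r) (designFun c)

lemma Vmixed_apply (l : Fin p) (c : Idx n) :
    Vmixed Z θ γ l c = bil (wgt Z θ γ) (covFun Z l) (designFun c) :=
  sum_erase_weight Z θ γ (covFun Z l) (designFun c)

lemma Vcov_apply (l l' : Fin p) :
    Vcov Z θ γ l l' = bil (wgt Z θ γ) (covFun Z l) (covFun Z l') :=
  sum_erase_weight Z θ γ (covFun Z l) (covFun Z l')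

lemma bil_degreeEffect_right (W f : Fin n → Fin n → ℝ) (y : Idx n → ℝ) :
    bil W f (degreeEffect y) = ∑ r, y r * bil W f (designFun r) := by
  rw [degreeEffect_eq_sum, bil_sum_right]
  exact Finset.sum_congr rfl fun r _ => bil_smul_right _ _ _ _

lemma dotProduct_V_mulVec (x y : Idx n → ℝ) :
    y ⬝ᵥ (V Z θ γ *ᵥ x) = bil (wgt Z θ γ) (degreeEffect x) (degreeEffect y) := by
  rw [bil_degreeEffect_right]
  simp only [dotProduct, Matrix.mulVec]
  refine Finset.sum_congr rfl fun r _ => ?_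
  rw [bil_comm, bil_degreeEffect_right]
  congr 1
  refine Finset.sum_congr rfl fun c _ => ?_
  rw [V_apply, mul_comm]

lemma V_transpose : (V Z θ γ)ᵀ = V Z θ γ := by
  ext r c
  rw [Matrix.transpose_apply, V_apply, V_apply, bil_comm]

variable {Z θ γ} {m : ℝ}

/-- In the gauge β_n = 0 the column of the last node shows α alone, so ∑α² ≤ F; averaging β_j = (α_i
+ β_j) - α_i over i then gives ∑β² ≤ 4F, and 50 = 5 · 10. Reading α from a single column loses the
factor n of the centred gauge, but this is enough for the invertibility of V, for uniqueness, and
for the noise coefficients of `colErr`. -/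
lemma sum_sq_le_bil_degreeEffect {W : Fin n → Fin n → ℝ} (hn : 3 ≤ n) (hW : IsWeight W m)
    (x : Idx n → ℝ) : ∑ r, x r ^ 2 ≤ 50 / m * bil W (degreeEffect x) (degreeEffect x) := by
  have hF := sum_addFun_sq_le hn hW (fun i => x (Sum.inl i)) (beta x)
  rw [← degreeEffect_eq_addFun] at hF
  set F := ∑ i, ∑ j, (x (Sum.inl i) + beta x j) ^ 2 with hFdef
  have hn0 : (0 : ℝ) < n := by exact_mod_cast (by omega : 0 < n)
  have hα : ∑ i, x (Sum.inl i) ^ 2 ≤ F := by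
    refine Finset.sum_le_sum fun i _ => ?_
    have hlast : beta x ⟨n - 1, by omega⟩ = 0 := by simp [beta]
    have := Finset.single_le_sum (fun j _ => sq_nonneg (x (Sum.inl i) + beta x j))
      (Finset.mem_univ (⟨n - 1, by omega⟩ : Fin n))
    rwa [hlast, add_zero] at this
  have hβ : ∑ j, x (Sum.inr j) ^ 2 ≤ ∑ j, beta x j ^ 2 := by
    have h1 : ∑ j : Fin (n - 1), x (Sum.inr j) ^ 2
        = ∑ j ∈ Finset.univ.map (Fin.castLEEmb (Nat.sub_le n 1)), beta x j ^ 2 := by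
      rw [Finset.sum_map]
      exact Finset.sum_congr rfl fun j _ => by rw [← beta_inNode x]; rfl
    rw [h1]
    exact Finset.sum_le_sum_of_subset_of_nonneg (Finset.subset_univ _) fun _ _ _ => sq_nonneg _
  have hβ2 : n * ∑ j, beta x j ^ 2 ≤ 2 * F + 2 * n * ∑ i, x (Sum.inl i) ^ 2 := by
    have : ∑ _i : Fin n, ∑ j, beta x j ^ 2 ≤
        ∑ i : Fin n, ∑ j, (2 * (x (Sum.inl i) + beta x j) ^ 2 + 2 * x (Sum.inl i) ^ 2) := by
      refine Finset.sum_le_sum fun i _ => Finset.sum_le_sum fun j _ => ?_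
      nlinarith [sq_nonneg (2 * x (Sum.inl i) + beta x j)]
    simp only [Finset.sum_add_distrib, ← Finset.mul_sum, Finset.sum_const, Finset.card_univ,
      Fintype.card_fin, nsmul_eq_mul] at this
    linarith
  have hF0 : 0 ≤ F := by positivity
  have hβ3 : ∑ j, beta x j ^ 2 ≤ 4 * F := by
    have h3 : (3 : ℝ) ≤ n := by exact_mod_cast hn
    have : n * ∑ j, beta x j ^ 2 ≤ n * (4 * F) := by nlinarith
    exact le_of_mul_le_mul_left this hn0
  rw [Fintype.sum_sum_type]
  have : 50 / m * bil W (degreeEffect x) (degreeEffect x)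
      = 5 * (10 / m * bil W (degreeEffect x) (degreeEffect x)) := by ring
  rw [this]
  linarith

lemma V_mul_inv (hn : 3 ≤ n) (hW : IsWeight (wgt Z θ γ) m) : V Z θ γ * (V Z θ γ)⁻¹ = 1 := by
  apply Matrix.mul_nonsing_inv
  rw [← Matrix.isUnit_iff_isUnit_det, ← Matrix.mulVec_injective_iff_isUnit]
  intro x y hxy
  have h0 : V Z θ γ *ᵥ (x - y) = 0 := by rw [Matrix.mulVec_sub]; exact sub_eq_zero.2 hxy
  have h1 := dotProduct_V_mulVec Z θ γ (x - y) (x - y)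
  rw [h0, dotProduct_zero] at h1
  have h2 := sum_sq_le_bil_degreeEffect hn hW (x - y)
  rw [← h1, mul_zero] at h2
  have h3 := (Finset.sum_eq_zero_iff_of_nonneg fun r _ => sq_nonneg ((x - y) r)).1
    (le_antisymm h2 (Finset.sum_nonneg fun r _ => sq_nonneg _))
  funext r
  have := h3 r (Finset.mem_univ r)
  exact sub_eq_zero.1 (pow_eq_zero_iff two_ne_zero |>.1 this)

/-- Riesz representation for the bilinear form of `V`. -/
lemma bil_degreeEffect_inv_mulVec (hn : 3 ≤ n) (hW : IsWeight (wgt Z θ γ) m)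
    (b y : Idx n → ℝ) :
    bil (wgt Z θ γ) (degreeEffect ((V Z θ γ)⁻¹ *ᵥ b)) (degreeEffect y) = b ⬝ᵥ y := by
  rw [← dotProduct_V_mulVec, Matrix.mulVec_mulVec, V_mul_inv hn hW, Matrix.one_mulVec,
    dotProduct_comm]

variable (Z θ γ)

/-- Coefficients of the projection of the `l`-th covariate on the span of the design. -/
def covProj (l : Fin p) : Idx n → ℝ := (V Z θ γ)⁻¹ *ᵥ (Vmixed Z θ γ l)

/-- The `l`-th covariate after projection orthogonally to the design. -/
def covRes (l : Fin p) : Fin n → Fin n → ℝ := covFun Z l - degreeEffect (covProj Z θ γ l)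

variable {Z θ γ}

lemma bil_covProj (hn : 3 ≤ n) (hW : IsWeight (wgt Z θ γ) m) (l : Fin p) (y : Idx n → ℝ) :
    bil (wgt Z θ γ) (degreeEffect (covProj Z θ γ l)) (degreeEffect y) =
      bil (wgt Z θ γ) (covFun Z l) (degreeEffect y) := by
  rw [covProj, bil_degreeEffect_inv_mulVec hn hW, bil_degreeEffect_right]
  exact Finset.sum_congr rfl fun r _ => by rw [Vmixed_apply, mul_comm]

lemma bil_covRes_degreeEffect (hn : 3 ≤ n) (hW : IsWeight (wgt Z θ γ) m) (l : Fin p)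
    (y : Idx n → ℝ) : bil (wgt Z θ γ) (covRes Z θ γ l) (degreeEffect y) = 0 := by
  rw [covRes, bil_sub_left, bil_covProj hn hW, sub_self]

/-- A Schur complement is the Gram matrix of the residuals: a residual is orthogonal to the design,
so the other residual may be replaced by the raw covariate, and the symmetry of V⁻¹ identifies what
is left. The assumptions on H thus become statements about energies of residuals. -/
lemma H_apply (hn : 3 ≤ n) (hW : IsWeight (wgt Z θ γ) m) (l l' : Fin p) :
    H Z θ γ l l' = bil (wgt Z θ γ) (covRes Z θ γ l) (covRes Z θ γ l') := by
  have h1 : bil (wgt Z θ γ) (covRes Z θ γ l) (covRes Z θ γ l') =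
      bil (wgt Z θ γ) (covRes Z θ γ l) (covFun Z l') := by
    conv_lhs => rw [covRes.eq_def Z θ γ l', bil_sub_right, bil_covRes_degreeEffect hn hW, sub_zero]
  rw [h1, covRes, bil_sub_left, H, Matrix.sub_apply, Vcov_apply]
  congr 1
  rw [bil_comm, bil_degreeEffect_right, Matrix.mul_assoc, Matrix.mul_apply]
  have hsymm : ((V Z θ γ)⁻¹)ᵀ = (V Z θ γ)⁻¹ := by
    rw [Matrix.transpose_nonsing_inv, V_transpose]
  have h2 : ∀ c, ((V Z θ γ)⁻¹ * (Vmixed Z θ γ)ᵀ) c l' = covProj Z θ γ l' c := fun c => rfl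
  have h3 : ∑ c, Vmixed Z θ γ l c * covProj Z θ γ l' c
      = ∑ c, covProj Z θ γ l c * Vmixed Z θ γ l' c := by
    change Vmixed Z θ γ l ⬝ᵥ ((V Z θ γ)⁻¹ *ᵥ Vmixed Z θ γ l')
      = ((V Z θ γ)⁻¹ *ᵥ Vmixed Z θ γ l) ⬝ᵥ Vmixed Z θ γ l'
    rw [Matrix.dotProduct_mulVec, ← Matrix.mulVec_transpose, hsymm]
  simp only [h2, h3]
  exact Finset.sum_congr rfl fun c _ => by rw [Vmixed_apply]

end info

/-! ### Bounds from the normal equations -/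

section normal

variable {W : Fin n → Fin n → ℝ} {m : ℝ}

lemma IsWeight.le_quarter (hW : IsWeight W m) (hn : 3 ≤ n) : m ≤ 1 / 4 := by
  have h : (⟨0, by omega⟩ : Fin n) ≠ ⟨1, by omega⟩ := by simp
  exact (hW.lower _ _ h).trans (hW.upper _ _)

lemma IsWeight.row_ge (hW : IsWeight W m) (i : Fin n) : (n - 1) * m ≤ ∑ j, W i j := by
  have h1 : ∑ j ∈ Finset.univ.erase i, m ≤ ∑ j ∈ Finset.univ.erase i, W i j :=
    Finset.sum_le_sum fun j hj => hW.lower i j (Finset.ne_of_mem_erase hj).symm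
  have h2 : ∑ j ∈ Finset.univ.erase i, W i j ≤ ∑ j, W i j :=
    Finset.sum_le_sum_of_subset_of_nonneg (Finset.erase_subset _ _) fun j _ _ => hW.nonneg i j
  rw [Finset.sum_const, Finset.card_erase_of_mem (Finset.mem_univ i), Finset.card_univ,
    Fintype.card_fin, nsmul_eq_mul, Nat.cast_sub (by have := i.2; omega)] at h1
  push_cast at h1
  linarith

lemma IsWeight.swap (hW : IsWeight W m) : IsWeight (fun i j => W j i) m :=
  ⟨hW.pos, hW.diag, fun i j h => hW.lower j i h.symm, fun i j => hW.upper j i⟩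

lemma IsWeight.row_le (hW : IsWeight W m) (i : Fin n) : ∑ j, W i j ≤ n / 4 := by
  calc ∑ j, W i j ≤ ∑ _j : Fin n, (1 / 4 : ℝ) := Finset.sum_le_sum fun j _ => hW.upper i j
    _ = n / 4 := by simp; ring

/-- If the weighted row sums of `αᵢ + βⱼ - fᵢⱼ` vanish, then `α` is bounded by the size of `f` and
the energy of `α + β`. -/
lemma abs_le_of_row_eq (hn : 3 ≤ n) (hW : IsWeight W m) {α β : Fin n → ℝ}
    {f : Fin n → Fin n → ℝ} {q : ℝ} (hq : 0 ≤ q) (hf : ∀ i j, i ≠ j → |f i j| ≤ q)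
    (hrow : ∀ i, ∑ j, W i j * (α i + β j) = ∑ j, W i j * f i j)
    (hβ : ∑ j, β j ^ 2 ≤ 5 / 2 * n * q ^ 2 / m) (i : Fin n) : |α i| ≤ q / m ^ 2 := by
  have hm := hW.pos
  have hm4 := hW.le_quarter hn
  have h3 : (3 : ℝ) ≤ n := by exact_mod_cast hn
  set v := ∑ j, W i j with hv
  have hvlow : (n - 1) * m ≤ v := hW.row_ge i
  have hv0 : 0 < v := lt_of_lt_of_le (by nlinarith) hvlow
  have h1 : α i * v = ∑ j, W i j * (f i j - β j) := by
    have := hrow i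
    simp only [mul_add, mul_sub, Finset.sum_add_distrib, Finset.sum_sub_distrib,
      ← Finset.sum_mul] at this ⊢
    linarith
  have h2 : |α i| * v ≤ v * q + 1 / 4 * ∑ j, |β j| := by
    rw [← abs_of_pos hv0, ← abs_mul, h1, abs_of_pos hv0]
    calc |∑ j, W i j * (f i j - β j)| ≤ ∑ j, |W i j * (f i j - β j)| :=
          Finset.abs_sum_le_sum_abs _ _
      _ ≤ ∑ j, (W i j * q + 1 / 4 * |β j|) := by
          refine Finset.sum_le_sum fun j _ => ?_
          rw [abs_mul, abs_of_nonneg (hW.nonneg i j)]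
          rcases eq_or_ne i j with rfl | hij
          · rw [hW.diag]; simp
          · have := abs_sub (f i j) (β j)
            have h4 := hf i j hij
            nlinarith [hW.nonneg i j, hW.upper i j, abs_nonneg (β j)]
      _ = _ := by rw [Finset.sum_add_distrib, ← Finset.sum_mul, ← Finset.mul_sum]
  have h4 : (∑ j, |β j|) ^ 2 ≤ n * ∑ j, β j ^ 2 := by
    have := sq_sum_le_card_mul_sum_sq (s := (Finset.univ : Finset (Fin n))) (f := fun j => |β j|)
    simpa using this
  have h5 : ∑ j, |β j| ≤ n * q / m := by
    apply abs_le_of_sq_le_sq' _ (by positivity) |>.2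
    refine h4.trans ?_
    calc (n : ℝ) * ∑ j, β j ^ 2 ≤ n * (5 / 2 * n * q ^ 2 / m) := by gcongr
      _ = (5 / 2 * m) * (n * q / m) ^ 2 := by field_simp
      _ ≤ 1 * (n * q / m) ^ 2 := by gcongr; linarith
      _ = _ := one_mul _
  -- From n ≥ 3 the row weight is at least 2nm/3, so the parameters of the other nodes contribute at
  -- most 3/8 of q/m². The function f contributes at most 1/16 of it, as m ≤ 1/4. The sum stays
  -- below 1.
  have h6 : 1 / 4 * (n * q / m) ≤ v * (3 / 8 * (q / m ^ 2)) := by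
    have : (n : ℝ) * (2 / 3) * m ≤ v := by nlinarith
    calc 1 / 4 * (n * q / m) = (n : ℝ) * (2 / 3) * m * (3 / 8 * (q / m ^ 2)) := by
          field_simp; ring
      _ ≤ _ := by gcongr
  have h7 : q ≤ 1 / 16 * (q / m ^ 2) := by
    have : m ^ 2 ≤ 1 / 16 := by nlinarith
    rw [← mul_div_assoc, le_div_iff₀ (by positivity)]
    nlinarith
  have h8 : |α i| * v ≤ (q / m ^ 2) * v := by
    have : 0 ≤ q / m ^ 2 := by positivity
    nlinarith
  exact le_of_mul_le_mul_right h8 hv0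

/-- Sup-norm bound for the coefficients of the projection of a bounded function on the functions
`αᵢ + βⱼ`, in the centred gauge. -/
lemma abs_le_of_normal_eq (hn : 3 ≤ n) (hW : IsWeight W m) {α β : Fin n → ℝ}
    {f : Fin n → Fin n → ℝ} {q : ℝ} (hq : 0 ≤ q) (hf : ∀ i j, i ≠ j → |f i j| ≤ q)
    (hrow : ∀ i, ∑ j, W i j * (α i + β j) = ∑ j, W i j * f i j)
    (hcol : ∀ j, ∑ i, W i j * (α i + β j) = ∑ i, W i j * f i j)
    (hg : ∑ i, α i = ∑ j, β j) (i : Fin n) : |α i| ≤ q / m ^ 2 ∧ |β i| ≤ q / m ^ 2 := by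
  have hm := hW.pos
  have hn0 : (0 : ℝ) < n := by exact_mod_cast (by omega : 0 < n)
  -- Pairing the row equations with α and the column equations with β says that α + β is the
  -- projection of f, so its energy does not exceed that of f.
  have hproj : bil W (addFun α β) (addFun α β) = bil W f (addFun α β) := by
    have e : ∀ g : Fin n → Fin n → ℝ, bil W g (addFun α β) =
        ∑ i, α i * ∑ j, W i j * g i j + ∑ j, β j * ∑ i, W i j * g i j := by
      intro g
      simp only [bil, addFun, Finset.mul_sum]
      rw [Finset.sum_comm (f := fun j i => β j * (W i j * g i j)), ← Finset.sum_add_distrib]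
      refine Finset.sum_congr rfl fun i _ => ?_
      rw [← Finset.sum_add_distrib]
      exact Finset.sum_congr rfl fun j _ => by ring
    rw [e, e]
    simp only [addFun, hrow, hcol]
  have hE : bil W (addFun α β) (addFun α β) ≤ n ^ 2 * q ^ 2 / 4 := by
    have h1 := bil_sq_le hW f (addFun α β)
    rw [← hproj, sq] at h1
    have h2 := bil_self_le_of_abs_le hW f hf
    have h0 := bil_self_nonneg hW (addFun α β)
    rcases h0.eq_or_lt with h | h
    · rw [← h]; positivity
    · exact (le_of_mul_le_mul_right h1 h).trans h2
  have hc := sum_sq_le_centered hn hW α β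
  rw [hg, sub_self] at hc
  have hs : ∑ i, α i ^ 2 + ∑ j, β j ^ 2 ≤ 5 / 2 * n * q ^ 2 / m := by
    have : n * (∑ i, α i ^ 2 + ∑ j, β j ^ 2) ≤ n * (5 / 2 * n * q ^ 2 / m) := by
      calc _ ≤ 10 / m * bil W (addFun α β) (addFun α β) := by simpa using hc
        _ ≤ 10 / m * (n ^ 2 * q ^ 2 / 4) := by gcongr
        _ = _ := by ring
    exact le_of_mul_le_mul_left this hn0
  have ha0 : 0 ≤ ∑ i, α i ^ 2 := Finset.sum_nonneg fun _ _ => sq_nonneg _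
  have hb0 : 0 ≤ ∑ i, β i ^ 2 := Finset.sum_nonneg fun _ _ => sq_nonneg _
  refine ⟨abs_le_of_row_eq hn hW hq hf hrow (by linarith) i,
    abs_le_of_row_eq hn hW.swap hq (f := fun i j => f j i) (fun i j h => hf j i h.symm) (α := β)
      (β := α) (fun j => ?_) (by linarith) i⟩
  have := hcol j
  simpa only [add_comm] using this

end normal

end

/-! ### Covariates projected off the design, and duality with `H` -/

section

variable {n p : ℕ}

/-- The vector `θ` with `αᵢ + βⱼ` as degree effects, normalised at the last node `N`. -/
def ofAdd (N : Fin n) (α β : Fin n → ℝ) : Idx n → ℝ :=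
  Sum.elim (fun i => α i + β N) (fun j => β (inNode j) - β N)

lemma beta_ofAdd {N : Fin n} (hN : (N : ℕ) = n - 1) (α β : Fin n → ℝ) (j : Fin n) :
    beta (ofAdd N α β) j = β j - β N := by
  by_cases h : (j : ℕ) < n - 1
  · have : inNode ⟨j, h⟩ = j := rfl
    simp [beta, h, ofAdd, this]
  · have : j = N := Fin.ext (by have := j.2; omega)
    rw [beta, dif_neg h, this, sub_self]

lemma degreeEffect_ofAdd {N : Fin n} (hN : (N : ℕ) = n - 1) (α β : Fin n → ℝ) :
    degreeEffect (ofAdd N α β) = addFun α β := by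
  funext i j
  rw [degreeEffect, beta_ofAdd hN]
  simp only [ofAdd, Sum.elim_inl, addFun]
  ring

lemma bil_addFun_right (W g : Fin n → Fin n → ℝ) (α β : Fin n → ℝ) :
    bil W g (addFun α β) =
      ∑ i, α i * ∑ j, W i j * g i j + ∑ j, β j * ∑ i, W i j * g i j := by
  simp only [bil, addFun, Finset.mul_sum]
  rw [Finset.sum_comm (f := fun j i => β j * (W i j * g i j)), ← Finset.sum_add_distrib]
  refine Finset.sum_congr rfl fun i _ => ?_
  rw [← Finset.sum_add_distrib]
  exact Finset.sum_congr rfl fun j _ => by ring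

section info

variable {Z : Fin n → Fin n → Fin p → ℝ} {θ : Idx n → ℝ} {γ : Fin p → ℝ} {m q Λ : ℝ}

lemma isWeight_wgt {ρ : ℝ} (h : ∀ i j, i ≠ j → |logit Z θ γ i j| ≤ ρ) :
    IsWeight (wgt Z θ γ) (Real.exp (-ρ) / 4) where
  pos := by positivity
  diag i := by simp [wgt]
  lower i j hij := by
    rw [wgt, if_neg hij]
    refine le_trans ?_ (exp_neg_abs_le_sigw (logit Z θ γ i j))
    have := Real.exp_le_exp.2 (neg_le_neg (h i j hij))
    linarith
  upper i j := by
    unfold wgt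
    split_ifs
    · norm_num
    · exact sigw_le _

lemma exists_last (hn : 3 ≤ n) : ∃ N : Fin n, (N : ℕ) = n - 1 := ⟨⟨n - 1, by omega⟩, rfl⟩

/-- A centred representation of the projection of a covariate, with its sup-norm bound. -/
lemma exists_centered_covProj (hn : 3 ≤ n) (hW : IsWeight (wgt Z θ γ) m) (hq : 0 ≤ q)
    (hZ : ∀ i j, i ≠ j → ∀ l, |Z i j l| ≤ q) (l : Fin p) :
    ∃ α β : Fin n → ℝ, degreeEffect (covProj Z θ γ l) = addFun α β ∧ ∑ i, α i = ∑ j, β j ∧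
      (∀ r, covProj Z θ γ l r = Sum.elim (fun i => α i + β ⟨n - 1, by omega⟩)
        (fun j => β (inNode j) - β ⟨n - 1, by omega⟩) r) ∧
      ∀ i, |α i| ≤ q / m ^ 2 ∧ |β i| ≤ q / m ^ 2 := by
  have hn0 : (n : ℝ) ≠ 0 := by exact_mod_cast (by omega : n ≠ 0)
  set x := covProj Z θ γ l with hx
  -- The shift solves ∑(α + t) = ∑(β - t); shifting does not change the function on edges.
  set t : ℝ := (∑ j, beta x j - ∑ i, x (Sum.inl i)) / (2 * n) with ht
  set α : Fin n → ℝ := fun i => x (Sum.inl i) + t with hα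
  set β : Fin n → ℝ := fun j => beta x j - t with hβ
  have hD : degreeEffect x = addFun α β := by
    funext i j; simp only [degreeEffect, addFun, hα, hβ]; ring
  have hg : ∑ i, α i = ∑ j, β j := by
    simp only [hα, hβ, Finset.sum_add_distrib, Finset.sum_sub_distrib, Finset.sum_const,
      Finset.card_univ, Fintype.card_fin, nsmul_eq_mul, ht]
    field_simp
    ring
  have hlast : beta x ⟨n - 1, by omega⟩ = 0 := by simp [beta]
  have hN : ((⟨n - 1, by omega⟩ : Fin n) : ℕ) = n - 1 := rfl
  -- Every function a_i + b_j lies in the span of the design, the indicator of the last column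
  -- included, although node n has no in-parameter. Single rows and columns as test functions then
  -- give all 2n normal equations.
  have horth : ∀ a b : Fin n → ℝ, bil (wgt Z θ γ) (addFun α β) (addFun a b)
      = bil (wgt Z θ γ) (covFun Z l) (addFun a b) := by
    intro a b
    rw [← degreeEffect_ofAdd hN a b, ← hD]
    exact bil_covProj hn hW l _
  refine ⟨α, β, hD, hg, ?_, ?_⟩
  · rintro (i | j)
    · simp [hα, hβ, hlast]
    · simp [hα, hβ, hlast, beta_inNode]
  · refine abs_le_of_normal_eq hn hW hq (f := covFun Z l) (fun i j hij => hZ i j hij l) ?_ ?_ hg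
    · intro i
      have := horth (Pi.single i 1) 0
      simpa [bil_addFun_right, Pi.single_apply, addFun] using this
    · intro i
      have := horth 0 (Pi.single i 1)
      simpa [bil_addFun_right, Pi.single_apply, addFun] using this

lemma abs_covProj_le (hn : 3 ≤ n) (hW : IsWeight (wgt Z θ γ) m) (hq : 0 ≤ q)
    (hZ : ∀ i j, i ≠ j → ∀ l, |Z i j l| ≤ q) (l : Fin p) (r : Idx n) :
    |covProj Z θ γ l r| ≤ 2 * q / m ^ 2 := by
  obtain ⟨α, β, -, -, hr, hb⟩ := exists_centered_covProj hn hW hq hZ l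
  rw [hr, mul_div_assoc]
  rcases r with i | j
  · exact (abs_add_le _ _).trans (by linarith [(hb i).1, (hb ⟨n - 1, by omega⟩).2])
  · exact (abs_sub _ _).trans
      (by linarith [(hb (inNode j)).2, (hb ⟨n - 1, by omega⟩).2])

lemma abs_covRes_le (hn : 3 ≤ n) (hW : IsWeight (wgt Z θ γ) m) (hq : 0 ≤ q)
    (hZ : ∀ i j, i ≠ j → ∀ l, |Z i j l| ≤ q) (l : Fin p) {i j : Fin n} (hij : i ≠ j) :
    |covRes Z θ γ l i j| ≤ 3 * q / m ^ 2 := by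
  obtain ⟨α, β, hD, -, -, hb⟩ := exists_centered_covProj hn hW hq hZ l
  have hm := hW.pos
  have hm4 := hW.le_quarter hn
  have h7 : q ≤ q / m ^ 2 := by
    have : m ^ 2 ≤ 1 := by nlinarith
    rw [le_div_iff₀ (by positivity)]
    nlinarith
  rw [covRes, hD]
  simp only [Pi.sub_apply, addFun, covFun]
  have h1 := abs_sub (Z i j l) (α i + β j)
  have h2 := abs_add_le (α i) (β j)
  have h3 := hZ i j hij l
  rw [mul_div_assoc]
  linarith [(hb i).1, (hb j).2]

variable (Z θ γ)

/-- The residual `∑ₗ cₗ τₗ` of the covariate combination `c`. -/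
def resFun (c : Fin p → ℝ) : Fin n → Fin n → ℝ := ∑ l, c l • covRes Z θ γ l

/-- The projection coefficients of the covariate combination `c`. -/
def combProj (c : Fin p → ℝ) : Idx n → ℝ := ∑ l, c l • covProj Z θ γ l

/-- The covariate combination `(i, j) ↦ Zᵢⱼᵀ c`. -/
def covComb (c : Fin p → ℝ) (i j : Fin n) : ℝ := Z i j ⬝ᵥ c

variable {Z θ γ}

lemma covComb_eq_sum (c : Fin p → ℝ) : covComb Z c = ∑ l, c l • covFun Z l := by
  funext i j
  simp [covComb, dotProduct, covFun, Finset.sum_apply, mul_comm]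

lemma resFun_eq (c : Fin p → ℝ) :
    resFun Z θ γ c = covComb Z c - degreeEffect (combProj Z θ γ c) := by
  rw [covComb_eq_sum, combProj, degreeEffect_sum, ← Finset.sum_sub_distrib]
  refine Finset.sum_congr rfl fun l _ => ?_
  rw [degreeEffect_smul, ← smul_sub, covRes]

lemma bil_resFun_degreeEffect (hn : 3 ≤ n) (hW : IsWeight (wgt Z θ γ) m) (c : Fin p → ℝ)
    (y : Idx n → ℝ) : bil (wgt Z θ γ) (resFun Z θ γ c) (degreeEffect y) = 0 := by
  rw [resFun, bil_sum_left]
  exact Finset.sum_eq_zero fun l _ => by rw [bil_smul_left, bil_covRes_degreeEffect hn hW, mul_zero]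

lemma bil_resFun_resFun (hn : 3 ≤ n) (hW : IsWeight (wgt Z θ γ) m) (c c' : Fin p → ℝ) :
    bil (wgt Z θ γ) (resFun Z θ γ c) (resFun Z θ γ c') = c ⬝ᵥ (H Z θ γ *ᵥ c') := by
  simp only [resFun, bil_sum_left, bil_sum_right, bil_smul_left, bil_smul_right, dotProduct,
    Matrix.mulVec, H_apply hn hW]
  simp only [Finset.mul_sum]
  rw [Finset.sum_comm]
  refine Finset.sum_congr rfl fun l _ => ?_
  exact Finset.sum_congr rfl fun l' _ => by ring

/-- Pythagoras for the decomposition into the design part and the covariate residual. -/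
lemma bil_add_covComb_self (hn : 3 ≤ n) (hW : IsWeight (wgt Z θ γ) m) (x : Idx n → ℝ)
    (c : Fin p → ℝ) :
    bil (wgt Z θ γ) (degreeEffect x + covComb Z c) (degreeEffect x + covComb Z c) =
      bil (wgt Z θ γ) (degreeEffect (x + combProj Z θ γ c)) (degreeEffect (x + combProj Z θ γ c))
        + bil (wgt Z θ γ) (resFun Z θ γ c) (resFun Z θ γ c) := by
  have h : degreeEffect x + covComb Z c =
      degreeEffect (x + combProj Z θ γ c) + resFun Z θ γ c := by
    rw [resFun_eq, degreeEffect_add]; abel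
  rw [h, bil_add_left, bil_add_right, bil_add_right, bil_resFun_degreeEffect hn hW,
    bil_comm _ _ (resFun Z θ γ c), bil_resFun_degreeEffect hn hW]
  ring

lemma abs_covComb_le (hZ : ∀ i j, i ≠ j → ∀ l, |Z i j l| ≤ q) (c : Fin p → ℝ) {b : ℝ}
    (hc : ∀ l, |c l| ≤ b) {i j : Fin n} (hij : i ≠ j) : |covComb Z c i j| ≤ p * q * b := by
  calc |∑ l, Z i j l * c l| ≤ ∑ l, |Z i j l * c l| := Finset.abs_sum_le_sum_abs _ _
    _ ≤ ∑ _l : Fin p, q * b := by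
        refine Finset.sum_le_sum fun l _ => ?_
        rw [abs_mul]
        exact mul_le_mul (hZ i j hij l) (hc l) (abs_nonneg _)
          ((abs_nonneg _).trans (hZ i j hij l))
    _ = p * q * b := by simp; ring

variable (Z θ γ)

/-- The columns of `H⁻¹`. -/
def invCol (l : Fin p) : Fin p → ℝ := (H Z θ γ)⁻¹ *ᵥ Pi.single l 1

variable {Z θ γ}

lemma abs_sum_row_le_rowSumNorm (A : Matrix (Fin p) (Fin p) ℝ) (l : Fin p) :
    ∑ c, |A l c| ≤ rowSumNorm A :=
  le_ciSup (f := fun r => ∑ c, |A r c|) (Set.finite_range _).bddAbove l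

/-- The energy of residuals is the quadratic form of H, so a column of H⁻¹ represents the
corresponding coordinate functional. With Cauchy–Schwarz this converts energy bounds into bounds for
single covariate coefficients. -/
lemma bil_resFun_invCol (hn : 3 ≤ n) (hW : IsWeight (wgt Z θ γ) m) (hH : (H Z θ γ).PosDef)
    (c : Fin p → ℝ) (l : Fin p) :
    bil (wgt Z θ γ) (resFun Z θ γ c) (resFun Z θ γ (invCol Z θ γ l)) = c l := by
  rw [bil_resFun_resFun hn hW, invCol, Matrix.mulVec_mulVec,
    Matrix.mul_nonsing_inv _ ((Matrix.isUnit_iff_isUnit_det _).1 hH.isUnit), Matrix.one_mulVec]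
  simp

/-- H⁻¹ is symmetric, so a bound on absolute row sums is also one on absolute column sums. -/
lemma sum_abs_invCol_le (hH : (H Z θ γ).PosDef) (hΛ : rowSumNorm (H Z θ γ)⁻¹ ≤ Λ) (l : Fin p) :
    ∑ l', |invCol Z θ γ l l'| ≤ Λ := by
  refine le_trans (le_of_eq ?_) ((abs_sum_row_le_rowSumNorm _ l).trans hΛ)
  refine Finset.sum_congr rfl fun l' _ => ?_
  have h := hH.inv.isHermitian.apply l l'
  rw [invCol, Matrix.mulVec_single_one, Matrix.col_apply]
  rw [← h]
  simp

lemma bil_resFun_invCol_self_le (hn : 3 ≤ n) (hW : IsWeight (wgt Z θ γ) m)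
    (hH : (H Z θ γ).PosDef) (hΛ : rowSumNorm (H Z θ γ)⁻¹ ≤ Λ) (l : Fin p) :
    bil (wgt Z θ γ) (resFun Z θ γ (invCol Z θ γ l)) (resFun Z θ γ (invCol Z θ γ l)) ≤ Λ := by
  rw [bil_resFun_invCol hn hW hH]
  refine (le_abs_self _).trans (le_trans ?_ (sum_abs_invCol_le hH hΛ l))
  exact Finset.single_le_sum (f := fun l' => |invCol Z θ γ l l'|) (fun _ _ => abs_nonneg _)
    (Finset.mem_univ l)

lemma sq_le_mul_bil_resFun (hn : 3 ≤ n) (hW : IsWeight (wgt Z θ γ) m)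
    (hH : (H Z θ γ).PosDef) (hΛ : rowSumNorm (H Z θ γ)⁻¹ ≤ Λ) (c : Fin p → ℝ) (l : Fin p) :
    c l ^ 2 ≤ Λ * bil (wgt Z θ γ) (resFun Z θ γ c) (resFun Z θ γ c) := by
  have h := bil_sq_le hW (resFun Z θ γ c) (resFun Z θ γ (invCol Z θ γ l))
  rw [bil_resFun_invCol hn hW hH] at h
  refine h.trans ?_
  rw [mul_comm]
  exact mul_le_mul_of_nonneg_right (bil_resFun_invCol_self_le hn hW hH hΛ l)
    (bil_self_nonneg hW _)

lemma bil_covRes_self_le (hn : 3 ≤ n) (hW : IsWeight (wgt Z θ γ) m)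
    (hZ : ∀ i j, i ≠ j → ∀ l, |Z i j l| ≤ q) (l : Fin p) :
    bil (wgt Z θ γ) (covRes Z θ γ l) (covRes Z θ γ l) ≤ n ^ 2 * q ^ 2 / 4 := by
  have h1 : covFun Z l = covRes Z θ γ l + degreeEffect (covProj Z θ γ l) := by
    rw [covRes]; abel
  have h2 := bil_self_le_of_abs_le hW (covFun Z l) (fun i j hij => hZ i j hij l)
  rw [h1, bil_add_left, bil_add_right, bil_add_right, bil_comm _ (degreeEffect _) (covRes Z θ γ l),
    bil_covRes_degreeEffect hn hW] at h2
  have := bil_self_nonneg hW (degreeEffect (covProj Z θ γ l))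
  linarith

/-- The coordinate bound for a unit vector meets the upper bound n²q²/4 for the energy of one
residual. With Λ = λ/n² this reads λq² ≥ 4, which later allows lower-order terms without the factor
λq² to be absorbed. -/
lemma four_le_of_rowSumNorm_le (hn : 3 ≤ n) (hW : IsWeight (wgt Z θ γ) m)
    (hZ : ∀ i j, i ≠ j → ∀ l, |Z i j l| ≤ q) (hH : (H Z θ γ).PosDef)
    (hΛ : rowSumNorm (H Z θ γ)⁻¹ ≤ Λ) (l : Fin p) : 4 ≤ Λ * n ^ 2 * q ^ 2 := by
  have h1 := sq_le_mul_bil_resFun hn hW hH hΛ (Pi.single l 1) l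
  have h2 : resFun Z θ γ (Pi.single l 1) = covRes Z θ γ l := by
    rw [resFun, Finset.sum_eq_single l]
    · simp
    · intro b _ hb; simp [hb]
    · simp
  rw [h2, Pi.single_eq_same] at h1
  have h3 := bil_covRes_self_le hn hW hZ l
  have h0 : 0 ≤ Λ := (bil_self_nonneg hW _).trans (bil_resFun_invCol_self_le hn hW hH hΛ l)
  nlinarith

end info

end

section

variable {n p : ℕ}

/-! ### A convex variational problem -/

/-- Increments of the edge probabilities when the linear predictor moves from `x` to `x + h`. -/
def probInc (x h : Fin n → Fin n → ℝ) (i j : Fin n) : ℝ :=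
  if i = j then 0 else sigm (x i j + h i j) - sigm (x i j)

/-- The increment of the linear predictor caused by increments of all parameters. -/
def predInc (Z : Fin n → Fin n → Fin p → ℝ) (Δ : (Fin n → ℝ) × (Fin n → ℝ) × (Fin p → ℝ)) :
    Fin n → Fin n → ℝ := addFun Δ.1 Δ.2.1 + covComb Z Δ.2.2

/-- The pairing with a score vector. -/
def scorePair (U Δ : (Fin n → ℝ) × (Fin n → ℝ) × (Fin p → ℝ)) : ℝ :=
  U.1 ⬝ᵥ Δ.1 + U.2.1 ⬝ᵥ Δ.2.1 + U.2.2 ⬝ᵥ Δ.2.2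

/-- The defect `∑ α - ∑ β` of the centred gauge. -/
def gaugeDefect (Δ : (Fin n → ℝ) × (Fin n → ℝ) × (Fin p → ℝ)) : ℝ := ∑ i, Δ.1 i - ∑ j, Δ.2.1 j

/-- The penalised negative log-likelihood as a function of the increments. -/
def objective (Z : Fin n → Fin n → Fin p → ℝ) (x : Fin n → Fin n → ℝ)
    (U Δ : (Fin n → ℝ) × (Fin n → ℝ) × (Fin p → ℝ)) : ℝ :=
  (∑ i, ∑ j, if i = j then 0 else
      softplus (x i j + predInc Z Δ i j) - sigm (x i j) * predInc Z Δ i j)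
    + gaugeDefect Δ ^ 2 / 2 - scorePair U Δ

/-- The directional derivative of `objective` at `Δ`. -/
def objectiveDeriv (Z : Fin n → Fin n → Fin p → ℝ) (x : Fin n → Fin n → ℝ)
    (U Δ d : (Fin n → ℝ) × (Fin n → ℝ) × (Fin p → ℝ)) : ℝ :=
  (∑ i, ∑ j, probInc x (predInc Z Δ) i j * predInc Z d i j)
    + gaugeDefect Δ * gaugeDefect d - scorePair U d

section vi

variable (Z : Fin n → Fin n → Fin p → ℝ) (x : Fin n → Fin n → ℝ)
  (U : (Fin n → ℝ) × (Fin n → ℝ) × (Fin p → ℝ))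

lemma predInc_add_smul (Δ d : (Fin n → ℝ) × (Fin n → ℝ) × (Fin p → ℝ)) (t : ℝ) (i j : Fin n) :
    predInc Z (Δ + t • d) i j = predInc Z Δ i j + t * predInc Z d i j := by
  simp only [predInc, addFun, covComb, Pi.add_apply, Prod.fst_add, Prod.snd_add, Prod.smul_fst,
    Prod.smul_snd, Pi.smul_apply, smul_eq_mul, dotProduct_add, dotProduct_smul]
  ring

lemma gaugeDefect_add_smul (Δ d : (Fin n → ℝ) × (Fin n → ℝ) × (Fin p → ℝ)) (t : ℝ) :
    gaugeDefect (Δ + t • d) = gaugeDefect Δ + t * gaugeDefect d := by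
  simp only [gaugeDefect, Pi.add_apply, Prod.fst_add, Prod.snd_add, Prod.smul_fst,
    Prod.smul_snd, Pi.smul_apply, smul_eq_mul, Finset.sum_add_distrib, ← Finset.mul_sum]
  ring

lemma scorePair_add_smul (Δ d : (Fin n → ℝ) × (Fin n → ℝ) × (Fin p → ℝ)) (t : ℝ) :
    scorePair U (Δ + t • d) = scorePair U Δ + t * scorePair U d := by
  simp only [scorePair, Prod.fst_add, Prod.snd_add, Prod.smul_fst,
    Prod.smul_snd, dotProduct_add, dotProduct_smul, smul_eq_mul]
  ring

lemma objectiveDeriv_smul (Δ d : (Fin n → ℝ) × (Fin n → ℝ) × (Fin p → ℝ)) (t : ℝ) :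
    objectiveDeriv Z x U Δ (t • d) = t * objectiveDeriv Z x U Δ d := by
  have h1 := predInc_add_smul Z 0 d t
  have h2 := gaugeDefect_add_smul 0 d t
  have h3 := scorePair_add_smul U 0 d t
  have e1 : ∀ i j, predInc Z 0 i j = 0 := fun i j => by simp [predInc, addFun, covComb]
  have e2 : gaugeDefect (0 : (Fin n → ℝ) × (Fin n → ℝ) × (Fin p → ℝ)) = 0 := by
    simp [gaugeDefect]
  have e3 : scorePair U 0 = 0 := by simp [scorePair]
  simp only [zero_add, e1, e2, e3] at h1 h2 h3
  simp only [objectiveDeriv, h1, h2, h3, mul_add, mul_sub, Finset.mul_sum]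
  congr 2
  · refine Finset.sum_congr rfl fun i _ => Finset.sum_congr rfl fun j _ => by ring
  · ring

lemma hasDerivAt_objective (Δ d : (Fin n → ℝ) × (Fin n → ℝ) × (Fin p → ℝ)) :
    HasDerivAt (fun t : ℝ => objective Z x U (Δ + t • d)) (objectiveDeriv Z x U Δ d) 0 := by
  simp only [objective, predInc_add_smul, gaugeDefect_add_smul, scorePair_add_smul]
  refine HasDerivAt.sub (HasDerivAt.add ?_ ?_) ?_
  · refine HasDerivAt.fun_sum fun i _ => HasDerivAt.fun_sum fun j _ => ?_
    unfold probInc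
    split_ifs
    · simpa using hasDerivAt_const (0 : ℝ) (0 : ℝ)
    · have h1 : HasDerivAt (fun t : ℝ => predInc Z Δ i j + t * predInc Z d i j)
          (predInc Z d i j) 0 := by
        simpa using ((hasDerivAt_id (0 : ℝ)).mul_const (predInc Z d i j)).const_add
          (predInc Z Δ i j)
      have h2 : HasDerivAt (fun t : ℝ => x i j + (predInc Z Δ i j + t * predInc Z d i j))
          (predInc Z d i j) 0 := h1.const_add (x i j)
      have h3 := (hasDerivAt_softplus
        (x i j + (predInc Z Δ i j + 0 * predInc Z d i j))).comp (0 : ℝ) h2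
      have h4 := h3.sub (h1.const_mul (sigm (x i j)))
      convert! h4 using 1
      simp only [zero_mul, add_zero]
      ring
  · have h1 : HasDerivAt (fun t : ℝ => gaugeDefect Δ + t * gaugeDefect d) (gaugeDefect d) 0 := by
      simpa using ((hasDerivAt_id (0 : ℝ)).mul_const (gaugeDefect d)).const_add
        (gaugeDefect Δ)
    have h2 := (h1.pow 2).div_const 2
    convert! h2 using 1
    simp
    ring
  · simpa using ((hasDerivAt_id (0 : ℝ)).mul_const (scorePair U d)).const_add (scorePair U Δ)

lemma continuous_objective : Continuous (objective Z x U) := by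
  have hs : Continuous softplus :=
    continuous_iff_continuousAt.2 fun y => (hasDerivAt_softplus y).continuousAt
  unfold objective
  refine Continuous.sub (Continuous.add ?_ ?_) ?_
  · refine continuous_finsetSum _ fun i _ => continuous_finsetSum _ fun j _ => ?_
    have hp : Continuous fun Δ : (Fin n → ℝ) × (Fin n → ℝ) × (Fin p → ℝ) =>
        predInc Z Δ i j := by
      simp only [predInc, addFun, covComb, Pi.add_apply, dotProduct]
      fun_prop
    split_ifs
    · exact continuous_const
    · exact (hs.comp (continuous_const.add hp)).sub (continuous_const.mul hp)
  · unfold gaugeDefect; fun_prop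
  · unfold scorePair dotProduct; fun_prop

lemma deriv_nonneg_of_forall_le {φ : ℝ → ℝ} {φ' : ℝ} (h : HasDerivAt φ φ' 0)
    (hmin : ∀ t, 0 < t → t ≤ 1 → φ 0 ≤ φ t) : 0 ≤ φ' := by
  have h1 := (hasDerivAt_iff_tendsto_slope.1 h).mono_left
    (nhdsWithin_mono (0 : ℝ) (fun t (ht : t ∈ Set.Ioi (0 : ℝ)) => ne_of_gt ht))
  refine ge_of_tendsto h1 ?_
  filter_upwards [Ioc_mem_nhdsGT (zero_lt_one : (0 : ℝ) < 1)] with t ht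
  rw [slope_def_field, sub_zero]
  exact div_nonneg (sub_nonneg.2 (hmin t ht.1 ht.2)) ht.1.le

/-- A minimiser of `objective` on a box satisfies a variational inequality. -/
lemma exists_variational_ineq {δ δ' : ℝ} (hδ : 0 ≤ δ) (hδ' : 0 ≤ δ') :
    ∃ Δ : (Fin n → ℝ) × (Fin n → ℝ) × (Fin p → ℝ),
      (‖Δ.1‖ ≤ δ ∧ ‖Δ.2.1‖ ≤ δ ∧ ‖Δ.2.2‖ ≤ δ') ∧
      ∀ d, (‖(Δ + d).1‖ ≤ δ ∧ ‖(Δ + d).2.1‖ ≤ δ ∧ ‖(Δ + d).2.2‖ ≤ δ') →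
        0 ≤ objectiveDeriv Z x U Δ d := by
  set K : Set ((Fin n → ℝ) × (Fin n → ℝ) × (Fin p → ℝ)) :=
    Metric.closedBall 0 δ ×ˢ (Metric.closedBall 0 δ ×ˢ Metric.closedBall 0 δ') with hK
  have hmem : ∀ Δ, Δ ∈ K ↔ (‖Δ.1‖ ≤ δ ∧ ‖Δ.2.1‖ ≤ δ ∧ ‖Δ.2.2‖ ≤ δ') := by
    intro Δ
    simp [hK, Set.mem_prod]
  have hcomp : IsCompact K :=
    (isCompact_closedBall _ _).prod ((isCompact_closedBall _ _).prod (isCompact_closedBall _ _))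
  have hconv : Convex ℝ K :=
    (convex_closedBall _ _).prod ((convex_closedBall _ _).prod (convex_closedBall _ _))
  have hne : K.Nonempty := ⟨0, (hmem 0).2 (by simp [hδ, hδ'])⟩
  -- On the compact box a minimiser exists without any coercivity; that it lies in the interior
  -- comes from the a priori bounds later.
  obtain ⟨Δ, hΔ, hmin⟩ := hcomp.exists_isMinOn hne (continuous_objective Z x U).continuousOn
  refine ⟨Δ, (hmem Δ).1 hΔ, fun d hd => ?_⟩
  refine deriv_nonneg_of_forall_le (hasDerivAt_objective Z x U Δ d) fun t ht0 ht1 => ?_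
  rw [zero_smul, add_zero]
  exact hmin (hconv.add_smul_mem hΔ ((hmem _).2 hd) ⟨ht0.le, ht1⟩)

end vi

end

section

variable {n p : ℕ}

/-! ### Existence and size of the solution of the score equations -/

/-- Two representations of the same function on edges, diagonal included, differ by a shift (t, -t),
which a score with equal totals does not see. This lets the gauge be changed inside pairings with
the score. -/
lemma dotProduct_add_eq_of_addFun_eq {u v α β α' β' : Fin n → ℝ} (huv : ∑ i, u i = ∑ j, v j)
    (h : addFun α β = addFun α' β') : u ⬝ᵥ α + v ⬝ᵥ β = u ⬝ᵥ α' + v ⬝ᵥ β' := by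
  rcases isEmpty_or_nonempty (Fin n) with hE | ⟨⟨k⟩⟩
  · simp [dotProduct]
  · have h1 : ∀ i j, α i + β j = α' i + β' j := fun i j => congrFun (congrFun h i) j
    have h2 : α = fun i => α' i + (β' k - β k) := by funext i; linarith [h1 i k]
    have h3 : β = fun j => β' j - (β' k - β k) := by funext j; linarith [h1 k j, h1 k k]
    have h4 : u ⬝ᵥ α = u ⬝ᵥ α' + (∑ i, u i) * (β' k - β k) := by
      conv_lhs => rw [h2]
      simp only [dotProduct, mul_add, Finset.sum_add_distrib, Finset.sum_mul]
    have h5 : v ⬝ᵥ β = v ⬝ᵥ β' - (∑ i, v i) * (β' k - β k) := by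
      conv_lhs => rw [h3]
      simp only [dotProduct, mul_sub, Finset.sum_sub_distrib, Finset.sum_mul]
    rw [h4, h5, huv]
    ring

lemma sq_dotProduct_add_le (u v α β : Fin n → ℝ) :
    (u ⬝ᵥ α + v ⬝ᵥ β) ^ 2 ≤
      (∑ i, u i ^ 2 + ∑ j, v j ^ 2) * (∑ i, α i ^ 2 + ∑ j, β j ^ 2) := by
  have := Finset.sum_mul_sq_le_sq_mul_sq (Finset.univ : Finset (Fin n ⊕ Fin n))
    (Sum.elim u v) (Sum.elim α β)
  simpa [Fintype.sum_sum_type, dotProduct] using this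

section solve

variable {Z : Fin n → Fin n → Fin p → ℝ} {θ : Idx n → ℝ} {γ : Fin p → ℝ} {m q Λ : ℝ}

lemma exists_probInc_eq {h : Fin n → Fin n → ℝ} {i j : Fin n} (hh : i ≠ j → |h i j| ≤ 1) :
    ∃ v, probInc (logit Z θ γ) h i j = v * h i j ∧ wgt Z θ γ i j / 3 ≤ v ∧
      v ≤ 3 * wgt Z θ γ i j := by
  unfold probInc wgt
  split_ifs with hij
  · exact ⟨0, by simp⟩
  · obtain ⟨v, h1, h2, h3, -⟩ := exists_sigm_sub_eq (logit Z θ γ i j) (h i j) (hh hij)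
    exact ⟨v, h1, h2, h3⟩

lemma bil_le_sum_probInc {h : Fin n → Fin n → ℝ} (hh : ∀ i j, i ≠ j → |h i j| ≤ 1) :
    bil (wgt Z θ γ) h h ≤ 3 * ∑ i, ∑ j, probInc (logit Z θ γ) h i j * h i j := by
  simp only [bil, Finset.mul_sum]
  refine Finset.sum_le_sum fun i _ => Finset.sum_le_sum fun j _ => ?_
  obtain ⟨v, h1, h2, -⟩ := exists_probInc_eq (Z := Z) (θ := θ) (γ := γ) (hh i j)
  rw [h1]
  nlinarith [mul_self_nonneg (h i j)]

/-- A single coordinate of the solution is controlled by its own equation. -/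
lemma abs_mul_sum_le {w F s : Fin n → ℝ} {a T : ℝ} (hT : 0 ≤ T) (hw : ∀ j, 0 ≤ w j)
    (hF : ∀ j, ∃ v, F j = v * (a + s j) ∧ w j / 3 ≤ v ∧ v ≤ 3 * w j)
    (h : a * ∑ j, F j ≤ |a| * T) :
    |a| * ((∑ j, w j) / 3) ≤ T + 3 * ∑ j, w j * |s j| := by
  have hs : 0 ≤ ∑ j, w j * |s j| :=
    Finset.sum_nonneg fun j _ => mul_nonneg (hw j) (abs_nonneg _)
  rcases eq_or_ne a 0 with rfl | ha
  · simp; linarith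
  have ha' : 0 < |a| := abs_pos.2 ha
  -- In v a² the secant slope v is bounded below by w/3, and in the mixed term v a s it is bounded
  -- above by 3w.
  have h1 : |a| * (|a| * ((∑ j, w j) / 3) - 3 * ∑ j, w j * |s j|) ≤ a * ∑ j, F j := by
    simp only [Finset.mul_sum, Finset.sum_div, ← Finset.sum_sub_distrib]
    refine Finset.sum_le_sum fun j _ => ?_
    obtain ⟨v, h1, h2, h3⟩ := hF j
    have hv0 : 0 ≤ v := (div_nonneg (hw j) (by norm_num)).trans h2
    have h4 : -(|a| * |s j|) ≤ a * s j := by rw [← abs_mul]; exact neg_abs_le _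
    rw [h1]
    have h5 : a * (v * (a + s j)) = v * |a| ^ 2 + v * (a * s j) := by rw [sq_abs]; ring
    rw [h5]
    have h6 : v * (|a| * |s j|) ≤ 3 * w j * (|a| * |s j|) := by gcongr
    have h7 : w j / 3 * |a| ^ 2 ≤ v * |a| ^ 2 := by gcongr
    nlinarith [mul_le_mul_of_nonneg_left h4 hv0]
  have h2 := le_of_mul_le_mul_left (h1.trans h) ha'
  linarith

/-- The score of the `l`-th covariate after projection. -/
def scoreRes (Z : Fin n → Fin n → Fin p → ℝ) (θ : Idx n → ℝ) (γ : Fin p → ℝ)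
    (U : (Fin n → ℝ) × (Fin n → ℝ) × (Fin p → ℝ)) (l : Fin p) : ℝ :=
  U.2.2 l - (U.1 ⬝ᵥ (fun i => covProj Z θ γ l (Sum.inl i)) + U.2.1 ⬝ᵥ beta (covProj Z θ γ l))

variable {U Δ : (Fin n → ℝ) × (Fin n → ℝ) × (Fin p → ℝ)} {B₁ B₂ B₃ : ℝ}

/-- The dual norm of the score. The predictor splits orthogonally into a design part and a covariate
residual. The node scores pair with the design part through ℓ² coercivity, at scale (mn)^(-1/2); the
projected covariate scores pair with the coefficients c_l, each bounded by √Λ times the root of the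
energy. Equal totals make it legitimate to use the centred representation of the projections. -/
lemma scorePair_sq_le (hn : 3 ≤ n) (hW : IsWeight (wgt Z θ γ) m) (hq : 0 ≤ q)
    (hZ : ∀ i j, i ≠ j → ∀ l, |Z i j l| ≤ q) (hH : (H Z θ γ).PosDef)
    (hΛ : rowSumNorm (H Z θ γ)⁻¹ ≤ Λ) (hU : ∑ i, U.1 i = ∑ j, U.2.1 j) (hB₁0 : 0 ≤ B₁)
    (hB₁ : ∑ i, U.1 i ^ 2 + ∑ j, U.2.1 j ^ 2 ≤ B₁ ^ 2)
    (hB₂ : ∀ l, |scoreRes Z θ γ U l| ≤ B₂) (Δ : (Fin n → ℝ) × (Fin n → ℝ) × (Fin p → ℝ)) :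
    |scorePair U Δ| ≤ (B₁ * √(10 / (m * n)) + p * B₂ * √Λ) *
      √(bil (wgt Z θ γ) (predInc Z Δ) (predInc Z Δ) + gaugeDefect Δ ^ 2) := by
  have hm := hW.pos
  have hn0 : (0 : ℝ) < n := by exact_mod_cast (by omega : 0 < n)
  set E := bil (wgt Z θ γ) (predInc Z Δ) (predInc Z Δ) with hE
  have hE0 : 0 ≤ E := bil_self_nonneg hW _
  choose a b hD hg _ _ using exists_centered_covProj (Z := Z) (θ := θ) (γ := γ) hn hW hq hZ
  obtain ⟨N, hN⟩ := exists_last hn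
  set c := Δ.2.2 with hc
  set α : Fin n → ℝ := fun i => Δ.1 i + ∑ l, c l * a l i with hα
  set β : Fin n → ℝ := fun j => Δ.2.1 j + ∑ l, c l * b l j with hβ
  have hαβ : addFun α β = degreeEffect (ofAdd N Δ.1 Δ.2.1 + combProj Z θ γ c) := by
    rw [degreeEffect_add, degreeEffect_ofAdd hN, combProj, degreeEffect_sum]
    simp only [degreeEffect_smul, hD]
    funext i j
    simp only [addFun, hα, hβ, Pi.add_apply, Finset.sum_apply, Pi.smul_apply, smul_eq_mul,
      mul_add, Finset.sum_add_distrib]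
    ring
  have hpy : E = bil (wgt Z θ γ) (addFun α β) (addFun α β)
      + bil (wgt Z θ γ) (resFun Z θ γ c) (resFun Z θ γ c) := by
    rw [hαβ, ← bil_add_covComb_self hn hW, degreeEffect_ofAdd hN, hE, predInc]
  -- The projections are represented in the centred gauge, so adding them does not change the gauge
  -- defect.
  have hgd : ∑ i, α i - ∑ j, β j = gaugeDefect Δ := by
    have h1 : ∑ i, ∑ l, c l * a l i = ∑ j, ∑ l, c l * b l j := by
      rw [Finset.sum_comm, Finset.sum_comm (f := fun j l => c l * b l j)]
      refine Finset.sum_congr rfl fun l _ => ?_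
      rw [← Finset.mul_sum, hg, Finset.mul_sum]
    simp only [hα, hβ, Finset.sum_add_distrib, gaugeDefect, h1]
    ring
  have hpair : scorePair U Δ = (U.1 ⬝ᵥ α + U.2.1 ⬝ᵥ β) + ∑ l, c l * scoreRes Z θ γ U l := by
    have h1 : ∀ l, scoreRes Z θ γ U l = U.2.2 l - (U.1 ⬝ᵥ a l + U.2.1 ⬝ᵥ b l) := by
      intro l
      rw [scoreRes, dotProduct_add_eq_of_addFun_eq hU (α := fun i => covProj Z θ γ l (Sum.inl i))
        (β := beta (covProj Z θ γ l)) (α' := a l) (β' := b l)]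
      rw [← degreeEffect_eq_addFun, hD]
    have h2 : ∀ (u : Fin n → ℝ) (f : Fin p → Fin n → ℝ),
        (∑ i, u i * ∑ l, c l * f l i) = ∑ l, c l * (u ⬝ᵥ f l) := by
      intro u f
      simp only [dotProduct, Finset.mul_sum]
      rw [Finset.sum_comm]
      exact Finset.sum_congr rfl fun l _ => Finset.sum_congr rfl fun i _ => by ring
    have h3 : U.1 ⬝ᵥ α = U.1 ⬝ᵥ Δ.1 + ∑ l, c l * (U.1 ⬝ᵥ a l) := by
      rw [← h2]
      simp only [hα, dotProduct, mul_add, Finset.sum_add_distrib]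
    have h4 : U.2.1 ⬝ᵥ β = U.2.1 ⬝ᵥ Δ.2.1 + ∑ l, c l * (U.2.1 ⬝ᵥ b l) := by
      rw [← h2]
      simp only [hβ, dotProduct, mul_add, Finset.sum_add_distrib]
    have h5 : U.2.2 ⬝ᵥ c = ∑ l, c l * U.2.2 l := by
      simp only [dotProduct, mul_comm]
    rw [scorePair, h3, h4, ← hc, h5]
    simp only [h1, mul_sub, mul_add, Finset.sum_sub_distrib, Finset.sum_add_distrib]
    ring
  have hr0 : 0 ≤ bil (wgt Z θ γ) (resFun Z θ γ c) (resFun Z θ γ c) := bil_self_nonneg hW _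
  have ha0 : 0 ≤ bil (wgt Z θ γ) (addFun α β) (addFun α β) := bil_self_nonneg hW _
  have hg0 := sq_nonneg (gaugeDefect Δ)
  have hA : |U.1 ⬝ᵥ α + U.2.1 ⬝ᵥ β| ≤ B₁ * √(10 / (m * n)) * √(E + gaugeDefect Δ ^ 2) := by
    apply abs_le_of_sq_le_sq _ (by positivity)
    refine (sq_dotProduct_add_le _ _ _ _).trans ?_
    rw [mul_pow, mul_pow, Real.sq_sqrt (by positivity), Real.sq_sqrt (by positivity), mul_assoc]
    refine mul_le_mul hB₁ ?_ (by positivity) (by positivity)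
    have h1 := sum_sq_le_centered hn hW α β
    rw [hgd] at h1
    -- Since 10/m is at least 1, it serves as a common constant for the energy and for the squared
    -- gauge defect.
    have h2 : (1 : ℝ) ≤ 10 / m := by
      rw [le_div_iff₀ hm]; linarith [hW.le_quarter hn]
    have h3 : n * (∑ i, α i ^ 2 + ∑ j, β j ^ 2)
        ≤ n * (10 / (m * n) * (E + gaugeDefect Δ ^ 2)) := by
      have : n * (10 / (m * n) * (E + gaugeDefect Δ ^ 2))
          = 10 / m * (E + gaugeDefect Δ ^ 2) := by field_simp
      rw [this]
      nlinarith
    exact le_of_mul_le_mul_left h3 hn0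
  have hΛ0 : p = 0 ∨ 0 ≤ Λ := by
    rcases Nat.eq_zero_or_pos p with h | h
    · exact Or.inl h
    · exact Or.inr ((bil_self_nonneg hW _).trans
        (bil_resFun_invCol_self_le hn hW hH hΛ ⟨0, h⟩))
  have hB : |∑ l, c l * scoreRes Z θ γ U l| ≤ p * B₂ * √Λ * √(E + gaugeDefect Δ ^ 2) := by
    have h1 : ∀ l, |c l * scoreRes Z θ γ U l| ≤ B₂ * √Λ * √(E + gaugeDefect Δ ^ 2) := by
      intro l
      have hΛ0' : 0 ≤ Λ := hΛ0.resolve_left (by have := l.2; omega)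
      have h2 : |c l| ≤ √Λ * √(E + gaugeDefect Δ ^ 2) := by
        rw [← Real.sqrt_mul hΛ0']
        apply Real.abs_le_sqrt
        refine (sq_le_mul_bil_resFun hn hW hH hΛ c l).trans ?_
        gcongr
        linarith
      rw [abs_mul]
      calc _ ≤ (√Λ * √(E + gaugeDefect Δ ^ 2)) * B₂ :=
            mul_le_mul h2 (hB₂ l) (abs_nonneg _) (by positivity)
        _ = _ := by ring
    calc _ ≤ ∑ l, |c l * scoreRes Z θ γ U l| := Finset.abs_sum_le_sum_abs _ _
      _ ≤ ∑ _l : Fin p, B₂ * √Λ * √(E + gaugeDefect Δ ^ 2) := Finset.sum_le_sum fun l _ => h1 l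
      _ = _ := by simp; ring
  rw [hpair, add_mul]
  exact (abs_add_le _ _).trans (add_le_add hA hB)

end solve

end

section

variable {n p : ℕ}

section solve

variable {Z : Fin n → Fin n → Fin p → ℝ} {θ : Idx n → ℝ} {γ : Fin p → ℝ} {m q Λ : ℝ}
  {U : (Fin n → ℝ) × (Fin n → ℝ) × (Fin p → ℝ)} {B₁ B₂ B₃ : ℝ}

lemma predInc_apply (Δ : (Fin n → ℝ) × (Fin n → ℝ) × (Fin p → ℝ)) (i j : Fin n) :
    predInc Z Δ i j = Δ.1 i + Δ.2.1 j + covComb Z Δ.2.2 i j := rfl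

/-- Removing the covariate part from the predictor leaves α + β with controlled energy; coercivity
gives ℓ² and Cauchy–Schwarz gives ℓ¹. The ℓ¹ norm is what enters the equation of a single node,
where the other nodes appear only in a weighted sum. -/
lemma sum_abs_le_of_energy (hn : 3 ≤ n) (hW : IsWeight (wgt Z θ γ) m)
    {Δ : (Fin n → ℝ) × (Fin n → ℝ) × (Fin p → ℝ)} {e b : ℝ} (he : 0 ≤ e) (hb : 0 ≤ b)
    (hE : bil (wgt Z θ γ) (predInc Z Δ) (predInc Z Δ) + gaugeDefect Δ ^ 2 ≤ e ^ 2)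
    (hc : ∀ i j, i ≠ j → |covComb Z Δ.2.2 i j| ≤ b) :
    ∑ i, |Δ.1 i| ≤ (3 * e + 2 * n * b) / m ∧ ∑ j, |Δ.2.1 j| ≤ (3 * e + 2 * n * b) / m := by
  have hm := hW.pos
  have hm4 := hW.le_quarter hn
  have hg0 := sq_nonneg (gaugeDefect Δ)
  have h1 : bil (wgt Z θ γ) (addFun Δ.1 Δ.2.1) (addFun Δ.1 Δ.2.1)
      ≤ 2 * (bil (wgt Z θ γ) (predInc Z Δ) (predInc Z Δ)) + n ^ 2 * b ^ 2 / 2 := by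
    have h2 : addFun Δ.1 Δ.2.1 = predInc Z Δ + (-1 : ℝ) • covComb Z Δ.2.2 := by
      rw [predInc]; simp
    have h3 := bil_add_self_le hW (predInc Z Δ) ((-1 : ℝ) • covComb Z Δ.2.2)
    rw [← h2, bil_smul_left, bil_smul_right] at h3
    have h4 := bil_self_le_of_abs_le hW _ hc
    linarith
  have h2 := sum_sq_le_centered hn hW Δ.1 Δ.2.1
  have h3 : n * (∑ i, Δ.1 i ^ 2 + ∑ j, Δ.2.1 j ^ 2) ≤ ((3 * e + 2 * n * b) / m) ^ 2 := by
    refine h2.trans ?_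
    change _ + gaugeDefect Δ ^ 2 ≤ _
    rw [div_pow, le_div_iff₀ (by positivity), add_mul]
    have h4 : 10 / m * bil (wgt Z θ γ) (addFun Δ.1 Δ.2.1) (addFun Δ.1 Δ.2.1) * m ^ 2
        = 10 * m * bil (wgt Z θ γ) (addFun Δ.1 Δ.2.1) (addFun Δ.1 Δ.2.1) := by field_simp
    rw [h4]
    have hb0 := bil_self_nonneg hW (addFun Δ.1 Δ.2.1)
    have hb1 := bil_self_nonneg hW (predInc Z Δ)
    have hm2 : m ^ 2 ≤ 1 / 16 := by nlinarith
    have h5 : 10 * m * bil (wgt Z θ γ) (addFun Δ.1 Δ.2.1) (addFun Δ.1 Δ.2.1) ≤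
        10 * (1 / 4) * (2 * (bil (wgt Z θ γ) (predInc Z Δ) (predInc Z Δ)) + n ^ 2 * b ^ 2 / 2) := by
      gcongr
    have h6 : gaugeDefect Δ ^ 2 * m ^ 2 ≤ gaugeDefect Δ ^ 2 * (1 / 16) := by gcongr
    have h7 : 0 ≤ e * (n * b) := by positivity
    have h8 : 0 ≤ (n : ℝ) ^ 2 * b ^ 2 := by positivity
    nlinarith
  have key : ∀ v : Fin n → ℝ, n * ∑ i, v i ^ 2 ≤ ((3 * e + 2 * n * b) / m) ^ 2 →
      ∑ i, |v i| ≤ (3 * e + 2 * n * b) / m := by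
    intro v hv
    have := sq_sum_le_card_mul_sum_sq (s := (Finset.univ : Finset (Fin n))) (f := fun j => |v j|)
    simp only [sq_abs, Finset.card_univ, Fintype.card_fin] at this
    exact (abs_le_of_sq_le_sq' (this.trans hv) (by positivity)).2
  have hn0 : (0 : ℝ) ≤ n := by positivity
  have ha0 : 0 ≤ n * ∑ i, Δ.1 i ^ 2 := by positivity
  have hb0 : 0 ≤ n * ∑ i, Δ.2.1 i ^ 2 := by positivity
  rw [mul_add] at h3
  exact ⟨key _ (by linarith), key _ (by linarith)⟩

/-- Solving the equation of one node for its own parameter. -/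
lemma abs_le_of_node_eq {m e₀ b₀ η B₃ M : ℝ} (hn : 3 ≤ n) (hm : 0 < m) (hm4 : m ≤ 1 / 4)
    (he0 : 0 ≤ e₀) (hb00 : 0 ≤ b₀) (hB₃0 : 0 ≤ B₃) (hM : M = (3 * e₀ + 2 * n * b₀) / m)
    (hη : 9 / (2 * n * m) * (B₃ + M) ≤ η) {w s F u : Fin n → ℝ} {a S : ℝ} (k : Fin n)
    (hw0 : ∀ j, 0 ≤ w j) (hw4 : ∀ j, w j ≤ 1 / 4) (hwk : w k = 0)
    (hs : ∀ j, j ≠ k → |s j| ≤ |u j| + b₀) (hu : ∑ j, |u j| ≤ M)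
    (hv : (n - 1) * m ≤ ∑ j, w j) (hS : S ≤ B₃ + e₀)
    (hF : ∀ j, ∃ v, F j = v * (a + s j) ∧ w j / 3 ≤ v ∧ v ≤ 3 * w j)
    (hle : a * ∑ j, F j ≤ |a| * S) : |a| ≤ η := by
  have hn3 : (3 : ℝ) ≤ n := by exact_mod_cast hn
  have h1 := abs_mul_sum_le (by positivity : 0 ≤ B₃ + e₀) hw0 hF
    (hle.trans (mul_le_mul_of_nonneg_left hS (abs_nonneg a)))
  have h2 : ∑ j, w j * |s j| ≤ 1 / 4 * (M + n * b₀) := by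
    calc ∑ j, w j * |s j| ≤ ∑ j, (1 / 4 * |u j| + 1 / 4 * b₀) := by
          refine Finset.sum_le_sum fun j _ => ?_
          rcases eq_or_ne j k with rfl | hj
          · rw [hwk]; simp; positivity
          · calc w j * |s j| ≤ 1 / 4 * (|u j| + b₀) :=
                  mul_le_mul (hw4 j) (hs j hj) (abs_nonneg _) (by norm_num)
              _ = _ := by ring
      _ ≤ _ := by
          rw [Finset.sum_add_distrib, ← Finset.mul_sum, Finset.sum_const, Finset.card_univ,
            Fintype.card_fin, nsmul_eq_mul]
          linarith
  have hX : 0 ≤ (n : ℝ) * b₀ := by positivity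
  -- The other node parameters use 3/4 of M. As m ≤ 1/4, the gauge term e₀ and the covariate term
  -- fit into the remaining quarter.
  have h3 : e₀ + 3 / 4 * (n * b₀) ≤ 1 / 4 * M := by
    rw [hM, ← mul_div_assoc, le_div_iff₀ hm]
    have := mul_le_mul_of_nonneg_left hm4 (by positivity : 0 ≤ e₀ + 3 / 4 * (n * b₀))
    linarith
  have h4 : |a| * (2 * n * m / 9) ≤ B₃ + M := by
    have h5 : 2 * n * m / 9 ≤ (∑ j, w j) / 3 := by
      have : 2 * n * m / 3 ≤ (n - 1) * m := by
        have := mul_le_mul_of_nonneg_right hn3 hm.le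
        linarith
      linarith
    have h6 := mul_le_mul_of_nonneg_left h5 (abs_nonneg a)
    linarith
  refine le_trans ?_ hη
  rw [div_mul_eq_mul_div, le_div_iff₀ (by positivity)]
  linarith

set_option maxHeartbeats 1000000 in
/-- The score equations have a solution near the true parameter, with explicit bounds. -/
theorem exists_score_solution (hn : 3 ≤ n) (hp : 1 ≤ p) (hW : IsWeight (wgt Z θ γ) m) (hq : 0 < q)
    (hZ : ∀ i j, i ≠ j → ∀ l, |Z i j l| ≤ q) (hH : (H Z θ γ).PosDef)
    (hΛ : rowSumNorm (H Z θ γ)⁻¹ ≤ Λ) (hU : ∑ i, U.1 i = ∑ j, U.2.1 j) (hB₁0 : 0 ≤ B₁)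
    (hB₁ : ∑ i, U.1 i ^ 2 + ∑ j, U.2.1 j ^ 2 ≤ B₁ ^ 2)
    (hB₂ : ∀ l, |scoreRes Z θ γ U l| ≤ B₂) (hB₃ : ∀ i, |U.1 i| ≤ B₃ ∧ |U.2.1 i| ≤ B₃)
    {e₀ b₀ η : ℝ} (he₀ : 3 * (B₁ * √(10 / (m * n)) + p * B₂ * √Λ) ≤ e₀)
    (hb₀ : p * q * (√Λ * e₀) ≤ b₀)
    (hη : 9 / (2 * n * m) * (B₃ + (3 * e₀ + 2 * n * b₀) / m) ≤ η)
    (hη4 : η < 1 / 4) (hb4 : b₀ < 1 / 4) :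
    ∃ Δ : (Fin n → ℝ) × (Fin n → ℝ) × (Fin p → ℝ),
      (∀ d, ∑ i, ∑ j, probInc (logit Z θ γ) (predInc Z Δ) i j * predInc Z d i j = scorePair U d) ∧
      bil (wgt Z θ γ) (predInc Z Δ) (predInc Z Δ) ≤ e₀ ^ 2 ∧
      (∀ i, |Δ.1 i| ≤ η) ∧ (∀ j, |Δ.2.1 j| ≤ η) ∧
      (∀ i j, i ≠ j → |covComb Z Δ.2.2 i j| ≤ b₀) := by
  have hm := hW.pos
  have hm4 := hW.le_quarter hn
  have hn0 : (0 : ℝ) < n := by exact_mod_cast (by omega : 0 < n)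
  have hn3 : (3 : ℝ) ≤ n := by exact_mod_cast hn
  have hp0 : (0 : ℝ) < p := by exact_mod_cast hp
  have hB₂0 : 0 ≤ B₂ := (abs_nonneg _).trans (hB₂ ⟨0, hp⟩)
  have hB₃0 : 0 ≤ B₃ := (abs_nonneg _).trans (hB₃ ⟨0, by omega⟩).1
  have he0 : 0 ≤ e₀ := le_trans (by positivity) he₀
  have hΛ0 : 0 ≤ Λ := (bil_self_nonneg hW _).trans (bil_resFun_invCol_self_le hn hW hH hΛ ⟨0, hp⟩)
  have hb00 : 0 ≤ b₀ := le_trans (by positivity) hb₀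
  -- With this radius the covariates move the predictor by at most 1/4. Together with 1/4 for each
  -- node parameter the total is at most 3/4, within the range where the secant slopes are
  -- comparable to the weights.
  set δ' : ℝ := 1 / (4 * (p * q)) with hδ'
  have hδ0 : 0 < δ' := by positivity
  have hpqδ : p * q * δ' = 1 / 4 := by rw [hδ']; field_simp
  obtain ⟨Δ, ⟨hΔ1, hΔ2, hΔ3⟩, hVI⟩ :=
    exists_variational_ineq Z (logit Z θ γ) U (δ := 1 / 4) (δ' := δ') (by norm_num) hδ0.le
  have hα : ∀ i, |Δ.1 i| ≤ 1 / 4 := fun i => (norm_le_pi_norm Δ.1 i).trans hΔ1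
  have hβ : ∀ i, |Δ.2.1 i| ≤ 1 / 4 := fun i => (norm_le_pi_norm Δ.2.1 i).trans hΔ2
  have hcov : ∀ i j, i ≠ j → |covComb Z Δ.2.2 i j| ≤ 1 / 4 := by
    intro i j hij
    rw [← hpqδ]
    exact abs_covComb_le hZ _ (fun l => (norm_le_pi_norm Δ.2.2 l).trans hΔ3) hij
  have hpred : ∀ i j, i ≠ j → |predInc Z Δ i j| ≤ 1 := by
    intro i j hij
    have h1 := abs_add_le (Δ.1 i + Δ.2.1 j) (covComb Z Δ.2.2 i j)
    have h2 := abs_add_le (Δ.1 i) (Δ.2.1 j)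
    rw [predInc_apply]
    linarith [hα i, hβ j, hcov i j hij]
  -- the energy bound
  set E := bil (wgt Z θ γ) (predInc Z Δ) (predInc Z Δ) with hEdef
  have hE0 : 0 ≤ E := bil_self_nonneg hW _
  have hg0 := sq_nonneg (gaugeDefect Δ)
  have hEg : E + gaugeDefect Δ ^ 2 ≤ e₀ ^ 2 := by
    -- The direction -Δ leads back to the true parameter, which is in the box. It yields E + g² ≤ 3
    -- · `scorePair U Δ`, with g the gauge defect.
    have h1 : objectiveDeriv Z (logit Z θ γ) U Δ ((-1 : ℝ) • Δ) ≥ 0 := by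
      apply hVI
      have : Δ + (-1 : ℝ) • Δ = 0 := by simp
      rw [this]
      simp [hδ0.le]
    rw [objectiveDeriv_smul, objectiveDeriv] at h1
    have h2 := bil_le_sum_probInc (Z := Z) (θ := θ) (γ := γ) hpred
    have h3 := scorePair_sq_le hn hW hq.le hZ hH hΛ hU hB₁0 hB₁ hB₂ Δ
    have h4 := le_abs_self (scorePair U Δ)
    rw [← hEdef] at h2 h3
    set y := √(E + gaugeDefect Δ ^ 2) with hy
    have hy2 : y ^ 2 = E + gaugeDefect Δ ^ 2 := Real.sq_sqrt (by positivity)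
    have hy0 : 0 ≤ y := Real.sqrt_nonneg _
    have h5 : y ^ 2 ≤ e₀ * y := by nlinarith
    have h6 : y ≤ e₀ := by
      rcases hy0.eq_or_lt with h | h
      · rw [← h]; exact he0
      · nlinarith
    rw [← hy2]
    exact pow_le_pow_left₀ hy0 h6 2
  have hEe : E ≤ e₀ ^ 2 := by linarith
  have hg : |gaugeDefect Δ| ≤ e₀ := abs_le_of_sq_le_sq (by linarith) he0
  -- the covariate coefficients
  have hcl : ∀ l, |Δ.2.2 l| ≤ √Λ * e₀ := by
    intro l
    apply abs_le_of_sq_le_sq _ (by positivity)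
    rw [mul_pow, Real.sq_sqrt hΛ0]
    refine (sq_le_mul_bil_resFun hn hW hH hΛ Δ.2.2 l).trans ?_
    gcongr
    refine le_trans ?_ hEe
    obtain ⟨N, hN⟩ := exists_last hn
    have h1 := bil_add_covComb_self hn hW (ofAdd N Δ.1 Δ.2.1) Δ.2.2
    rw [degreeEffect_ofAdd hN] at h1
    have h2 : E = bil (wgt Z θ γ) (addFun Δ.1 Δ.2.1 + covComb Z Δ.2.2)
      (addFun Δ.1 Δ.2.1 + covComb Z Δ.2.2) := rfl
    rw [h2, h1]
    have := bil_self_nonneg hW (degreeEffect (ofAdd N Δ.1 Δ.2.1 + combProj Z θ γ Δ.2.2))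
    linarith
  have hcov0 : ∀ i j, i ≠ j → |covComb Z Δ.2.2 i j| ≤ b₀ := fun i j hij =>
    (abs_covComb_le hZ _ hcl hij).trans hb₀
  -- the coordinates
  obtain ⟨hsα, hsβ⟩ := sum_abs_le_of_energy hn hW he0 hb00 hEg hcov0
  set M := (3 * e₀ + 2 * n * b₀) / m with hM
  have hηα : ∀ i, |Δ.1 i| ≤ η := by
    intro i
    set d : (Fin n → ℝ) × (Fin n → ℝ) × (Fin p → ℝ) := (Pi.single i 1, 0, 0) with hd
    -- Resetting one coordinate to zero stays in the box, so the equation of a single node is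
    -- available as an inequality before interiority is known.
    have h1 : 0 ≤ objectiveDeriv Z (logit Z θ γ) U Δ ((-Δ.1 i) • d) := by
      apply hVI
      refine ⟨?_, by simpa [hd] using hΔ2, by simpa [hd] using hΔ3⟩
      rw [pi_norm_le_iff_of_nonneg (by norm_num)]
      intro k
      rcases eq_or_ne k i with rfl | hk
      · simp [hd]
      · simpa [hd, hk] using hα k
    rw [objectiveDeriv_smul, objectiveDeriv] at h1
    have e1 : ∀ F : Fin n → Fin n → ℝ, ∑ k, ∑ j, F k j * predInc Z d k j = ∑ j, F i j := by
      intro F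
      simp [predInc, addFun, covComb, hd, Pi.single_apply]
    have e2 : gaugeDefect d = 1 := by simp [gaugeDefect, hd]
    have e3 : scorePair U d = U.1 i := by simp [scorePair, hd]
    rw [e1, e2, e3] at h1
    refine abs_le_of_node_eq hn hm hm4 he0 hb00 hB₃0 hM hη (w := fun j => wgt Z θ γ i j)
      (s := fun j => Δ.2.1 j + covComb Z Δ.2.2 i j)
      (F := fun j => probInc (logit Z θ γ) (predInc Z Δ) i j) (u := Δ.2.1)
      (S := |U.1 i| + |gaugeDefect Δ|) i
      (hW.nonneg i) (hW.upper i) (hW.diag i) ?_ hsβ (hW.row_ge i)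
      (add_le_add (hB₃ i).1 hg) ?_ ?_
    · intro j hj
      exact (abs_add_le _ _).trans (add_le_add le_rfl (hcov0 i j hj.symm))
    · intro j
      simp only [← add_assoc]
      exact exists_probInc_eq (hpred i j)
    · have h2 : Δ.1 i * (U.1 i - gaugeDefect Δ) ≤ |Δ.1 i| * (|U.1 i| + |gaugeDefect Δ|) := by
        refine (le_abs_self _).trans ?_
        rw [abs_mul]
        exact mul_le_mul_of_nonneg_left (abs_sub _ _) (abs_nonneg _)
      linarith
  have hηβ : ∀ i, |Δ.2.1 i| ≤ η := by
    intro i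
    set d : (Fin n → ℝ) × (Fin n → ℝ) × (Fin p → ℝ) := (0, Pi.single i 1, 0) with hd
    have h1 : 0 ≤ objectiveDeriv Z (logit Z θ γ) U Δ ((-Δ.2.1 i) • d) := by
      apply hVI
      refine ⟨by simpa [hd] using hΔ1, ?_, by simpa [hd] using hΔ3⟩
      rw [pi_norm_le_iff_of_nonneg (by norm_num)]
      intro k
      rcases eq_or_ne k i with rfl | hk
      · simp [hd]
      · simpa [hd, hk] using hβ k
    rw [objectiveDeriv_smul, objectiveDeriv] at h1
    have e1 : ∀ F : Fin n → Fin n → ℝ, ∑ k, ∑ j, F k j * predInc Z d k j = ∑ k, F k i := by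
      intro F
      simp [predInc, addFun, covComb, hd, Pi.single_apply]
    have e2 : gaugeDefect d = -1 := by simp [gaugeDefect, hd]
    have e3 : scorePair U d = U.2.1 i := by simp [scorePair, hd]
    rw [e1, e2, e3] at h1
    refine abs_le_of_node_eq hn hm hm4 he0 hb00 hB₃0 hM hη (w := fun j => wgt Z θ γ j i)
      (s := fun j => Δ.1 j + covComb Z Δ.2.2 j i)
      (F := fun j => probInc (logit Z θ γ) (predInc Z Δ) j i) (u := Δ.1)
      (S := |U.2.1 i| + |gaugeDefect Δ|) i
      (fun j => hW.nonneg j i) (fun j => hW.upper j i) (hW.diag i) ?_ hsα (hW.swap.row_ge i)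
      (add_le_add (hB₃ i).2 hg) ?_ ?_
    · intro j hj
      exact (abs_add_le _ _).trans (add_le_add le_rfl (hcov0 j i hj))
    · intro j
      have : Δ.2.1 i + (Δ.1 j + covComb Z Δ.2.2 j i) = predInc Z Δ j i := by
        rw [predInc_apply]; ring
      simp only [this]
      exact exists_probInc_eq (hpred j i)
    · have h2 : Δ.2.1 i * (U.2.1 i + gaugeDefect Δ) ≤ |Δ.2.1 i| * (|U.2.1 i| + |gaugeDefect Δ|) := by
        refine (le_abs_self _).trans ?_
        rw [abs_mul]
        exact mul_le_mul_of_nonneg_left (abs_add_le _ _) (abs_nonneg _)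
      linarith
  -- the solution is interior, so the derivative vanishes
  have hη0 : 0 ≤ η := (abs_nonneg _).trans (hηα ⟨0, by omega⟩)
  have hcδ : √Λ * e₀ < δ' := by
    have : p * q * (√Λ * e₀) < p * q * δ' := by rw [hpqδ]; linarith
    exact lt_of_mul_lt_mul_left this (by positivity)
  have hint : ∀ d, 0 ≤ objectiveDeriv Z (logit Z θ γ) U Δ d := by
    intro d
    have hev : ∀ᶠ t : ℝ in 𝓝[>] 0, ‖(Δ + t • d).1‖ ≤ 1 / 4 ∧ ‖(Δ + t • d).2.1‖ ≤ 1 / 4 ∧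
        ‖(Δ + t • d).2.2‖ ≤ δ' := by
      have hlim : ∀ {F : Type} [NormedAddCommGroup F] [NormedSpace ℝ F] (a b : F) (r : ℝ),
          ‖a‖ < r → ∀ᶠ t : ℝ in 𝓝[>] 0, ‖a + t • b‖ ≤ r := by
        intro F _ _ a b r hr
        have hcont : Continuous fun t : ℝ => ‖a + t • b‖ := by fun_prop
        have h1 : ∀ᶠ t : ℝ in 𝓝 0, ‖a + t • b‖ < r := by
          apply hcont.continuousAt.eventually_lt continuousAt_const
          simpa using hr
        exact (h1.filter_mono nhdsWithin_le_nhds).mono fun t ht => ht.le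
      refine (hlim Δ.1 d.1 _ ?_).and ((hlim Δ.2.1 d.2.1 _ ?_).and (hlim Δ.2.2 d.2.2 _ ?_))
      · exact lt_of_le_of_lt ((pi_norm_le_iff_of_nonneg hη0).2 hηα) hη4
      · exact lt_of_le_of_lt ((pi_norm_le_iff_of_nonneg hη0).2 hηβ) hη4
      · exact lt_of_le_of_lt ((pi_norm_le_iff_of_nonneg (by positivity)).2 hcl) hcδ
    obtain ⟨t, ht, ht0⟩ := (hev.and self_mem_nhdsWithin).exists
    have := hVI (t • d) ht
    rw [objectiveDeriv_smul] at this
    exact (mul_nonneg_iff_of_pos_left ht0).1 this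
  have hzero : ∀ d, objectiveDeriv Z (logit Z θ γ) U Δ d = 0 := by
    intro d
    have h1 := hint ((-1 : ℝ) • d)
    rw [objectiveDeriv_smul] at h1
    linarith [hint d]
  -- The direction (1, -1, 0) changes neither the predictor nor, by equality of totals, the pairing
  -- with the score. Only the penalty remains in the stationarity condition, so the unpenalised
  -- score equations hold.
  have hgz : gaugeDefect Δ = 0 := by
    set d : (Fin n → ℝ) × (Fin n → ℝ) × (Fin p → ℝ) := (1, -1, 0) with hd
    have h1 := hzero d
    have e1 : predInc Z d = 0 := by
      funext i j
      simp [predInc, addFun, covComb, hd]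
    have e2 : gaugeDefect d = 2 * n := by
      simp [gaugeDefect, hd]; ring
    have e3 : scorePair U d = 0 := by
      simp [scorePair, hd, dotProduct, hU]
    rw [objectiveDeriv, e1, e2, e3] at h1
    simp only [Pi.zero_apply, mul_zero, Finset.sum_const_zero, zero_add, sub_zero] at h1
    rcases mul_eq_zero.1 h1 with h | h
    · exact h
    · linarith
  refine ⟨Δ, fun d => ?_, hEe, hηα, hηβ, hcov0⟩
  have := hzero d
  rw [objectiveDeriv, hgz] at this
  linarith

end solve

end

section

variable {n p : ℕ}

/-! ### The moment equations in weak form -/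

section weak

variable (Z : Fin n → Fin n → Fin p → ℝ) (θ : Idx n → ℝ) (γ : Fin p → ℝ)
  (A : Fin n → Fin n → ℤ) (eO eI : Fin n → ℤ)

/-- The centred edge indicators, set to `0` on the diagonal. -/
def resid (i j : Fin n) : ℝ := if i = j then 0 else (A i j : ℝ) - edgeProb Z θ γ i j

/-- The linear statistic of the centred edges with coefficients `f` and of the noises with
coefficients `x`. -/
def linStat (f : Fin n → Fin n → ℝ) (x : Idx n → ℝ) : ℝ :=
  bil (resid Z θ γ A) 1 f +
    (∑ i, x (Sum.inl i) * (eO i : ℝ) + ∑ j, x (Sum.inr j) * (eI (inNode j) : ℝ))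

/-- The weak form of the moment equations for an increment `h` of the linear predictor. -/
def IsWeakSolution (h : Fin n → Fin n → ℝ) : Prop :=
  ∀ (y : Idx n → ℝ) (c : Fin p → ℝ),
    bil (probInc (logit Z θ γ) h) 1 (degreeEffect y + covComb Z c) =
      linStat Z θ γ A eO eI (degreeEffect y + covComb Z c) y

variable {Z θ γ A eO eI}

lemma bil_one_designFun_inl (F : Fin n → Fin n → ℝ) (i : Fin n) :
    bil F 1 (designFun (Sum.inl i)) = ∑ j, F i j := by
  simp [bil, designFun, design]

lemma bil_one_designFun_inr (F : Fin n → Fin n → ℝ) (j : Fin (n - 1)) :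
    bil F 1 (designFun (Sum.inr j)) = ∑ i, F i (inNode j) := by
  simp [bil, designFun, design]

lemma bil_one_degreeEffect (F : Fin n → Fin n → ℝ) (y : Idx n → ℝ) :
    bil F 1 (degreeEffect y) = ∑ i, y (Sum.inl i) * ∑ j, F i j
      + ∑ j, y (Sum.inr j) * ∑ i, F i (inNode j) := by
  rw [bil_degreeEffect_right, Fintype.sum_sum_type]
  simp only [bil_one_designFun_inl, bil_one_designFun_inr]

lemma bil_one_covComb (F : Fin n → Fin n → ℝ) (c : Fin p → ℝ) :
    bil F 1 (covComb Z c) = ∑ l, c l * bil F 1 (covFun Z l) := by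
  rw [covComb_eq_sum, bil_sum_right]
  exact Finset.sum_congr rfl fun l _ => bil_smul_right _ _ _ _

lemma linStat_add (f g : Fin n → Fin n → ℝ) (x y : Idx n → ℝ) :
    linStat Z θ γ A eO eI (f + g) (x + y) =
      linStat Z θ γ A eO eI f x + linStat Z θ γ A eO eI g y := by
  simp only [linStat, bil_add_right, Pi.add_apply, add_mul, Finset.sum_add_distrib]
  ring

lemma linStat_smul (c : ℝ) (f : Fin n → Fin n → ℝ) (x : Idx n → ℝ) :
    linStat Z θ γ A eO eI (c • f) (c • x) = c * linStat Z θ γ A eO eI f x := by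
  simp only [linStat, bil_smul_right, Pi.smul_apply, smul_eq_mul, mul_add, Finset.mul_sum,
    mul_assoc]

lemma linStat_sum {ι : Type*} (s : Finset ι) (f : ι → Fin n → Fin n → ℝ) (x : ι → Idx n → ℝ) :
    linStat Z θ γ A eO eI (∑ l ∈ s, f l) (∑ l ∈ s, x l) =
      ∑ l ∈ s, linStat Z θ γ A eO eI (f l) (x l) := by
  classical
  induction s using Finset.induction_on with
  | empty => simp [linStat, bil]
  | insert a s ha ih =>
    rw [Finset.sum_insert ha, Finset.sum_insert ha, Finset.sum_insert ha, linStat_add, ih]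

lemma linStat_sub (f g : Fin n → Fin n → ℝ) (x y : Idx n → ℝ) :
    linStat Z θ γ A eO eI (f - g) (x - y) =
      linStat Z θ γ A eO eI f x - linStat Z θ γ A eO eI g y := by
  have := linStat_add (Z := Z) (θ := θ) (γ := γ) (A := A) (eO := eO) (eI := eI) (f - g) g (x - y) y
  rw [sub_add_cancel, sub_add_cancel] at this
  linarith

lemma sum_erase_fst (i : Fin n) (f : Fin n → ℝ) :
    ∑ j ∈ Finset.univ.erase i, f j = ∑ j, if j = i then 0 else f j := by
  rw [sum_erase_eq]
  simp only [eq_comm]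

/-- The equations are linear in the test pair (y, c), so the coordinate equations imply all
combinations. Testing with columns of V⁻¹ or H⁻¹ then isolates single parameters. -/
lemma isWeakSolution_of_isMomentSolution {θ' : Idx n → ℝ} {γ' : Fin p → ℝ}
    (h : IsMomentSolution Z A eO eI θ' γ') :
    IsWeakSolution Z θ γ A eO eI (logit Z θ' γ' - logit Z θ γ) := by
  set F := probInc (logit Z θ γ) (logit Z θ' γ' - logit Z θ γ) with hF
  have hFe : ∀ i j, F i j - resid Z θ γ A i j =
      if i = j then 0 else edgeProb Z θ' γ' i j - A i j := by
    intro i j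
    simp only [hF, probInc, resid, Pi.sub_apply, add_sub_cancel]
    split_ifs
    · simp
    · change edgeProb Z θ' γ' i j - edgeProb Z θ γ i j - (A i j - edgeProb Z θ γ i j) = _
      ring
  obtain ⟨h1, h2, h3⟩ := h
  have r1 : ∀ i, ∑ j, F i j = ∑ j, resid Z θ γ A i j + eO i := by
    intro i
    have := h1 i
    simp only [noisyOutDegree, Int.cast_add, Int.cast_sum, sum_erase_eq] at this
    have e : ∑ j, (F i j - resid Z θ γ A i j) = ∑ j, (if i = j then 0 else edgeProb Z θ' γ' i j)
        - ∑ j, (if i = j then 0 else (A i j : ℝ)) := by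
      rw [← Finset.sum_sub_distrib]
      refine Finset.sum_congr rfl fun j _ => ?_
      rw [hFe]; split_ifs <;> simp
    rw [Finset.sum_sub_distrib] at e
    linarith
  have r2 : ∀ j : Fin (n - 1), ∑ i, F i (inNode j) =
      ∑ i, resid Z θ γ A i (inNode j) + eI (inNode j) := by
    intro j
    have := h2 j
    simp only [noisyInDegree, Int.cast_add, Int.cast_sum, sum_erase_fst] at this
    have e : ∑ i, (F i (inNode j) - resid Z θ γ A i (inNode j)) =
        ∑ i, (if i = inNode j then 0 else edgeProb Z θ' γ' i (inNode j))
        - ∑ i, (if i = inNode j then 0 else (A i (inNode j) : ℝ)) := by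
      rw [← Finset.sum_sub_distrib]
      refine Finset.sum_congr rfl fun i _ => ?_
      rw [hFe]; split_ifs <;> simp
    rw [Finset.sum_sub_distrib] at e
    linarith
  have r3 : ∀ l, bil F 1 (covFun Z l) = bil (resid Z θ γ A) 1 (covFun Z l) := by
    intro l
    have := congrFun h3 l
    simp only [Finset.sum_apply, Pi.smul_apply, smul_eq_mul, sum_erase_eq] at this
    have e : bil F 1 (covFun Z l) - bil (resid Z θ γ A) 1 (covFun Z l) =
        ∑ i, ∑ j, (if i = j then 0 else edgeProb Z θ' γ' i j * Z i j l)
        - ∑ i, ∑ j, (if i = j then 0 else A i j * Z i j l) := by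
      simp only [bil, ← Finset.sum_sub_distrib]
      refine Finset.sum_congr rfl fun i _ => Finset.sum_congr rfl fun j _ => ?_
      rw [← sub_mul, hFe]
      simp only [covFun, Pi.one_apply]
      split_ifs <;> ring
    linarith
  intro y c
  rw [linStat, bil_add_right, bil_add_right, bil_one_covComb, bil_one_covComb,
    bil_one_degreeEffect, bil_one_degreeEffect]
  simp only [← hF, r1, r2, r3, mul_add, Finset.sum_add_distrib]
  ring

lemma isMomentSolution_of_isWeakSolution {θ' : Idx n → ℝ} {γ' : Fin p → ℝ}
    (h : IsWeakSolution Z θ γ A eO eI (logit Z θ' γ' - logit Z θ γ)) :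
    IsMomentSolution Z A eO eI θ' γ' := by
  set F := probInc (logit Z θ γ) (logit Z θ' γ' - logit Z θ γ) with hF
  have hFe : ∀ i j, F i j - resid Z θ γ A i j =
      if i = j then 0 else edgeProb Z θ' γ' i j - A i j := by
    intro i j
    simp only [hF, probInc, resid, Pi.sub_apply, add_sub_cancel]
    split_ifs
    · simp
    · change edgeProb Z θ' γ' i j - edgeProb Z θ γ i j - (A i j - edgeProb Z θ γ i j) = _
      ring
  have hD : ∀ r : Idx n, degreeEffect (Pi.single r (1 : ℝ)) = designFun r := by
    intro r
    rw [degreeEffect_eq_sum, Finset.sum_eq_single r]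
    · simp
    · intro b _ hb; simp [hb]
    · simp
  have hc0 : covComb Z 0 = 0 := by funext i j; simp [covComb]
  have hD0 : degreeEffect (0 : Idx n → ℝ) = 0 := by
    rw [degreeEffect_eq_sum]; simp
  refine ⟨fun i => ?_, fun j => ?_, ?_⟩
  · have h1 := h (Pi.single (Sum.inl i) 1) 0
    rw [hD, hc0, add_zero, linStat, bil_one_designFun_inl, bil_one_designFun_inl, ← hF] at h1
    simp only [Pi.single_apply, Sum.inl.injEq, reduceCtorEq, ite_mul, one_mul, zero_mul,
      Finset.sum_ite_eq', Finset.mem_univ, if_true, if_false, Finset.sum_const_zero,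
      add_zero] at h1
    have e : ∑ j, (F i j - resid Z θ γ A i j) = ∑ j, (if i = j then 0 else edgeProb Z θ' γ' i j)
        - ∑ j, (if i = j then 0 else (A i j : ℝ)) := by
      rw [← Finset.sum_sub_distrib]
      refine Finset.sum_congr rfl fun j _ => ?_
      rw [hFe]; split_ifs <;> simp
    rw [Finset.sum_sub_distrib] at e
    simp only [noisyOutDegree, Int.cast_add, Int.cast_sum, sum_erase_eq]
    linarith
  · have h1 := h (Pi.single (Sum.inr j) 1) 0
    rw [hD, hc0, add_zero, linStat, bil_one_designFun_inr, bil_one_designFun_inr, ← hF] at h1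
    simp only [Pi.single_apply, Sum.inr.injEq, reduceCtorEq, ite_mul, one_mul, zero_mul,
      Finset.sum_ite_eq', Finset.mem_univ, if_true, if_false, Finset.sum_const_zero,
      zero_add] at h1
    have e : ∑ i, (F i (inNode j) - resid Z θ γ A i (inNode j)) =
        ∑ i, (if i = inNode j then 0 else edgeProb Z θ' γ' i (inNode j))
        - ∑ i, (if i = inNode j then 0 else (A i (inNode j) : ℝ)) := by
      rw [← Finset.sum_sub_distrib]
      refine Finset.sum_congr rfl fun i _ => ?_
      rw [hFe]; split_ifs <;> simp
    rw [Finset.sum_sub_distrib] at e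
    simp only [noisyInDegree, Int.cast_add, Int.cast_sum, sum_erase_fst]
    linarith
  · funext l
    have h1 := h 0 (Pi.single l 1)
    have hcl : covComb Z (Pi.single l 1) = covFun Z l := by
      funext i j; simp [covComb, covFun]
    rw [hD0, zero_add, hcl, linStat, ← hF] at h1
    simp only [Pi.zero_apply, zero_mul, Finset.sum_const_zero, add_zero] at h1
    have e : bil F 1 (covFun Z l) - bil (resid Z θ γ A) 1 (covFun Z l) =
        ∑ i, ∑ j, (if i = j then 0 else edgeProb Z θ' γ' i j * Z i j l)
        - ∑ i, ∑ j, (if i = j then 0 else A i j * Z i j l) := by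
      simp only [bil, ← Finset.sum_sub_distrib]
      refine Finset.sum_congr rfl fun i _ => Finset.sum_congr rfl fun j _ => ?_
      rw [← sub_mul, hFe]
      simp only [covFun, Pi.one_apply]
      split_ifs <;> ring
    simp only [Finset.sum_apply, Pi.smul_apply, smul_eq_mul, sum_erase_eq]
    linarith

lemma logit_sub_logit (θ' : Idx n → ℝ) (γ' : Fin p → ℝ) :
    logit Z θ' γ' - logit Z θ γ = degreeEffect (θ' - θ) + covComb Z (γ' - γ) := by
  rw [degreeEffect_sub]
  funext i j
  simp only [logit, covComb, Pi.sub_apply, Pi.add_apply, dotProduct_sub]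
  ring

/-- The solution of the moment equations is unique. -/
lemma IsMomentSolution.unique {m Λ : ℝ} (hn : 3 ≤ n) (hW : IsWeight (wgt Z θ γ) m)
    (hH : (H Z θ γ).PosDef) (hΛ : rowSumNorm (H Z θ γ)⁻¹ ≤ Λ)
    {θ₁ θ₂ : Idx n → ℝ} {γ₁ γ₂ : Fin p → ℝ} (h₁ : IsMomentSolution Z A eO eI θ₁ γ₁)
    (h₂ : IsMomentSolution Z A eO eI θ₂ γ₂) : θ₁ = θ₂ ∧ γ₁ = γ₂ := by
  have w₁ := isWeakSolution_of_isMomentSolution (θ := θ) (γ := γ) h₁ (θ₁ - θ₂) (γ₁ - γ₂)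
  have w₂ := isWeakSolution_of_isMomentSolution (θ := θ) (γ := γ) h₂ (θ₁ - θ₂) (γ₁ - γ₂)
  have hd : degreeEffect (θ₁ - θ₂) + covComb Z (γ₁ - γ₂) = logit Z θ₁ γ₁ - logit Z θ₂ γ₂ :=
    (logit_sub_logit _ _).symm
  rw [← w₂] at w₁
  -- The difference of the two weak equations, tested with the difference of the predictors, is a
  -- sum of nonnegative terms since the logistic function increases. Hence the predictors agree on
  -- every edge.
  have hsum : ∑ i, ∑ j, (if i = j then 0 else (sigm (logit Z θ₁ γ₁ i j) - sigm (logit Z θ₂ γ₂ i j))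
      * (logit Z θ₁ γ₁ i j - logit Z θ₂ γ₂ i j)) = 0 := by
    rw [hd] at w₁
    rw [← sub_eq_zero] at w₁
    refine Eq.trans ?_ w₁
    simp only [bil, ← Finset.sum_sub_distrib]
    refine Finset.sum_congr rfl fun i _ => Finset.sum_congr rfl fun j _ => ?_
    simp only [probInc, Pi.sub_apply, add_sub_cancel, Pi.one_apply]
    split_ifs <;> ring
  have hnn : ∀ i j : Fin n, 0 ≤ (if i = j then 0 else
      (sigm (logit Z θ₁ γ₁ i j) - sigm (logit Z θ₂ γ₂ i j))
      * (logit Z θ₁ γ₁ i j - logit Z θ₂ γ₂ i j)) := by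
    intro i j
    split_ifs
    · exact le_rfl
    · rcases le_total (logit Z θ₁ γ₁ i j) (logit Z θ₂ γ₂ i j) with h | h
      · exact mul_nonneg_of_nonpos_of_nonpos (sub_nonpos.2 (sigm_strictMono.monotone h))
          (sub_nonpos.2 h)
      · exact mul_nonneg (sub_nonneg.2 (sigm_strictMono.monotone h)) (sub_nonneg.2 h)
  have heq : ∀ i j, i ≠ j → logit Z θ₁ γ₁ i j - logit Z θ₂ γ₂ i j = 0 := by
    intro i j hij
    have h3 := (Finset.sum_eq_zero_iff_of_nonneg
      (fun i _ => Finset.sum_nonneg fun j _ => hnn i j)).1 hsum i (Finset.mem_univ i)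
    have h4 := (Finset.sum_eq_zero_iff_of_nonneg (fun j _ => hnn i j)).1 h3 j (Finset.mem_univ j)
    rw [if_neg hij] at h4
    rcases mul_eq_zero.1 h4 with h | h
    · rw [sigm_strictMono.injective (sub_eq_zero.1 h), sub_self]
    · exact h
  have hz : bil (wgt Z θ γ) (degreeEffect (θ₁ - θ₂) + covComb Z (γ₁ - γ₂))
      (degreeEffect (θ₁ - θ₂) + covComb Z (γ₁ - γ₂)) = 0 := by
    rw [hd]
    refine Finset.sum_eq_zero fun i _ => Finset.sum_eq_zero fun j _ => ?_
    rcases eq_or_ne i j with rfl | hij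
    · rw [hW.diag, zero_mul]
    · simp only [Pi.sub_apply, heq i j hij, mul_zero]
  rw [bil_add_covComb_self hn hW] at hz
  have n1 := bil_self_nonneg hW (degreeEffect (θ₁ - θ₂ + combProj Z θ γ (γ₁ - γ₂)))
  have n2 := bil_self_nonneg hW (resFun Z θ γ (γ₁ - γ₂))
  -- By Pythagoras both energies vanish: the residual energy determines γ through H, and then the
  -- design energy determines θ.
  have hγ : γ₁ - γ₂ = 0 := by
    funext l
    have := sq_le_mul_bil_resFun hn hW hH hΛ (γ₁ - γ₂) l
    rw [show bil (wgt Z θ γ) (resFun Z θ γ (γ₁ - γ₂)) (resFun Z θ γ (γ₁ - γ₂)) = 0 by linarith,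
      mul_zero] at this
    exact pow_eq_zero_iff two_ne_zero |>.1 (le_antisymm this (sq_nonneg _))
  have hcp : combProj Z θ γ 0 = 0 := by simp [combProj]
  rw [hγ, hcp, add_zero] at n1 hz
  have hθ : θ₁ - θ₂ = 0 := by
    have h5 := sum_sq_le_bil_degreeEffect hn hW (θ₁ - θ₂)
    rw [hγ] at n2
    rw [show bil (wgt Z θ γ) (degreeEffect (θ₁ - θ₂)) (degreeEffect (θ₁ - θ₂)) = 0 by linarith,
      mul_zero] at h5
    funext r
    have h6 := (Finset.sum_eq_zero_iff_of_nonneg fun r _ => sq_nonneg ((θ₁ - θ₂) r)).1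
      (le_antisymm h5 (Finset.sum_nonneg fun r _ => sq_nonneg _)) r (Finset.mem_univ r)
    exact pow_eq_zero_iff two_ne_zero |>.1 h6
  exact ⟨sub_eq_zero.1 hθ, sub_eq_zero.1 hγ⟩

end weak

end

/-! ### The score at the true parameter and the solution near it -/

section

variable {n p : ℕ}

section sol

variable (Z : Fin n → Fin n → Fin p → ℝ) (θ : Idx n → ℝ) (γ : Fin p → ℝ)
  (A : Fin n → Fin n → ℤ) (eO eI : Fin n → ℤ)

/-- The noise in the equation of the in-parameter of node `j`; the last equation is minus the sum
of the others. -/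
def inNoise (eO eI : Fin n → ℤ) (j : Fin n) : ℝ :=
  if (j : ℕ) < n - 1 then (eI j : ℝ) else ∑ i, (eO i : ℝ) - ∑ k : Fin (n - 1), (eI (inNode k) : ℝ)

/-- The score at the true parameter, in the redundant parametrisation. -/
def scoreVec : (Fin n → ℝ) × (Fin n → ℝ) × (Fin p → ℝ) :=
  (fun i => ∑ j, resid Z θ γ A i j + eO i,
    fun j => ∑ i, resid Z θ γ A i j + inNoise eO eI j,
    fun l => bil (resid Z θ γ A) 1 (covFun Z l))

variable {Z θ γ A eO eI} {m q Λ : ℝ}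

lemma sum_eq_sum_inNode_add {N : Fin n} (hN : (N : ℕ) = n - 1) (f : Fin n → ℝ) :
    ∑ j, f j = ∑ k : Fin (n - 1), f (inNode k) + f N := by
  obtain ⟨k, rfl⟩ : ∃ k, n = k + 1 := ⟨n - 1, by have := N.2; omega⟩
  rw [Fin.sum_univ_castSucc]
  congr 2
  exact Fin.ext (by rw [hN]; rfl)

/-- The in-degree of the last node is not among the equations; the noise assigned to it is the one
that makes the out-noises and the in-noises have equal totals. This is the balance that changes of
gauge require. -/
lemma sum_inNoise (hn : 3 ≤ n) : ∑ j, inNoise eO eI j = ∑ i, (eO i : ℝ) := by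
  obtain ⟨N, hN⟩ := exists_last hn
  rw [sum_eq_sum_inNode_add hN]
  have h1 : ∀ k : Fin (n - 1), inNoise eO eI (inNode k) = eI (inNode k) := fun k => by
    rw [inNoise, if_pos (by rw [inNode_val]; exact k.2)]
  rw [inNoise, if_neg (by omega)]
  simp only [h1]
  ring

lemma sum_scoreVec (hn : 3 ≤ n) :
    ∑ i, (scoreVec Z θ γ A eO eI).1 i = ∑ j, (scoreVec Z θ γ A eO eI).2.1 j := by
  simp only [scoreVec, Finset.sum_add_distrib]
  rw [sum_inNoise hn, Finset.sum_comm]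

lemma scorePair_scoreVec (hn : 3 ≤ n) (y : Idx n → ℝ) (c : Fin p → ℝ) :
    scorePair (scoreVec Z θ γ A eO eI) (fun i => y (Sum.inl i), beta y, c) =
      linStat Z θ γ A eO eI (degreeEffect y + covComb Z c) y := by
  obtain ⟨N, hN⟩ := exists_last hn
  have hb : beta y N = 0 := by simp [beta, hN]
  have h1 : ∀ k : Fin (n - 1), inNoise eO eI (inNode k) = eI (inNode k) := fun k => by
    rw [inNoise, if_pos (by rw [inNode_val]; exact k.2)]
  rw [linStat, bil_add_right, bil_one_covComb, bil_one_degreeEffect]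
  simp only [scorePair, scoreVec, dotProduct]
  rw [sum_eq_sum_inNode_add hN (fun j => (∑ i, resid Z θ γ A i j + inNoise eO eI j) * beta y j), hb]
  simp only [h1, beta_inNode, mul_comm (y _), mul_comm (c _), add_mul, Finset.sum_add_distrib,
    mul_zero]
  ring

lemma scoreRes_scoreVec (hn : 3 ≤ n) (l : Fin p) :
    scoreRes Z θ γ (scoreVec Z θ γ A eO eI) l =
      linStat Z θ γ A eO eI (covRes Z θ γ l) (-covProj Z θ γ l) := by
  have hc0 : covComb Z 0 = 0 := by funext i j; simp [covComb]
  have h := scorePair_scoreVec (Z := Z) (θ := θ) (γ := γ) (A := A) (eO := eO) (eI := eI) hn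
    (covProj Z θ γ l) 0
  rw [hc0, add_zero] at h
  have h2 : linStat Z θ γ A eO eI (covFun Z l) 0 = (scoreVec Z θ γ A eO eI).2.2 l := by
    simp [linStat, scoreVec]
  rw [scoreRes, covRes, ← zero_sub (covProj Z θ γ l), linStat_sub, h2, ← h, scorePair]
  simp

/-- Existence of a solution of the moment equations close to the true parameter. -/
theorem exists_isMomentSolution {B₁ B₂ B₃ : ℝ} (hn : 3 ≤ n) (hp : 1 ≤ p)
    (hW : IsWeight (wgt Z θ γ) m) (hq : 0 < q)
    (hZ : ∀ i j, i ≠ j → ∀ l, |Z i j l| ≤ q) (hH : (H Z θ γ).PosDef)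
    (hΛ : rowSumNorm (H Z θ γ)⁻¹ ≤ Λ) (hB₁0 : 0 ≤ B₁)
    (hB₁ : ∑ i, (scoreVec Z θ γ A eO eI).1 i ^ 2 + ∑ j, (scoreVec Z θ γ A eO eI).2.1 j ^ 2 ≤ B₁ ^ 2)
    (hB₂ : ∀ l, |linStat Z θ γ A eO eI (covRes Z θ γ l) (-covProj Z θ γ l)| ≤ B₂)
    (hB₃ : ∀ i, |(scoreVec Z θ γ A eO eI).1 i| ≤ B₃ ∧ |(scoreVec Z θ γ A eO eI).2.1 i| ≤ B₃)
    {e₀ b₀ η : ℝ} (he₀ : 3 * (B₁ * √(10 / (m * n)) + p * B₂ * √Λ) ≤ e₀)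
    (hb₀ : p * q * (√Λ * e₀) ≤ b₀)
    (hη : 9 / (2 * n * m) * (B₃ + (3 * e₀ + 2 * n * b₀) / m) ≤ η)
    (hη4 : η < 1 / 4) (hb4 : b₀ < 1 / 4) :
    ∃ (θ' : Idx n → ℝ) (γ' : Fin p → ℝ), IsMomentSolution Z A eO eI θ' γ' ∧
      bil (wgt Z θ γ) (logit Z θ' γ' - logit Z θ γ) (logit Z θ' γ' - logit Z θ γ) ≤ e₀ ^ 2 ∧
      ∀ i j, i ≠ j → |(logit Z θ' γ' - logit Z θ γ) i j| ≤ 2 * η + b₀ := by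
  obtain ⟨Δ, h1, h2, h3, h4, h5⟩ := exists_score_solution hn hp hW hq hZ hH hΛ
    (sum_scoreVec hn) hB₁0 hB₁ (fun l => by rw [scoreRes_scoreVec hn]; exact hB₂ l) hB₃ he₀ hb₀ hη
    hη4 hb4
  obtain ⟨N, hN⟩ := exists_last hn
  have hl : logit Z (θ + ofAdd N Δ.1 Δ.2.1) (γ + Δ.2.2) - logit Z θ γ = predInc Z Δ := by
    rw [logit_sub_logit, add_sub_cancel_left, add_sub_cancel_left, degreeEffect_ofAdd hN, predInc]
  refine ⟨θ + ofAdd N Δ.1 Δ.2.1, γ + Δ.2.2, ?_, by rw [hl]; exact h2, ?_⟩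
  · apply isMomentSolution_of_isWeakSolution (θ := θ) (γ := γ)
    intro y c
    rw [hl, ← scorePair_scoreVec hn, ← h1]
    simp only [bil, Pi.one_apply, one_mul]
    rfl
  · intro i j hij
    rw [hl, predInc_apply]
    have e1 := abs_add_le (Δ.1 i + Δ.2.1 j) (covComb Z Δ.2.2 i j)
    have e2 := abs_add_le (Δ.1 i) (Δ.2.1 j)
    linarith [h3 i, h4 j, h5 i j hij]

/-! ### Linearisation of the moment equations -/

lemma abs_bil_probInc_sub_le {h : Fin n → Fin n → ℝ} (hh : ∀ i j, i ≠ j → |h i j| ≤ 1)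
    (g : Fin n → Fin n → ℝ) :
    |bil (probInc (logit Z θ γ) h) 1 g - bil (wgt Z θ γ) h g| ≤
      2 * ∑ i, ∑ j, wgt Z θ γ i j * h i j ^ 2 * |g i j| := by
  simp only [bil, ← Finset.sum_sub_distrib, Finset.mul_sum]
  refine (Finset.abs_sum_le_sum_abs _ _).trans (Finset.sum_le_sum fun i _ => ?_)
  refine (Finset.abs_sum_le_sum_abs _ _).trans (Finset.sum_le_sum fun j _ => ?_)
  unfold probInc wgt
  split_ifs with hij
  · simp
  · have h1 := abs_sigm_sub_sub_le (logit Z θ γ i j) (h i j) (hh i j hij)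
    have h2 : edgeWeight Z θ γ i j = sigw (logit Z θ γ i j) := rfl
    rw [h2, Pi.one_apply, Pi.one_apply, one_mul, ← mul_assoc, ← sub_mul, abs_mul]
    calc _ ≤ 2 * (sigw (logit Z θ γ i j) * h i j ^ 2) * |g i j| :=
          mul_le_mul_of_nonneg_right h1 (abs_nonneg _)
      _ = _ := by ring

variable {θ' : Idx n → ℝ} {γ' : Fin p → ℝ} {e₀ η B₂ : ℝ}

/-- The test function is the residual of a column of H⁻¹. It is orthogonal to the design, so θ' - θ
drops out and one coordinate of γ' - γ remains on the left. On the right stand the projected scores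
with weights of ℓ¹ norm at most Λ, and a quadratic remainder: twice the energy times the sup norm Λ
· 3q/m² of the test function. -/
lemma abs_gamma_sub_le (hn : 3 ≤ n) (hW : IsWeight (wgt Z θ γ) m) (hq : 0 ≤ q)
    (hZ : ∀ i j, i ≠ j → ∀ l, |Z i j l| ≤ q) (hH : (H Z θ γ).PosDef)
    (hΛ : rowSumNorm (H Z θ γ)⁻¹ ≤ Λ) (hsol : IsMomentSolution Z A eO eI θ' γ')
    (hB₂ : ∀ l, |linStat Z θ γ A eO eI (covRes Z θ γ l) (-covProj Z θ γ l)| ≤ B₂)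
    (hE : bil (wgt Z θ γ) (logit Z θ' γ' - logit Z θ γ) (logit Z θ' γ' - logit Z θ γ) ≤ e₀ ^ 2)
    (hh : ∀ i j, i ≠ j → |(logit Z θ' γ' - logit Z θ γ) i j| ≤ 1) (l : Fin p) :
    |γ' l - γ l| ≤ Λ * (B₂ + 6 * q * e₀ ^ 2 / m ^ 2) := by
  have hm := hW.pos
  set z := invCol Z θ γ l with hz
  set h := logit Z θ' γ' - logit Z θ γ with hhdef
  have hsum := sum_abs_invCol_le hH hΛ l
  have hweak := isWeakSolution_of_isMomentSolution (θ := θ) (γ := γ) hsol (-combProj Z θ γ z) z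
  have hD : degreeEffect (-combProj Z θ γ z) + covComb Z z = resFun Z θ γ z := by
    rw [resFun_eq, ← zero_sub (combProj Z θ γ z), degreeEffect_sub]
    have : degreeEffect (0 : Idx n → ℝ) = 0 := by rw [degreeEffect_eq_sum]; simp
    rw [this]; abel
  rw [hD, ← hhdef] at hweak
  have h1 : bil (wgt Z θ γ) h (resFun Z θ γ z) = γ' l - γ l := by
    rw [hhdef, logit_sub_logit, bil_add_left, bil_comm, bil_resFun_degreeEffect hn hW, zero_add]
    have : covComb Z (γ' - γ) = resFun Z θ γ (γ' - γ)
        + degreeEffect (combProj Z θ γ (γ' - γ)) := by rw [resFun_eq]; abel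
    rw [this, bil_add_left, bil_comm _ (degreeEffect _), bil_resFun_degreeEffect hn hW, add_zero,
      hz, bil_resFun_invCol hn hW hH, Pi.sub_apply]
  have h2 : linStat Z θ γ A eO eI (resFun Z θ γ z) (-combProj Z θ γ z) =
      ∑ l', z l' * linStat Z θ γ A eO eI (covRes Z θ γ l') (-covProj Z θ γ l') := by
    have : -combProj Z θ γ z = ∑ l', z l' • (-covProj Z θ γ l') := by
      simp [combProj]
    rw [this, resFun, linStat_sum]
    exact Finset.sum_congr rfl fun l' _ => linStat_smul _ _ _
  have h3 : |linStat Z θ γ A eO eI (resFun Z θ γ z) (-combProj Z θ γ z)| ≤ Λ * B₂ := by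
    rw [h2]
    calc _ ≤ ∑ l', |z l' * linStat Z θ γ A eO eI (covRes Z θ γ l') (-covProj Z θ γ l')| :=
          Finset.abs_sum_le_sum_abs _ _
      _ ≤ ∑ l', |z l'| * B₂ := Finset.sum_le_sum fun l' _ => by
          rw [abs_mul]; exact mul_le_mul_of_nonneg_left (hB₂ l') (abs_nonneg _)
      _ ≤ Λ * B₂ := by
          rw [← Finset.sum_mul]
          exact mul_le_mul_of_nonneg_right hsum ((abs_nonneg _).trans (hB₂ l))
  have h4 : ∀ i j, i ≠ j → |resFun Z θ γ z i j| ≤ Λ * (3 * q / m ^ 2) := by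
    intro i j hij
    simp only [resFun, Finset.sum_apply, Pi.smul_apply, smul_eq_mul]
    calc _ ≤ ∑ l', |z l' * covRes Z θ γ l' i j| := Finset.abs_sum_le_sum_abs _ _
      _ ≤ ∑ l', |z l'| * (3 * q / m ^ 2) := Finset.sum_le_sum fun l' _ => by
          rw [abs_mul]
          exact mul_le_mul_of_nonneg_left (abs_covRes_le hn hW hq hZ l' hij) (abs_nonneg _)
      _ ≤ _ := by
          rw [← Finset.sum_mul]
          exact mul_le_mul_of_nonneg_right hsum (by positivity)
  have h5 := abs_bil_probInc_sub_le (Z := Z) (θ := θ) (γ := γ) hh (resFun Z θ γ z)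
  have hΛ0 : 0 ≤ Λ := (bil_self_nonneg hW _).trans (bil_resFun_invCol_self_le hn hW hH hΛ l)
  have h6 : ∑ i, ∑ j, wgt Z θ γ i j * h i j ^ 2 * |resFun Z θ γ z i j| ≤
      e₀ ^ 2 * (Λ * (3 * q / m ^ 2)) := by
    calc _ ≤ ∑ i, ∑ j, wgt Z θ γ i j * (h i j * h i j) * (Λ * (3 * q / m ^ 2)) := by
          refine Finset.sum_le_sum fun i _ => Finset.sum_le_sum fun j _ => ?_
          rw [← sq]
          rcases eq_or_ne i j with rfl | hij
          · rw [hW.diag]; simp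
          · exact mul_le_mul_of_nonneg_left (h4 i j hij)
              (mul_nonneg (hW.nonneg i j) (sq_nonneg _))
      _ = bil (wgt Z θ γ) h h * (Λ * (3 * q / m ^ 2)) := by simp only [bil, Finset.sum_mul]
      _ ≤ _ := mul_le_mul_of_nonneg_right hE (by positivity)
  rw [h1, hweak] at h5
  have h7 : |γ' l - γ l| ≤ Λ * B₂ + 2 * (e₀ ^ 2 * (Λ * (3 * q / m ^ 2))) := by
    rw [abs_le] at h3 h5 ⊢
    constructor <;> linarith
  refine h7.trans (le_of_eq ?_)
  ring

end sol

end

section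

variable {n p : ℕ}

section approx

variable {Z : Fin n → Fin n → Fin p → ℝ} {θ : Idx n → ℝ} {γ : Fin p → ℝ}
  {A : Fin n → Fin n → ℤ} {eO eI : Fin n → ℤ} {m q Λ : ℝ}

/-! ### The explicit approximation of the inverse -/

lemma V_inl_inl (i k : Fin n) :
    V Z θ γ (Sum.inl i) (Sum.inl k) = if i = k then ∑ j, wgt Z θ γ i j else 0 := by
  rw [V_apply]
  simp only [bil, designFun, design, Sum.elim_inl]
  split_ifs with h
  · subst h; simp
  · refine Finset.sum_eq_zero fun a _ => Finset.sum_eq_zero fun b _ => ?_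
    by_cases h1 : i = a
    · subst h1; simp [Ne.symm h]
    · simp [h1]

lemma V_inl_inr (i : Fin n) (j : Fin (n - 1)) :
    V Z θ γ (Sum.inl i) (Sum.inr j) = wgt Z θ γ i (inNode j) := by
  rw [V_apply]
  simp [bil, designFun, design]

lemma inNode_injective : Function.Injective (inNode : Fin (n - 1) → Fin n) :=
  Fin.castLE_injective (Nat.sub_le n 1)

lemma V_inr_inr (j k : Fin (n - 1)) :
    V Z θ γ (Sum.inr j) (Sum.inr k) = if j = k then ∑ i, wgt Z θ γ i (inNode j) else 0 := by
  rw [V_apply]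
  simp only [bil, designFun, design, Sum.elim_inr]
  split_ifs with h
  · subst h; simp
  · refine Finset.sum_eq_zero fun a _ => Finset.sum_eq_zero fun b _ => ?_
    by_cases h1 : inNode j = b
    · subst h1; simp [inNode_injective.ne (Ne.symm h)]
    · simp [h1]

lemma V_inr_inl (j : Fin (n - 1)) (i : Fin n) :
    V Z θ γ (Sum.inr j) (Sum.inl i) = wgt Z θ γ i (inNode j) := by
  rw [← V_inl_inr, ← V_transpose, Matrix.transpose_apply, V_transpose]

/-- The row of an out-node i has excess w_{iN}, the weight of the edge to the node whose
in-parameter is fixed at 0; the rows of in-nodes have excess 0. -/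
lemma vLast_V {N : Fin n} (hN : (N : ℕ) = n - 1) :
    vLast (V Z θ γ) = ∑ i, wgt Z θ γ i N := by
  have h1 : ∀ r, V Z θ γ r r - ∑ c ∈ Finset.univ.erase r, V Z θ γ r c =
      2 * V Z θ γ r r - ∑ c, V Z θ γ r c := by
    intro r
    rw [← Finset.add_sum_erase _ _ (Finset.mem_univ r)]
    ring
  simp only [vLast, h1, Fintype.sum_sum_type, V_inl_inl, V_inl_inr, V_inr_inl, V_inr_inr]
  simp only [if_true, Finset.sum_ite_eq, Finset.mem_univ]
  have h2 : ∀ i, 2 * ∑ j, wgt Z θ γ i j - (∑ j, wgt Z θ γ i j +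
      ∑ j : Fin (n - 1), wgt Z θ γ i (inNode j)) = wgt Z θ γ i N := by
    intro i
    rw [sum_eq_sum_inNode_add hN (wgt Z θ γ i)]
    ring
  have h3 : ∀ j : Fin (n - 1), 2 * ∑ i, wgt Z θ γ i (inNode j) -
      (∑ i, wgt Z θ γ i (inNode j) + ∑ i, wgt Z θ γ i (inNode j)) = 0 := fun j => by ring
  simp only [h2, h3, Finset.sum_const_zero, add_zero]

/-- The column of `S` that belongs to the out-parameter of node `i`. -/
def sCol (Z : Fin n → Fin n → Fin p → ℝ) (θ : Idx n → ℝ) (γ : Fin p → ℝ) (i : Fin n) :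
    Idx n → ℝ := fun r => S (V Z θ γ) r (Sum.inl i)

/-- The total weight of the edges leaving `i`. -/
def outW (Z : Fin n → Fin n → Fin p → ℝ) (θ : Idx n → ℝ) (γ : Fin p → ℝ) (i : Fin n) : ℝ :=
  ∑ j, wgt Z θ γ i j

/-- The total weight of the edges entering `j`. -/
def inW (Z : Fin n → Fin n → Fin p → ℝ) (θ : Idx n → ℝ) (γ : Fin p → ℝ) (j : Fin n) : ℝ :=
  ∑ i, wgt Z θ γ i j

/-- As a function on edges, a column of S is supported on the row i and the column N, where pairing
with it takes weighted averages. Its spread over all 2n - 1 coordinates comes only from the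
normalisation β_N = 0. -/
lemma sCol_eq {N : Fin n} (hN : (N : ℕ) = n - 1) (i : Fin n) :
    sCol Z θ γ i = ofAdd N (Pi.single i (1 / outW Z θ γ i)) (Pi.single N (1 / inW Z θ γ N)) := by
  have hNk : ∀ k : Fin (n - 1), inNode k ≠ N := by
    intro k h
    have := congrArg Fin.val h
    rw [inNode_val, hN] at this
    have := k.2
    omega
  funext r
  rcases r with k | k
  · simp only [sCol, S, Matrix.of_apply, ofAdd, Sum.elim_inl, Pi.single_eq_same, vLast_V hN, inW,
      V_inl_inl, if_true, Pi.single_apply]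
    congr 1
    split_ifs with h
    · rw [h]; rfl
    · rfl
  · simp only [sCol, S, Matrix.of_apply, ofAdd, Sum.elim_inr, Pi.single_eq_same, vLast_V hN, inW,
      Pi.single_eq_of_ne (hNk k)]
    ring

lemma degreeEffect_sCol {N : Fin n} (hN : (N : ℕ) = n - 1) (i : Fin n) :
    degreeEffect (sCol Z θ γ i) =
      addFun (Pi.single i (1 / outW Z θ γ i)) (Pi.single N (1 / inW Z θ γ N)) := by
  rw [sCol_eq hN, degreeEffect_ofAdd hN]

lemma outW_ge (hn : 3 ≤ n) (hW : IsWeight (wgt Z θ γ) m) (i : Fin n) :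
    2 / 3 * n * m ≤ outW Z θ γ i := by
  have h := hW.row_ge i
  have h3 : (3 : ℝ) ≤ n := by exact_mod_cast hn
  have := mul_le_mul_of_nonneg_right h3 hW.pos.le
  unfold outW
  linarith

lemma inW_ge (hn : 3 ≤ n) (hW : IsWeight (wgt Z θ γ) m) (i : Fin n) :
    2 / 3 * n * m ≤ inW Z θ γ i := by
  have h := hW.swap.row_ge i
  have h3 : (3 : ℝ) ≤ n := by exact_mod_cast hn
  have := mul_le_mul_of_nonneg_right h3 hW.pos.le
  unfold inW
  linarith

lemma outW_pos (hn : 3 ≤ n) (hW : IsWeight (wgt Z θ γ) m) (i : Fin n) : 0 < outW Z θ γ i :=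
  lt_of_lt_of_le (by have := hW.pos; have : (0:ℝ) < n := by exact_mod_cast (by omega : 0 < n)
                     positivity) (outW_ge hn hW i)

lemma inW_pos (hn : 3 ≤ n) (hW : IsWeight (wgt Z θ γ) m) (i : Fin n) : 0 < inW Z θ γ i :=
  lt_of_lt_of_le (by have := hW.pos; have : (0:ℝ) < n := by exact_mod_cast (by omega : 0 < n)
                     positivity) (inW_ge hn hW i)

/-- The bilinear form against a column of `S`. -/
lemma bil_addFun_single_right {N : Fin n} (i : Fin n) (f : Fin n → Fin n → ℝ) :
    bil (wgt Z θ γ) f (addFun (Pi.single i (1 / outW Z θ γ i)) (Pi.single N (1 / inW Z θ γ N))) =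
      ∑ j, wgt Z θ γ i j / outW Z θ γ i * f i j + ∑ k, wgt Z θ γ k N / inW Z θ γ N * f k N := by
  rw [bil_addFun_right]
  simp only [Pi.single_apply, ite_mul, zero_mul, Finset.sum_ite_eq', Finset.mem_univ, if_true]
  simp only [Finset.mul_sum]
  congr 1 <;> exact Finset.sum_congr rfl fun j _ => by ring

lemma sum_outW_div (hn : 3 ≤ n) (hW : IsWeight (wgt Z θ γ) m) (i : Fin n) :
    ∑ j, wgt Z θ γ i j / outW Z θ γ i = 1 := by
  rw [← Finset.sum_div]
  exact div_self (outW_pos hn hW i).ne'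

lemma sum_inW_div (hn : 3 ≤ n) (hW : IsWeight (wgt Z θ γ) m) (j : Fin n) :
    ∑ i, wgt Z θ γ i j / inW Z θ γ j = 1 := by
  rw [← Finset.sum_div]
  exact div_self (inW_pos hn hW j).ne'

/-- The error of the column of `S` as a column of the inverse of `V`. -/
def colErr (Z : Fin n → Fin n → Fin p → ℝ) (θ : Idx n → ℝ) (γ : Fin p → ℝ) (i : Fin n) :
    Idx n → ℝ := (V Z θ γ)⁻¹ *ᵥ Pi.single (Sum.inl i) 1 - sCol Z θ γ i

/-- Pairing with the column of V⁻¹ gives y_i. Pairing with the column of S gives the average of y_i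
+ β_j along row i plus the average of the y_k along column N. The difference is minus the mean of
y_k + β_j, with k and j drawn independently with these two sets of weights. -/
lemma bil_colErr (hn : 3 ≤ n) (hW : IsWeight (wgt Z θ γ) m) {N : Fin n} (hN : (N : ℕ) = n - 1)
    (i : Fin n) (y : Idx n → ℝ) :
    bil (wgt Z θ γ) (degreeEffect (colErr Z θ γ i)) (degreeEffect y) =
      -∑ k, ∑ j, (wgt Z θ γ k N / inW Z θ γ N) * (wgt Z θ γ i j / outW Z θ γ i) *
        (y (Sum.inl k) + beta y j) := by
  have hb : beta y N = 0 := by simp [beta, hN]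
  rw [colErr, degreeEffect_sub, bil_sub_left, bil_degreeEffect_inv_mulVec hn hW, bil_comm _
    (degreeEffect (sCol Z θ γ i)), degreeEffect_sCol hN, bil_addFun_single_right]
  simp only [degreeEffect, hb, add_zero, mul_add, Finset.sum_add_distrib, ← Finset.sum_mul,
    ← Finset.mul_sum, sum_outW_div hn hW]
  have e1 : ∑ k, wgt Z θ γ k N / inW Z θ γ N * (1 : ℝ) * y (Sum.inl k) =
      ∑ k, wgt Z θ γ k N / inW Z θ γ N * y (Sum.inl k) := by simp only [mul_one]
  have e2 : ∑ k, ∑ j, wgt Z θ γ k N / inW Z θ γ N * (wgt Z θ γ i j / outW Z θ γ i) * beta y j =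
      ∑ j, wgt Z θ γ i j / outW Z θ γ i * beta y j := by
    simp only [mul_assoc, ← Finset.mul_sum, ← Finset.sum_mul, sum_inW_div hn hW, one_mul]
  rw [e1, e2]
  simp
  ring

/-- The error is tested with itself. The product weights P_k Q_j are probabilities with factors at
most b, hence have ℓ² norm at most b, and the spectral gap returns the energy on the right. The sum
includes the diagonal k = j, which is why the gap must cover it. -/
lemma bil_colErr_self_le (hn : 3 ≤ n) (hW : IsWeight (wgt Z θ γ) m) (i : Fin n) :
    bil (wgt Z θ γ) (degreeEffect (colErr Z θ γ i)) (degreeEffect (colErr Z θ γ i)) ≤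
      (1 / (n * m ^ 2)) ^ 2 := by
  obtain ⟨N, hN⟩ := exists_last hn
  have hm := hW.pos
  have hm4 := hW.le_quarter hn
  have hn0 : (0 : ℝ) < n := by exact_mod_cast (by omega : 0 < n)
  set d := colErr Z θ γ i with hd
  set E := bil (wgt Z θ γ) (degreeEffect d) (degreeEffect d) with hE
  have hE0 : 0 ≤ E := bil_self_nonneg hW _
  set P := fun k => wgt Z θ γ k N / inW Z θ γ N with hP
  set Q := fun j => wgt Z θ γ i j / outW Z θ γ i with hQ
  -- The largest weight 1/4 divided by the smallest total weight 2nm/3 of a row or column.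
  set b : ℝ := 3 / (8 * n * m) with hb
  have hP0 : ∀ k, 0 ≤ P k := fun k => div_nonneg (hW.nonneg _ _) (inW_pos hn hW N).le
  have hQ0 : ∀ k, 0 ≤ Q k := fun k => div_nonneg (hW.nonneg _ _) (outW_pos hn hW i).le
  have hPb : ∀ k, P k ≤ b := by
    intro k
    rw [hP, hb, div_le_div_iff₀ (inW_pos hn hW N) (by positivity)]
    have h1 := hW.upper k N
    have h2 := inW_ge hn hW N
    calc wgt Z θ γ k N * (8 * n * m) ≤ 1 / 4 * (8 * n * m) := by gcongr
      _ = 3 * (2 / 3 * n * m) := by ring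
      _ ≤ _ := by gcongr
  have hQb : ∀ k, Q k ≤ b := by
    intro k
    rw [hQ, hb, div_le_div_iff₀ (outW_pos hn hW i) (by positivity)]
    have h1 := hW.upper i k
    have h2 := outW_ge hn hW i
    calc wgt Z θ γ i k * (8 * n * m) ≤ 1 / 4 * (8 * n * m) := by gcongr
      _ = 3 * (2 / 3 * n * m) := by ring
      _ ≤ _ := by gcongr
  have hPs : ∑ k, P k ^ 2 ≤ b := by
    calc ∑ k, P k ^ 2 ≤ ∑ k, b * P k := Finset.sum_le_sum fun k _ => by
          rw [sq]; exact mul_le_mul_of_nonneg_right (hPb k) (hP0 k)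
      _ = b := by rw [← Finset.mul_sum, sum_inW_div hn hW, mul_one]
  have hQs : ∑ k, Q k ^ 2 ≤ b := by
    calc ∑ k, Q k ^ 2 ≤ ∑ k, b * Q k := Finset.sum_le_sum fun k _ => by
          rw [sq]; exact mul_le_mul_of_nonneg_right (hQb k) (hQ0 k)
      _ = b := by rw [← Finset.mul_sum, sum_outW_div hn hW, mul_one]
  have hb0 : 0 ≤ b := by positivity
  have h1 : E = -∑ k, ∑ j, P k * Q j * (d (Sum.inl k) + beta d j) := bil_colErr hn hW hN i d
  have h2 : E ^ 2 ≤ (b * b) * (10 / m * E) := by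
    rw [h1, neg_sq, ← h1, ← Fintype.sum_prod_type' (f := fun k j =>
      P k * Q j * (d (Sum.inl k) + beta d j))]
    refine (Finset.sum_mul_sq_le_sq_mul_sq _ _ _).trans ?_
    refine mul_le_mul ?_ ?_ (by positivity) (by positivity)
    · rw [Fintype.sum_prod_type' (f := fun k j => (P k * Q j) ^ 2)]
      simp only [mul_pow, ← Finset.mul_sum, ← Finset.sum_mul]
      exact mul_le_mul hPs hQs (by positivity) hb0
    · rw [Fintype.sum_prod_type' (f := fun k j => (d (Sum.inl k) + beta d j) ^ 2)]
      exact sum_addFun_sq_le hn hW _ _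
  have h3 : E ≤ b * b * (10 / m) := by
    rcases hE0.eq_or_lt with h | h
    · rw [← h]; positivity
    · rw [sq, ← mul_assoc] at h2
      exact le_of_mul_le_mul_right h2 h
  refine h3.trans ?_
  have h4 : b * b * (10 / m) = (90 / 64 * m) * (1 / (n * m ^ 2)) ^ 2 := by
    rw [hb]; field_simp; norm_num
  rw [h4]
  have h5 : 90 / 64 * m ≤ 1 := by linarith
  calc _ ≤ 1 * (1 / (n * m ^ 2)) ^ 2 := mul_le_mul_of_nonneg_right h5 (by positivity)
    _ = _ := one_mul _

lemma sum_abs_bil_le (hW : IsWeight (wgt Z θ γ) m) (f g : Fin n → Fin n → ℝ) :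
    ∑ i, ∑ j, wgt Z θ γ i j * (|f i j| * |g i j|) ≤
      √(bil (wgt Z θ γ) f f) * √(bil (wgt Z θ γ) g g) := by
  have h := abs_bil_le hW (fun i j => |f i j|) (fun i j => |g i j|)
  have e : ∀ f : Fin n → Fin n → ℝ, bil (wgt Z θ γ) (fun i j => |f i j|) (fun i j => |f i j|)
      = bil (wgt Z θ γ) f f := by intro f; simp [bil]
  rw [e, e] at h
  exact (le_abs_self _).trans h

/-- Linearisation of the out-parameter of a node `i` in terms of the column of `S`. -/
theorem abs_theta_sub_sub_le {θ' : Idx n → ℝ} {γ' : Fin p → ℝ} {e₀ η b : ℝ} (hn : 3 ≤ n)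
    (hW : IsWeight (wgt Z θ γ) m) (he₀ : 0 ≤ e₀) (hb : 0 ≤ b)
    (hsol : IsMomentSolution Z A eO eI θ' γ')
    (hE : bil (wgt Z θ γ) (logit Z θ' γ' - logit Z θ γ) (logit Z θ' γ' - logit Z θ γ) ≤ e₀ ^ 2)
    (hη : η ≤ 1) (hη0 : 0 ≤ η)
    (hh : ∀ i j, i ≠ j → |(logit Z θ' γ' - logit Z θ γ) i j| ≤ η)
    (hc : ∀ i j, i ≠ j → |covComb Z (γ' - γ) i j| ≤ b) (i : Fin n) :
    |θ' (Sum.inl i) - θ (Sum.inl i)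
      - linStat Z θ γ A eO eI (degreeEffect (sCol Z θ γ i)) (sCol Z θ γ i)
      - linStat Z θ γ A eO eI (degreeEffect (colErr Z θ γ i)) (colErr Z θ γ i)| ≤
      b * (2 + 1 / m ^ 2) + 4 * η ^ 2 + 2 * η * e₀ / (n * m ^ 2) := by
  obtain ⟨N, hN⟩ := exists_last hn
  have hm := hW.pos
  have hn0 : (0 : ℝ) < n := by exact_mod_cast (by omega : 0 < n)
  set h := logit Z θ' γ' - logit Z θ γ with hhdef
  set u := (V Z θ γ)⁻¹ *ᵥ Pi.single (Sum.inl i) 1 with hu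
  set s := sCol Z θ γ i with hs
  set d := colErr Z θ γ i with hd
  have husd : u = s + d := by rw [hd, colErr]; abel
  have hDu : degreeEffect u = degreeEffect s + degreeEffect d := by
    rw [husd, degreeEffect_add]
  have hc0 : covComb Z 0 = 0 := by funext i j; simp [covComb]
  have hweak := isWeakSolution_of_isMomentSolution (θ := θ) (γ := γ) hsol u 0
  rw [hc0, add_zero, ← hhdef] at hweak
  have h1 : bil (wgt Z θ γ) h (degreeEffect u) = θ' (Sum.inl i) - θ (Sum.inl i)
      + bil (wgt Z θ γ) (covComb Z (γ' - γ)) (degreeEffect u) := by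
    rw [hhdef, logit_sub_logit, bil_add_left]
    congr 1
    rw [bil_comm, hu, bil_degreeEffect_inv_mulVec hn hW]
    simp
  have h2 : linStat Z θ γ A eO eI (degreeEffect u) u =
      linStat Z θ γ A eO eI (degreeEffect s) s + linStat Z θ γ A eO eI (degreeEffect d) d := by
    rw [hDu, husd, linStat_add]
  have hSnn : ∀ k j, 0 ≤ degreeEffect s k j := by
    intro k j
    rw [hs, degreeEffect_sCol hN]
    have e1 := outW_pos hn hW i
    have e2 := inW_pos hn hW N
    simp only [addFun, Pi.single_apply]
    split_ifs <;> positivity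
  -- The column of S acts as a sum of two averages, so it tests a function bounded by B to at most
  -- 2B, with no factor of m.
  have hS2 : ∀ f : Fin n → Fin n → ℝ, ∀ B, 0 ≤ B → (∀ k j, k ≠ j → |f k j| ≤ B) →
      ∑ k, ∑ j, wgt Z θ γ k j * (|f k j| * |degreeEffect s k j|) ≤ 2 * B := by
    intro f B hB hf
    calc _ ≤ ∑ k, ∑ j, wgt Z θ γ k j * (B * degreeEffect s k j) := by
          refine Finset.sum_le_sum fun k _ => Finset.sum_le_sum fun j _ => ?_
          rw [abs_of_nonneg (hSnn k j)]
          rcases eq_or_ne k j with rfl | hkj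
          · rw [hW.diag]; simp
          · exact mul_le_mul_of_nonneg_left
              (mul_le_mul_of_nonneg_right (hf k j hkj) (hSnn k j)) (hW.nonneg k j)
      _ = bil (wgt Z θ γ) (fun _ _ => B) (degreeEffect s) := rfl
      _ = 2 * B := by
          rw [hs, degreeEffect_sCol hN, bil_addFun_single_right, ← Finset.sum_mul,
            ← Finset.sum_mul, sum_outW_div hn hW, sum_inW_div hn hW]
          ring
  have hDd : √(bil (wgt Z θ γ) (degreeEffect d) (degreeEffect d)) ≤ 1 / (n * m ^ 2) := by
    rw [← Real.sqrt_sq (by positivity : (0 : ℝ) ≤ 1 / (n * m ^ 2))]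
    exact Real.sqrt_le_sqrt (bil_colErr_self_le hn hW i)
  -- the covariate term
  have h3 : |bil (wgt Z θ γ) (covComb Z (γ' - γ)) (degreeEffect u)| ≤ b * (2 + 1 / m ^ 2) := by
    rw [hDu, bil_add_right]
    refine (abs_add_le _ _).trans ?_
    have e1 : |bil (wgt Z θ γ) (covComb Z (γ' - γ)) (degreeEffect s)| ≤ 2 * b := by
      refine le_trans ?_ (hS2 _ b hb hc)
      refine (Finset.abs_sum_le_sum_abs _ _).trans (Finset.sum_le_sum fun k _ => ?_)
      refine (Finset.abs_sum_le_sum_abs _ _).trans (Finset.sum_le_sum fun j _ => ?_)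
      rw [abs_mul, abs_mul, abs_of_nonneg (hW.nonneg k j)]
    have e2 : |bil (wgt Z θ γ) (covComb Z (γ' - γ)) (degreeEffect d)| ≤
        (n * b / 2) * (1 / (n * m ^ 2)) := by
      refine (abs_bil_le hW _ _).trans ?_
      refine mul_le_mul ?_ hDd (Real.sqrt_nonneg _) (by positivity)
      rw [← Real.sqrt_sq (by positivity : (0 : ℝ) ≤ n * b / 2)]
      refine Real.sqrt_le_sqrt ((bil_self_le_of_abs_le hW _ hc).trans (le_of_eq (by ring)))
    have e3 : (n * b / 2) * (1 / (n * m ^ 2)) = b / m ^ 2 / 2 := by field_simp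
    have e4 : 0 ≤ b / m ^ 2 := by positivity
    rw [e3] at e2
    have e5 : b * (2 + 1 / m ^ 2) = 2 * b + b / m ^ 2 := by ring
    linarith
  -- the second order term
  have h4 := abs_bil_probInc_sub_le (Z := Z) (θ := θ) (γ := γ)
    (fun i j hij => (hh i j hij).trans hη) (degreeEffect u)
  have h5 : ∑ k, ∑ j, wgt Z θ γ k j * h k j ^ 2 * |degreeEffect u k j| ≤
      2 * η ^ 2 + η * e₀ / (n * m ^ 2) := by
    -- Against the column of S both factors of h² are bounded by η. Against the error one factor is
    -- bounded by η, and the other goes with the error into Cauchy–Schwarz, which uses both small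
    -- energies.
    have e1 := hS2 (fun k j => h k j ^ 2) (η ^ 2) (by positivity) (fun k j hkj => by
      rw [abs_of_nonneg (sq_nonneg _), ← sq_abs]
      exact pow_le_pow_left₀ (abs_nonneg _) (hh k j hkj) 2)
    have e2 := sum_abs_bil_le hW h (degreeEffect d)
    have e3 : √(bil (wgt Z θ γ) h h) ≤ e₀ := by
      rw [← Real.sqrt_sq he₀]; exact Real.sqrt_le_sqrt hE
    have e4 : ∑ k, ∑ j, wgt Z θ γ k j * (|h k j| * |degreeEffect d k j|) ≤
        e₀ * (1 / (n * m ^ 2)) :=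
      e2.trans (mul_le_mul e3 hDd (Real.sqrt_nonneg _) he₀)
    calc _ ≤ ∑ k, ∑ j, (wgt Z θ γ k j * (|h k j ^ 2| * |degreeEffect s k j|)
          + η * (wgt Z θ γ k j * (|h k j| * |degreeEffect d k j|))) := by
          refine Finset.sum_le_sum fun k _ => Finset.sum_le_sum fun j _ => ?_
          rcases eq_or_ne k j with rfl | hkj
          · rw [hW.diag]; simp
          · have f1 : |degreeEffect u k j| ≤ |degreeEffect s k j| + |degreeEffect d k j| := by
              rw [hDu]; exact abs_add_le _ _
            have f2 : h k j ^ 2 ≤ η * |h k j| := by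
              rw [← sq_abs, sq]
              exact mul_le_mul_of_nonneg_right (hh k j hkj) (abs_nonneg _)
            have f3 := hW.nonneg k j
            rw [abs_of_nonneg (sq_nonneg (h k j))]
            calc wgt Z θ γ k j * h k j ^ 2 * |degreeEffect u k j|
                ≤ wgt Z θ γ k j * h k j ^ 2 * (|degreeEffect s k j| + |degreeEffect d k j|) := by
                  gcongr
              _ = wgt Z θ γ k j * (h k j ^ 2 * |degreeEffect s k j|)
                  + wgt Z θ γ k j * (h k j ^ 2 * |degreeEffect d k j|) := by ring
              _ ≤ wgt Z θ γ k j * (h k j ^ 2 * |degreeEffect s k j|)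
                  + wgt Z θ γ k j * (η * |h k j| * |degreeEffect d k j|) := by gcongr
              _ = _ := by ring
      _ = ∑ k, ∑ j, wgt Z θ γ k j * (|h k j ^ 2| * |degreeEffect s k j|)
          + η * ∑ k, ∑ j, wgt Z θ γ k j * (|h k j| * |degreeEffect d k j|) := by
          simp only [Finset.sum_add_distrib, Finset.mul_sum]
      _ ≤ 2 * η ^ 2 + η * (e₀ * (1 / (n * m ^ 2))) :=
          add_le_add e1 (mul_le_mul_of_nonneg_left e4 hη0)
      _ = _ := by ring
  rw [hweak, h1, h2] at h4
  have h6 : 2 * η * e₀ / (n * m ^ 2) = 2 * (η * e₀ / (n * m ^ 2)) := by ring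
  rw [h6]
  rw [abs_le] at h3 h4 ⊢
  constructor <;> linarith

end approx

end

section

/-! ### Moments of the discrete Laplace law -/

/-- The variance `2r / (1 - r)²` of the discrete Laplace law with parameter `r`. -/
def lapVar (r : ℝ) : ℝ := 2 * r / (1 - r) ^ 2

/-- From k² = 2·C(k+2, 2) - 3·C(k+1, 1) + 1 and the binomial geometric series. -/
lemma hasSum_sq_mul_geometric {r : ℝ} (h0 : 0 ≤ r) (h1 : r < 1) :
    HasSum (fun k : ℕ => (k : ℝ) ^ 2 * r ^ k) (r * (1 + r) / (1 - r) ^ 3) := by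
  have hr : ‖r‖ < 1 := by rwa [Real.norm_of_nonneg h0]
  have hr1 : (1 - r) ≠ 0 := by linarith
  have a2 := (hasSum_choose_mul_geometric_of_norm_lt_one 2 hr).mul_left 2
  have a1 := (hasSum_choose_mul_geometric_of_norm_lt_one 1 hr).mul_left 3
  have a0 := hasSum_geometric_of_norm_lt_one hr
  convert! (a2.sub a1).add a0 using 1
  · funext k
    have : (((k + 2).choose 2 : ℕ) : ℝ) = (k + 2) * (k + 1) / 2 := by
      rw [Nat.cast_choose_two]; push_cast; ring
    simp only [this, Nat.choose_one_right]
    push_cast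
    ring
  · field_simp
    ring

lemma hasSum_int_of_even {f : ℤ → ℝ} (hf : ∀ x, f (-x) = f x) (h0 : f 0 = 0) {c : ℝ}
    (h : HasSum (fun k : ℕ => f k) c) : HasSum f (2 * c) := by
  have h' : HasSum (fun k : ℕ => f (-(k : ℤ))) c := by simpa only [hf] using h
  have := h.of_nat_of_neg h'
  rwa [h0, sub_zero, ← two_mul] at this

/-- An upper bound for the third moment is enough, so a single binomial replaces the exact expansion
of k³. -/
lemma pow_three_le_choose (k : ℕ) : (k : ℝ) ^ 3 ≤ 6 * ((k + 3).choose 3 : ℕ) := by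
  have h : (k + 3).descFactorial 3 = 6 * (k + 3).choose 3 := by
    rw [Nat.descFactorial_eq_factorial_mul_choose]; rfl
  have h2 : (k + 3).descFactorial 3 = (k + 1) * ((k + 2) * (k + 3)) := by
    simp only [Nat.descFactorial_succ, Nat.descFactorial_zero, mul_one]
    have e1 : k + 3 - 0 = k + 3 := rfl
    have e2 : k + 3 - 1 = k + 2 := rfl
    have e3 : k + 3 - 2 = k + 1 := rfl
    rw [e1, e2, e3]
  have h3 : (k : ℝ) ^ 3 ≤ ((k + 1) * ((k + 2) * (k + 3)) : ℕ) := by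
    push_cast
    have : (0 : ℝ) ≤ k := Nat.cast_nonneg k
    nlinarith [mul_nonneg this this]
  rw [← h2, h] at h3
  push_cast at h3
  exact_mod_cast h3

section law

variable {Ω : Type*} [MeasurableSpace Ω] {P : Measure Ω} {X : Ω → ℤ}

lemma integrable_comp_int [IsProbabilityMeasure P] (hX : Measurable X) {f : ℤ → ℝ}
    (hf : Summable fun x => P.real {ω | X ω = x} * |f x|) : Integrable (fun ω => f (X ω)) P := by
  have h1 : ∀ x, ((P.map X) {x}).toReal = P.real {ω | X ω = x} := fun x => by
    rw [Measure.map_apply hX (measurableSet_singleton x)]; rfl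
  have : Integrable f (P.map X) := by
    rw [← Measure.sum_smul_dirac (P.map X)]
    refine integrable_sum_dirac (fun x => measure_ne_top _ _) ?_
    simpa only [h1, Real.norm_eq_abs] using hf
  exact this.comp_measurable hX

lemma hasSum_integral_comp_int [IsProbabilityMeasure P] (hX : Measurable X) {f : ℤ → ℝ}
    (hf : Summable fun x => P.real {ω | X ω = x} * |f x|) :
    HasSum (fun x => P.real {ω | X ω = x} * f x) (∫ ω, f (X ω) ∂P) := by
  have h1 : ∀ x, ((P.map X) {x}).toReal = P.real {ω | X ω = x} := fun x => by
    rw [Measure.map_apply hX (measurableSet_singleton x)]; rfl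
  rw [← integral_map (φ := X) (f := f) hX.aemeasurable (by fun_prop)]
  have := hasSum_integral_sum_dirac (x := fun x : ℤ => x) (c := fun x => (P.map X) {x}) (f := f)
    (fun x => measure_ne_top _ _) (by simpa only [h1, Real.norm_eq_abs] using hf)
  rw [Measure.sum_smul_dirac] at this
  simpa only [h1, smul_eq_mul] using this

variable {r : ℝ}

/-- The discrete Laplace law with parameter `r`. -/
structure IsLaplace (X : Ω → ℤ) (P : Measure Ω) (r : ℝ) : Prop where
  meas : Measurable X
  pos : 0 < r
  lt_one : r < 1
  law : ∀ x : ℤ, P.real {ω | X ω = x} = (1 - r) / (1 + r) * r ^ x.natAbs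

namespace IsLaplace

lemma hasSum_sq (h : IsLaplace X P r) :
    HasSum (fun x : ℤ => P.real {ω | X ω = x} * (x : ℝ) ^ 2) (lapVar r) := by
  have h0 := h.pos
  have h1 : (1 - r) ≠ 0 := by linarith [h.lt_one]
  have h2 : (1 + r) ≠ 0 := by linarith
  have := hasSum_int_of_even (f := fun x : ℤ => P.real {ω | X ω = x} * (x : ℝ) ^ 2)
    (c := (1 - r) / (1 + r) * (r * (1 + r) / (1 - r) ^ 3)) (fun x => by simp [h.law]) (by simp)
    (by simpa [h.law, mul_assoc, mul_comm, mul_left_comm] using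
          (hasSum_sq_mul_geometric h0.le h.lt_one).mul_left ((1 - r) / (1 + r)))
  convert! this using 1
  rw [lapVar]
  field_simp

lemma summable_sq (h : IsLaplace X P r) :
    Summable (fun x : ℤ => P.real {ω | X ω = x} * |(x : ℝ) ^ 2|) := by
  simpa only [abs_pow, sq_abs] using h.hasSum_sq.summable

lemma integrable_sq [IsProbabilityMeasure P] (h : IsLaplace X P r) : Integrable (fun ω => (X ω : ℝ) ^ 2) P :=
  integrable_comp_int h.meas (f := fun x => (x : ℝ) ^ 2) h.summable_sq

lemma integral_sq [IsProbabilityMeasure P] (h : IsLaplace X P r) : ∫ ω, (X ω : ℝ) ^ 2 ∂P = lapVar r :=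
  (hasSum_integral_comp_int h.meas (f := fun x => (x : ℝ) ^ 2) h.summable_sq).unique h.hasSum_sq

lemma summable_id (h : IsLaplace X P r) :
    Summable (fun x : ℤ => P.real {ω | X ω = x} * |(x : ℝ)|) := by
  refine h.summable_sq.of_nonneg_of_le (fun x => by positivity) fun x => ?_
  refine mul_le_mul_of_nonneg_left ?_ measureReal_nonneg
  have : (|x| : ℤ) ≤ |x ^ 2| := by
    rcases eq_or_ne x 0 with rfl | hx
    · simp
    · rw [abs_pow, sq]
      exact le_mul_of_one_le_left (abs_nonneg x) (Int.one_le_abs hx)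
  exact_mod_cast this

lemma integral_eq_zero [IsProbabilityMeasure P] (h : IsLaplace X P r) : ∫ ω, (X ω : ℝ) ∂P = 0 := by
  have h1 := hasSum_integral_comp_int h.meas (f := fun x => (x : ℝ)) h.summable_id
  have h2 := (Equiv.neg ℤ).hasSum_iff.2 h1
  have h3 : ((fun x : ℤ => P.real {ω | X ω = x} * (x : ℝ)) ∘ (Equiv.neg ℤ)) =
      fun x : ℤ => -(P.real {ω | X ω = x} * (x : ℝ)) := by
    funext x; simp [h.law]
  rw [h3] at h2
  have := h2.unique h1.neg
  linarith

lemma hasSum_cube_le (h : IsLaplace X P r) :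
    ∃ c ≤ 12 / (1 - r) ^ 3, HasSum (fun x : ℤ => P.real {ω | X ω = x} * |(x : ℝ)| ^ 3) c := by
  have h0 := h.pos
  have h1 : 0 < 1 - r := by linarith [h.lt_one]
  have hr : ‖r‖ < 1 := by rw [Real.norm_of_nonneg h0.le]; exact h.lt_one
  have e3 := (hasSum_choose_mul_geometric_of_norm_lt_one 3 hr).mul_left 6
  have hs : ∀ k : ℕ, (k : ℝ) ^ 3 * r ^ k ≤ 6 * (((k + 3).choose 3 : ℕ) * r ^ k) := fun k => by
    rw [← mul_assoc]
    exact mul_le_mul_of_nonneg_right (pow_three_le_choose k) (by positivity)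
  have hsum := e3.summable.of_nonneg_of_le (fun k => by positivity) hs
  have hle := hasSum_le hs hsum.hasSum e3
  refine ⟨2 * ((1 - r) / (1 + r) * ∑' k : ℕ, (k : ℝ) ^ 3 * r ^ k), ?_,
    hasSum_int_of_even (fun x => by simp [h.law]) (by simp) ?_⟩
  · calc _ ≤ 2 * ((1 - r) * (6 * (1 / (1 - r) ^ (3 + 1)))) := by
          gcongr
          exact div_le_self h1.le (by linarith)
      _ = _ := by field_simp; ring
  · simpa [h.law, mul_assoc, mul_comm, mul_left_comm] using
      hsum.hasSum.mul_left ((1 - r) / (1 + r))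

lemma integrable_cube [IsProbabilityMeasure P] (h : IsLaplace X P r) : Integrable (fun ω => |(X ω : ℝ)| ^ 3) P := by
  obtain ⟨c, -, hc⟩ := h.hasSum_cube_le
  exact integrable_comp_int h.meas (f := fun x => |(x : ℝ)| ^ 3)
    (by simpa only [abs_pow, abs_abs] using hc.summable)

lemma integral_cube_le [IsProbabilityMeasure P] (h : IsLaplace X P r) :
    ∫ ω, |(X ω : ℝ)| ^ 3 ∂P ≤ 12 / (1 - r) ^ 3 := by
  obtain ⟨c, hc0, hc⟩ := h.hasSum_cube_le
  rw [(hasSum_integral_comp_int h.meas (f := fun x => |(x : ℝ)| ^ 3)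
    (by simpa only [abs_pow, abs_abs] using hc.summable)).unique hc]
  exact hc0

end IsLaplace

end law

lemma laplaceParam_pos (ε : ℝ) : 0 < laplaceParam ε := Real.exp_pos _

lemma laplaceParam_lt_one {ε : ℝ} (hε : 0 < ε) : laplaceParam ε < 1 := by
  rw [laplaceParam, Real.exp_lt_one_iff]; linarith

lemma lapVar_laplaceParam_nonneg (ε : ℝ) : 0 ≤ lapVar (laplaceParam ε) := by
  have := laplaceParam_pos ε
  unfold lapVar; positivity

lemma kappa_pos {ε : ℝ} (hε : 0 < ε) : 0 < kappa ε := by unfold kappa; positivity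

/-- `σ² = 1 / (2 sinh² (ε/4)) ≤ 8 / ε²`. -/
lemma lapVar_le {ε : ℝ} (hε : 0 < ε) : lapVar (laplaceParam ε) ≤ kappa ε ^ 2 / 2 := by
  set y := Real.exp (ε / 4) with hy
  have hy1 : 1 + ε / 4 ≤ y := by have := Real.add_one_le_exp (ε / 4); linarith
  have hr : laplaceParam ε = 1 / y ^ 2 := by
    rw [laplaceParam, hy, ← Real.exp_nat_mul, one_div, ← Real.exp_neg]
    congr 1; push_cast; ring
  have hs : ε / 4 ≤ Real.sinh (ε / 4) := Real.self_le_sinh_iff.2 (by positivity)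
  have hs2 : 2 * Real.sinh (ε / 4) = y - 1 / y := by
    rw [Real.sinh_eq, hy, one_div, ← Real.exp_neg]; ring
  have hy0 : 0 < y := Real.exp_pos _
  have h1 : lapVar (laplaceParam ε) = 2 / (y - 1 / y) ^ 2 := by
    have hy2 : y - 1 / y ≠ 0 := by rw [← hs2]; positivity
    have hy3 : 1 - 1 / y ^ 2 ≠ 0 := by
      intro h; apply hy2
      have : y - 1 / y = y * (1 - 1 / y ^ 2) := by field_simp
      rw [this, h, mul_zero]
    rw [lapVar, hr, div_eq_div_iff (by positivity) (by positivity)]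
    field_simp
  rw [h1, ← hs2, kappa]
  rw [div_pow, div_div, div_le_div_iff₀ (by positivity) (by positivity)]
  nlinarith [mul_self_le_mul_self (by positivity) hs]

end

section

variable {n p : ℕ}

/-! ### The linear statistics as sums of independent variables -/

lemma sum_edge (g : Fin n → Fin n → ℝ) :
    ∑ e : Edge n, g e.1.1 e.1.2 = ∑ i, ∑ j, if i = j then 0 else g i j := by
  rw [← Fintype.sum_prod_type' (f := fun i j => if i = j then 0 else g i j),
    Finset.sum_congr rfl (g := fun x : Fin n × Fin n => if x.1 ≠ x.2 then g x.1 x.2 else 0)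
      (fun x _ => by simp only [ne_eq, ite_not]), ← Finset.sum_filter]
  exact (Finset.sum_subtype (Finset.univ.filter fun x : Fin n × Fin n => x.1 ≠ x.2)
    (fun x => by simp) (fun x => g x.1 x.2)).symm

lemma sum_inr_mul (hn : 3 ≤ n) (x : Idx n → ℝ) (g : Fin n → ℝ) :
    ∑ j, x (Sum.inr j) * g (inNode j) = ∑ j, beta x j * g j := by
  obtain ⟨N, hN⟩ := exists_last hn
  rw [sum_eq_sum_inNode_add hN]
  have hb : beta x N = 0 := by simp [beta, hN]
  simp only [beta_inNode, hb, zero_mul, add_zero]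

/-- The value of a source, centred at its mean. -/
def centred (Z : Fin n → Fin n → Fin p → ℝ) (θ : Idx n → ℝ) (γ : Fin p → ℝ) :
    Edge n ⊕ (Fin n ⊕ Fin n) → ℤ → ℝ :=
  Sum.elim (fun e x => x - edgeProb Z θ γ e.1.1 e.1.2) (fun _ x => x)

/-- The coefficients of the sources in a linear statistic. -/
def srcCoef (f : Fin n → Fin n → ℝ) (x : Idx n → ℝ) : Edge n ⊕ (Fin n ⊕ Fin n) → ℝ :=
  Sum.elim (fun e => f e.1.1 e.1.2) (Sum.elim (fun i => x (Sum.inl i)) (beta x))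

/-- The variances of the sources. -/
def srcVar (Z : Fin n → Fin n → Fin p → ℝ) (θ : Idx n → ℝ) (γ : Fin p → ℝ) (ε : ℝ) :
    Edge n ⊕ (Fin n ⊕ Fin n) → ℝ :=
  Sum.elim (fun e => edgeWeight Z θ γ e.1.1 e.1.2) (fun _ => lapVar (laplaceParam ε))

/-- Bounds for the third absolute moments of the sources. -/
def srcCube (Z : Fin n → Fin n → Fin p → ℝ) (θ : Idx n → ℝ) (γ : Fin p → ℝ) (ε : ℝ) :
    Edge n ⊕ (Fin n ⊕ Fin n) → ℝ :=
  Sum.elim (fun e => edgeWeight Z θ γ e.1.1 e.1.2) (fun _ => 12 / (1 - laplaceParam ε) ^ 3)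

variable {Z : Fin n → Fin n → Fin p → ℝ} {θ : Idx n → ℝ} {γ : Fin p → ℝ} {ε : ℝ}

/-- The sum of the squares of the noise coefficients. -/
def sumSq (x : Idx n → ℝ) : ℝ := ∑ r, x r ^ 2

lemma sum_beta_sq (hn : 3 ≤ n) (x : Idx n → ℝ) :
    ∑ i, x (Sum.inl i) ^ 2 + ∑ j, beta x j ^ 2 = sumSq x := by
  obtain ⟨N, hN⟩ := exists_last hn
  have hb : beta x N = 0 := by simp [beta, hN]
  rw [sumSq, Fintype.sum_sum_type, sum_eq_sum_inNode_add hN (fun j => beta x j ^ 2), hb]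
  simp only [beta_inNode]
  ring

/-- The variance of an edge is its weight, so the variance of the edge part is the energy of f.
Information and covariance are given by the same form. -/
lemma sum_srcCoef_sq_mul_srcVar (hn : 3 ≤ n) (f : Fin n → Fin n → ℝ) (x : Idx n → ℝ) :
    ∑ s, srcCoef f x s ^ 2 * srcVar Z θ γ ε s =
      bil (wgt Z θ γ) f f + lapVar (laplaceParam ε) * sumSq x := by
  rw [← sum_beta_sq hn]
  simp only [Fintype.sum_sum_type, srcCoef, srcVar, Sum.elim_inl, Sum.elim_inr]
  rw [sum_edge (fun i j => f i j ^ 2 * edgeWeight Z θ γ i j), mul_add, Finset.mul_sum,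
    Finset.mul_sum]
  congr 1
  · refine Finset.sum_congr rfl fun i _ => Finset.sum_congr rfl fun j _ => ?_
    unfold wgt
    split_ifs <;> ring
  · congr 1 <;> exact Finset.sum_congr rfl fun j _ => mul_comm _ _

lemma linStat_eq_sum (hn : 3 ≤ n) {A : Fin n → Fin n → ℤ} {eO eI : Fin n → ℤ}
    (f : Fin n → Fin n → ℝ) (x : Idx n → ℝ) :
    linStat Z θ γ A eO eI f x = ∑ s, srcCoef f x s * centred Z θ γ s
      ((Sum.elim (fun e : Edge n => A e.1.1 e.1.2) (Sum.elim eO eI) :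
        Edge n ⊕ (Fin n ⊕ Fin n) → ℤ) s) := by
  simp only [Fintype.sum_sum_type, srcCoef, centred, Sum.elim_inl, Sum.elim_inr]
  rw [sum_edge (fun i j => f i j * ((A i j : ℝ) - edgeProb Z θ γ i j)), linStat,
    sum_inr_mul hn x (fun j => (eI j : ℝ))]
  congr 1
  refine Finset.sum_congr rfl fun i _ => Finset.sum_congr rfl fun j _ => ?_
  unfold resid
  split_ifs <;> simp [mul_comm]

lemma edgeProb_pos (i j : Fin n) : 0 < edgeProb Z θ γ i j := sigm_pos _

lemma edgeProb_lt_one (i j : Fin n) : edgeProb Z θ γ i j < 1 := sigm_lt_one _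

lemma edgeWeight_eq (i j : Fin n) :
    edgeWeight Z θ γ i j = edgeProb Z θ γ i j * (1 - edgeProb Z θ γ i j) := sigw_eq _

section model

variable {Ω : Type*} [MeasurableSpace Ω] {P : Measure Ω} [IsProbabilityMeasure P]
  {a : Fin n → Fin n → Ω → ℤ} {eO eI : Fin n → Ω → ℤ}

namespace IsModel

omit [IsProbabilityMeasure P] in
lemma measurable_edge (M : IsModel P Z θ γ ε a eO eI) {i j : Fin n} (hij : i ≠ j) :
    Measurable (a i j) := M.measurable_sources (Sum.inl ⟨(i, j), hij⟩)

omit [IsProbabilityMeasure P] in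
lemma isLaplace_out (M : IsModel P Z θ γ ε a eO eI) (hε : 0 < ε) (i : Fin n) :
    IsLaplace (eO i) P (laplaceParam ε) :=
  ⟨M.measurable_sources (Sum.inr (Sum.inl i)), laplaceParam_pos ε, laplaceParam_lt_one hε,
    M.noise_out i⟩

omit [IsProbabilityMeasure P] in
lemma isLaplace_in (M : IsModel P Z θ γ ε a eO eI) (hε : 0 < ε) (i : Fin n) :
    IsLaplace (eI i) P (laplaceParam ε) :=
  ⟨M.measurable_sources (Sum.inr (Sum.inr i)), laplaceParam_pos ε, laplaceParam_lt_one hε,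
    M.noise_in i⟩

lemma edge_ae (M : IsModel P Z θ γ ε a eO eI) {i j : Fin n} (hij : i ≠ j) :
    ∀ᵐ ω ∂P, a i j ω = 1 ∨ a i j ω = 0 := by
  have hm := M.measurable_edge hij
  have m1 : MeasurableSet {ω | a i j ω = 1} := hm (measurableSet_singleton 1)
  have m0 : MeasurableSet {ω | a i j ω = 0} := hm (measurableSet_singleton 0)
  have h1 : P.real ({ω | a i j ω = 1} ∪ {ω | a i j ω = 0}) = 1 := by
    rw [measureReal_union _ m0, M.edge_one i j hij, M.edge_zero i j hij]
    · ring
    · rw [Set.disjoint_left]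
      rintro ω (h : a i j ω = 1) (h' : a i j ω = 0)
      omega
  have h2 := prob_compl_eq_zero_iff (μ := P) (m1.union m0)
  rw [ae_iff]
  have h3 : P ({ω | a i j ω = 1} ∪ {ω | a i j ω = 0}) = 1 := by
    rw [measureReal_def] at h1
    rw [← ENNReal.ofReal_toReal (measure_ne_top P _), h1, ENNReal.ofReal_one]
  exact h2.2 h3

lemma edge_comp_ae (M : IsModel P Z θ γ ε a eO eI) {i j : Fin n} (hij : i ≠ j) (g : ℤ → ℝ) :
    (fun ω => g (a i j ω)) =ᵐ[P]
      fun ω => g 0 + {ω | a i j ω = 1}.indicator (fun _ => g 1 - g 0) ω := by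
  filter_upwards [M.edge_ae hij] with ω hω
  rcases hω with h | h <;> simp [h]

lemma edge_integrable (M : IsModel P Z θ γ ε a eO eI) {i j : Fin n} (hij : i ≠ j) (g : ℤ → ℝ) :
    Integrable (fun ω => g (a i j ω)) P := by
  have m1 : MeasurableSet {ω | a i j ω = 1} := M.measurable_edge hij (measurableSet_singleton 1)
  rw [integrable_congr (M.edge_comp_ae hij g)]
  exact (integrable_const _).add ((integrable_const _).indicator m1)

lemma edge_integral (M : IsModel P Z θ γ ε a eO eI) {i j : Fin n} (hij : i ≠ j) (g : ℤ → ℝ) :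
    ∫ ω, g (a i j ω) ∂P = edgeProb Z θ γ i j * g 1 + (1 - edgeProb Z θ γ i j) * g 0 := by
  have m1 : MeasurableSet {ω | a i j ω = 1} := M.measurable_edge hij (measurableSet_singleton 1)
  rw [integral_congr_ae (M.edge_comp_ae hij g), integral_add (integrable_const _)
    ((integrable_const _).indicator m1), integral_indicator_const _ m1, M.edge_one i j hij]
  simp
  ring

lemma integrable_centred_sq (M : IsModel P Z θ γ ε a eO eI) (hε : 0 < ε)
    (s : Edge n ⊕ (Fin n ⊕ Fin n)) :
    Integrable (fun ω => centred Z θ γ s (sources a eO eI s ω) ^ 2) P := by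
  rcases s with e | i | i
  · exact M.edge_integrable e.2 (fun x => ((x : ℝ) - edgeProb Z θ γ e.1.1 e.1.2) ^ 2)
  · exact (M.isLaplace_out hε i).integrable_sq
  · exact (M.isLaplace_in hε i).integrable_sq

omit [IsProbabilityMeasure P] in
lemma measurable_centred (M : IsModel P Z θ γ ε a eO eI) (s : Edge n ⊕ (Fin n ⊕ Fin n)) :
    Measurable (fun ω => centred Z θ γ s (sources a eO eI s ω)) :=
  (measurable_of_countable (centred Z θ γ s)).comp (M.measurable_sources s)

lemma memLp_centred (M : IsModel P Z θ γ ε a eO eI) (hε : 0 < ε)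
    (s : Edge n ⊕ (Fin n ⊕ Fin n)) :
    MemLp (fun ω => centred Z θ γ s (sources a eO eI s ω)) 2 P := by
  rw [memLp_two_iff_integrable_sq (M.measurable_centred s).aestronglyMeasurable]
  exact M.integrable_centred_sq hε s

lemma integral_centred (M : IsModel P Z θ γ ε a eO eI) (hε : 0 < ε)
    (s : Edge n ⊕ (Fin n ⊕ Fin n)) :
    ∫ ω, centred Z θ γ s (sources a eO eI s ω) ∂P = 0 := by
  rcases s with e | i | i
  · refine (M.edge_integral e.2 (fun x => (x : ℝ) - edgeProb Z θ γ e.1.1 e.1.2)).trans ?_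
    push_cast
    ring
  · exact (M.isLaplace_out hε i).integral_eq_zero
  · exact (M.isLaplace_in hε i).integral_eq_zero

lemma integral_centred_sq (M : IsModel P Z θ γ ε a eO eI) (hε : 0 < ε)
    (s : Edge n ⊕ (Fin n ⊕ Fin n)) :
    ∫ ω, centred Z θ γ s (sources a eO eI s ω) ^ 2 ∂P = srcVar Z θ γ ε s := by
  rcases s with e | i | i
  · refine (M.edge_integral e.2 (fun x => ((x : ℝ) - edgeProb Z θ γ e.1.1 e.1.2) ^ 2)).trans ?_
    simp only [srcVar, Sum.elim_inl, edgeWeight_eq]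
    push_cast
    ring
  · exact (M.isLaplace_out hε i).integral_sq
  · exact (M.isLaplace_in hε i).integral_sq

lemma integrable_centred_cube (M : IsModel P Z θ γ ε a eO eI) (hε : 0 < ε)
    (s : Edge n ⊕ (Fin n ⊕ Fin n)) :
    Integrable (fun ω => |centred Z θ γ s (sources a eO eI s ω)| ^ 3) P := by
  rcases s with e | i | i
  · exact M.edge_integrable e.2 (fun x => |(x : ℝ) - edgeProb Z θ γ e.1.1 e.1.2| ^ 3)
  · exact (M.isLaplace_out hε i).integrable_cube
  · exact (M.isLaplace_in hε i).integrable_cube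

lemma integral_centred_cube_le (M : IsModel P Z θ γ ε a eO eI) (hε : 0 < ε)
    (s : Edge n ⊕ (Fin n ⊕ Fin n)) :
    ∫ ω, |centred Z θ γ s (sources a eO eI s ω)| ^ 3 ∂P ≤ srcCube Z θ γ ε s := by
  rcases s with e | i | i
  · refine (M.edge_integral e.2
      (fun x => |(x : ℝ) - edgeProb Z θ γ e.1.1 e.1.2| ^ 3)).trans_le ?_
    simp only [srcCube, Sum.elim_inl, edgeWeight_eq]
    have h0 := edgeProb_pos (Z := Z) (θ := θ) (γ := γ) e.1.1 e.1.2
    have h1 := edgeProb_lt_one (Z := Z) (θ := θ) (γ := γ) e.1.1 e.1.2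
    set x := edgeProb Z θ γ e.1.1 e.1.2
    have h2 : 0 < 1 - x := by linarith
    push_cast
    rw [zero_sub, abs_neg, abs_of_pos h0, abs_of_pos h2]
    -- The third absolute moment is x(1 - x)(x² + (1 - x)²), and the bracket is at most 1.
    nlinarith [mul_pos h0 h2]
  · exact (M.isLaplace_out hε i).integral_cube_le
  · exact (M.isLaplace_in hε i).integral_cube_le

omit [IsProbabilityMeasure P] in
lemma iIndepFun_centred (M : IsModel P Z θ γ ε a eO eI) :
    iIndepFun (fun s ω => centred Z θ γ s (sources a eO eI s ω)) P :=
  M.indep.comp (fun s => centred Z θ γ s) fun _ => measurable_of_countable _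

/-- The sum of the sources with coefficients `c` has mean zero and the variance `∑ c² v`. -/
lemma memLp_sum_centred (M : IsModel P Z θ γ ε a eO eI) (hε : 0 < ε)
    (c : Edge n ⊕ (Fin n ⊕ Fin n) → ℝ) :
    MemLp (fun ω => ∑ s, c s * centred Z θ γ s (sources a eO eI s ω)) 2 P :=
  memLp_finsetSum _ fun _ _ => (M.memLp_centred hε _).const_mul (c _)

lemma integral_sum_centred (M : IsModel P Z θ γ ε a eO eI) (hε : 0 < ε)
    (c : Edge n ⊕ (Fin n ⊕ Fin n) → ℝ) :
    ∫ ω, ∑ s, c s * centred Z θ γ s (sources a eO eI s ω) ∂P = 0 := by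
  rw [integral_finsetSum _ fun s _ =>
    (((M.memLp_centred hε s).const_mul (c s)).integrable one_le_two)]
  refine Finset.sum_eq_zero fun s _ => ?_
  rw [integral_const_mul, M.integral_centred hε, mul_zero]

lemma variance_sum_centred (M : IsModel P Z θ γ ε a eO eI) (hε : 0 < ε)
    (c : Edge n ⊕ (Fin n ⊕ Fin n) → ℝ) :
    variance (fun ω => ∑ s, c s * centred Z θ γ s (sources a eO eI s ω)) P =
      ∑ s, c s ^ 2 * srcVar Z θ γ ε s := by
  have h1 : (fun ω => ∑ s, c s * centred Z θ γ s (sources a eO eI s ω)) =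
      ∑ s, fun ω => c s * centred Z θ γ s (sources a eO eI s ω) := by
    funext ω; simp
  have hind : iIndepFun (fun s ω => c s * centred Z θ γ s (sources a eO eI s ω)) P :=
    M.iIndepFun_centred.comp (fun s y => c s * y) fun s => by fun_prop
  rw [h1, IndepFun.variance_sum (fun s _ => (M.memLp_centred hε s).const_mul (c s))
    (fun s _ t _ hst => hind.indepFun hst)]
  refine Finset.sum_congr rfl fun s _ => ?_
  rw [variance_const_mul, variance_of_integral_eq_zero (M.measurable_centred s).aemeasurable
    (M.integral_centred hε s)]
  rw [M.integral_centred_sq hε]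

lemma integral_sum_centred_sq (M : IsModel P Z θ γ ε a eO eI) (hε : 0 < ε)
    (c : Edge n ⊕ (Fin n ⊕ Fin n) → ℝ) :
    ∫ ω, (∑ s, c s * centred Z θ γ s (sources a eO eI s ω)) ^ 2 ∂P =
      ∑ s, c s ^ 2 * srcVar Z θ γ ε s := by
  rw [← M.variance_sum_centred hε c, variance_of_integral_eq_zero
    (M.memLp_sum_centred hε c).aestronglyMeasurable.aemeasurable (M.integral_sum_centred hε c)]

/-- Chebyshev's inequality for a sum of the sources. -/
lemma measureReal_lt_abs_sum_le (M : IsModel P Z θ γ ε a eO eI) (hε : 0 < ε)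
    (c : Edge n ⊕ (Fin n ⊕ Fin n) → ℝ) {t : ℝ} (ht : 0 < t) :
    P.real {ω | t < |∑ s, c s * centred Z θ γ s (sources a eO eI s ω)|} ≤
      (∑ s, c s ^ 2 * srcVar Z θ γ ε s) / t ^ 2 := by
  have h := mul_meas_ge_le_integral_of_nonneg (μ := P)
    (f := fun ω => (∑ s, c s * centred Z θ γ s (sources a eO eI s ω)) ^ 2)
    (Eventually.of_forall fun ω => sq_nonneg _) (M.memLp_sum_centred hε c).integrable_sq (t ^ 2)
  rw [M.integral_sum_centred_sq hε c] at h
  rw [le_div_iff₀ (by positivity), mul_comm]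
  refine le_trans (mul_le_mul_of_nonneg_left (measureReal_mono ?_) (by positivity)) h
  intro ω (hω : t < _)
  change t ^ 2 ≤ _
  rw [← sq_abs (∑ s, _)]
  exact pow_le_pow_left₀ ht.le hω.le 2

end IsModel

end model

end

section

variable {n p : ℕ}

/-! ### The good event -/

/-- The deviation bounds for a graph and noises that imply the existence of the estimator. -/
structure IsGood (Z : Fin n → Fin n → Fin p → ℝ) (θ : Idx n → ℝ) (γ : Fin p → ℝ)
    (A : Fin n → Fin n → ℤ) (eO eI : Fin n → ℤ) (t B B₂ : ℝ) : Prop where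
  row : ∀ i, |∑ j, resid Z θ γ A i j| ≤ t
  col : ∀ j, |∑ i, resid Z θ γ A i j| ≤ t
  noise : ∑ i, (eO i : ℝ) ^ 2 + ∑ j, inNoise eO eI j ^ 2 ≤ B
  cov : ∀ l, |linStat Z θ γ A eO eI (covRes Z θ γ l) (-covProj Z θ γ l)| ≤ B₂

variable {Z : Fin n → Fin n → Fin p → ℝ} {θ : Idx n → ℝ} {γ : Fin p → ℝ} {ε : ℝ}

section det

variable {A : Fin n → Fin n → ℤ} {eO eI : Fin n → ℤ} {t B B₂ : ℝ}

lemma IsGood.scoreVec_sq_le (h : IsGood Z θ γ A eO eI t B B₂) :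
    ∑ i, (scoreVec Z θ γ A eO eI).1 i ^ 2 + ∑ j, (scoreVec Z θ γ A eO eI).2.1 j ^ 2 ≤
      4 * n * t ^ 2 + 2 * B := by
  have e : ∀ x y : ℝ, |x| ≤ t → (x + y) ^ 2 ≤ 2 * t ^ 2 + 2 * y ^ 2 := by
    intro x y hx
    have : x ^ 2 ≤ t ^ 2 := by rw [← sq_abs x]; exact pow_le_pow_left₀ (abs_nonneg _) hx 2
    nlinarith [sq_nonneg (x - y)]
  have h1 : ∑ i, (scoreVec Z θ γ A eO eI).1 i ^ 2 ≤ ∑ i, (2 * t ^ 2 + 2 * (eO i : ℝ) ^ 2) :=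
    Finset.sum_le_sum fun i _ => e _ _ (h.row i)
  have h2 : ∑ j, (scoreVec Z θ γ A eO eI).2.1 j ^ 2 ≤
      ∑ j, (2 * t ^ 2 + 2 * inNoise eO eI j ^ 2) :=
    Finset.sum_le_sum fun j _ => e _ _ (h.col j)
  simp only [Finset.sum_add_distrib, Finset.sum_const, Finset.card_univ, Fintype.card_fin,
    nsmul_eq_mul, ← Finset.mul_sum] at h1 h2
  linarith [h.noise]

lemma IsGood.abs_scoreVec_le (h : IsGood Z θ γ A eO eI t B B₂) (i : Fin n) :
    |(scoreVec Z θ γ A eO eI).1 i| ≤ t + √B ∧ |(scoreVec Z θ γ A eO eI).2.1 i| ≤ t + √B := by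
  have h1 := h.noise
  have n1 : (eO i : ℝ) ^ 2 ≤ ∑ i, (eO i : ℝ) ^ 2 :=
    Finset.single_le_sum (f := fun i => (eO i : ℝ) ^ 2) (fun i _ => sq_nonneg _)
      (Finset.mem_univ i)
  have n2 : inNoise eO eI i ^ 2 ≤ ∑ j, inNoise eO eI j ^ 2 :=
    Finset.single_le_sum (f := fun i => inNoise eO eI i ^ 2) (fun i _ => sq_nonneg _)
      (Finset.mem_univ i)
  have n3 : 0 ≤ ∑ i, (eO i : ℝ) ^ 2 := Finset.sum_nonneg fun i _ => sq_nonneg _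
  have n4 : 0 ≤ ∑ j, inNoise eO eI j ^ 2 := Finset.sum_nonneg fun i _ => sq_nonneg _
  constructor
  · exact (abs_add_le _ _).trans (add_le_add (h.row i) (Real.abs_le_sqrt (by linarith)))
  · exact (abs_add_le _ _).trans (add_le_add (h.col i) (Real.abs_le_sqrt (by linarith)))

end det

/-- The noise coefficients of `inNoise`. -/
def inNoiseCoef (j : Fin n) : Idx n → ℝ :=
  if h : (j : ℕ) < n - 1 then Pi.single (Sum.inr ⟨j, h⟩) 1 else Sum.elim 1 (-1)

lemma inNoise_eq_linStat {A : Fin n → Fin n → ℤ} {eO eI : Fin n → ℤ} (j : Fin n) :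
    inNoise eO eI j = linStat Z θ γ A eO eI 0 (inNoiseCoef j) := by
  have h0 : bil (resid Z θ γ A) 1 0 = 0 := by simp [bil]
  rw [linStat, h0, zero_add, inNoise, inNoiseCoef]
  split_ifs with h
  · simp [Pi.single_apply]
    rfl
  · simp [sub_eq_add_neg]

lemma out_eq_linStat {A : Fin n → Fin n → ℤ} {eO eI : Fin n → ℤ} (i : Fin n) :
    (eO i : ℝ) = linStat Z θ γ A eO eI 0 (Pi.single (Sum.inl i) 1) := by
  have h0 : bil (resid Z θ γ A) 1 0 = 0 := by simp [bil]
  rw [linStat, h0, zero_add]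
  simp [Pi.single_apply]

lemma sumSq_single (r : Idx n) : sumSq (Pi.single r 1) = 1 := by
  rw [sumSq, Finset.sum_eq_single r (fun s _ hs => by simp [hs]) (by simp)]
  simp

/-- There are n - 1 unit vectors and, for the last node, one vector with 2n - 1 entries ±1. The last
noise thus costs as much as all the others in order, which the Markov bound can afford. -/
lemma sum_sumSq_inNoiseCoef_le (hn : 3 ≤ n) : ∑ j : Fin n, sumSq (inNoiseCoef j) ≤ 3 * n := by
  obtain ⟨N, hN⟩ := exists_last hn
  rw [sum_eq_sum_inNode_add hN]
  have h1 : ∀ k : Fin (n - 1), sumSq (inNoiseCoef (inNode k)) = 1 := fun k => by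
    have hk : ((inNode k : Fin n) : ℕ) < n - 1 := by rw [inNode_val]; exact k.2
    rw [inNoiseCoef, dif_pos hk, sumSq_single]
  have h2 : sumSq (inNoiseCoef N) = n + (n - 1 : ℕ) := by
    rw [inNoiseCoef, dif_neg (by omega), sumSq, Fintype.sum_sum_type]
    simp
  simp only [h1, h2]
  simp only [Finset.sum_const, Finset.card_univ, Fintype.card_fin, nsmul_eq_mul, mul_one]
  have : ((n - 1 : ℕ) : ℝ) ≤ n := by exact_mod_cast Nat.sub_le n 1
  linarith

section model

variable {Ω : Type*} [MeasurableSpace Ω] {P : Measure Ω} [IsProbabilityMeasure P]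
  {a : Fin n → Fin n → Ω → ℤ} {eO eI : Fin n → Ω → ℤ}

omit [MeasurableSpace Ω] in
lemma linStat_eq_sum_sources (hn : 3 ≤ n) (f : Fin n → Fin n → ℝ) (x : Idx n → ℝ) (ω : Ω) :
    linStat Z θ γ (fun i j => a i j ω) (fun i => eO i ω) (fun i => eI i ω) f x =
      ∑ s, srcCoef f x s * centred Z θ γ s (sources a eO eI s ω) := by
  rw [linStat_eq_sum hn]
  refine Finset.sum_congr rfl fun s _ => ?_
  rcases s with e | i | i <;> rfl

namespace IsModel

lemma measureReal_lt_abs_linStat_le (M : IsModel P Z θ γ ε a eO eI) (hε : 0 < ε) (hn : 3 ≤ n)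
    (f : Fin n → Fin n → ℝ) (x : Idx n → ℝ) {t : ℝ} (ht : 0 < t) :
    P.real {ω | t < |linStat Z θ γ (fun i j => a i j ω) (fun i => eO i ω) (fun i => eI i ω) f x|} ≤
      (bil (wgt Z θ γ) f f + lapVar (laplaceParam ε) * sumSq x) / t ^ 2 := by
  rw [← sum_srcCoef_sq_mul_srcVar hn]
  simp only [linStat_eq_sum_sources hn]
  exact M.measureReal_lt_abs_sum_le hε _ ht

lemma integral_linStat_sq (M : IsModel P Z θ γ ε a eO eI) (hε : 0 < ε) (hn : 3 ≤ n)
    (f : Fin n → Fin n → ℝ) (x : Idx n → ℝ) :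
    ∫ ω, linStat Z θ γ (fun i j => a i j ω) (fun i => eO i ω) (fun i => eI i ω) f x ^ 2 ∂P =
      bil (wgt Z θ γ) f f + lapVar (laplaceParam ε) * sumSq x := by
  rw [← sum_srcCoef_sq_mul_srcVar hn]
  simp only [linStat_eq_sum_sources hn]
  exact M.integral_sum_centred_sq hε _

lemma integrable_linStat_sq (M : IsModel P Z θ γ ε a eO eI) (hε : 0 < ε) (hn : 3 ≤ n)
    (f : Fin n → Fin n → ℝ) (x : Idx n → ℝ) : Integrable (fun ω =>
      linStat Z θ γ (fun i j => a i j ω) (fun i => eO i ω) (fun i => eI i ω) f x ^ 2) P := by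
  simp only [linStat_eq_sum_sources hn]
  exact (M.memLp_sum_centred hε _).integrable_sq

/-- Markov's inequality for the sum of the squares of the noises. -/
lemma measureReal_lt_noise_le (M : IsModel P Z θ γ ε a eO eI) (hε : 0 < ε) (hn : 3 ≤ n)
    {B : ℝ} (hB : 0 < B) :
    P.real {ω | B < ∑ i, (eO i ω : ℝ) ^ 2 +
      ∑ j, inNoise (fun i => eO i ω) (fun i => eI i ω) j ^ 2} ≤
      4 * n * lapVar (laplaceParam ε) / B := by
  set F := fun (ω : Ω) (x : Idx n → ℝ) =>
    linStat Z θ γ (fun i j => a i j ω) (fun i => eO i ω) (fun i => eI i ω) 0 x ^ 2 with hF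
  have hb0 : bil (wgt Z θ γ) 0 0 = 0 := by simp [bil]
  have hint : ∀ x, Integrable (fun ω => F ω x) P := M.integrable_linStat_sq hε hn 0
  have hval : ∀ x, ∫ ω, F ω x ∂P = lapVar (laplaceParam ε) * sumSq x := fun x => by
    rw [M.integral_linStat_sq hε hn 0, hb0, zero_add]
  have hG : ∀ ω, ∑ i, (eO i ω : ℝ) ^ 2 + ∑ j, inNoise (fun i => eO i ω) (fun i => eI i ω) j ^ 2 =
      ∑ i, F ω (Pi.single (Sum.inl i) 1) + ∑ j, F ω (inNoiseCoef j) := by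
    intro ω
    simp only [hF, ← out_eq_linStat, ← inNoise_eq_linStat]
  simp only [hG]
  have hi1 : Integrable (fun ω => ∑ i : Fin n, F ω (Pi.single (Sum.inl i) 1)) P :=
    integrable_finsetSum _ fun i _ => hint _
  have hi2 : Integrable (fun ω => ∑ j, F ω (inNoiseCoef j)) P :=
    integrable_finsetSum _ fun i _ => hint _
  have h := mul_meas_ge_le_integral_of_nonneg (μ := P)
    (f := fun ω => ∑ i : Fin n, F ω (Pi.single (Sum.inl i) 1) + ∑ j, F ω (inNoiseCoef j))
    (Eventually.of_forall fun ω => by simp only [hF]; positivity) (hi1.add hi2) B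
  rw [integral_add hi1 hi2, integral_finsetSum _ fun i _ => hint _,
    integral_finsetSum _ fun i _ => hint _] at h
  simp only [hval, sumSq_single, ← Finset.mul_sum, mul_one, Finset.sum_const, Finset.card_univ,
    Fintype.card_fin, nsmul_eq_mul] at h
  have h1 := mul_le_mul_of_nonneg_left (sum_sumSq_inNoiseCoef_le hn) (lapVar_laplaceParam_nonneg ε)
  rw [le_div_iff₀ hB, mul_comm]
  refine (mul_le_mul_of_nonneg_left (measureReal_mono (Set.ofPred_subset_ofPred.2 fun ω hω =>
    hω.le)) hB.le).trans (h.trans ?_)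
  linarith

lemma hasSubgaussianMGF_centred (M : IsModel P Z θ γ ε a eO eI) (hε : 0 < ε) (e : Edge n) :
    HasSubgaussianMGF (fun ω => centred Z θ γ (Sum.inl e) (a e.1.1 e.1.2 ω)) (1 / 4) P := by
  have h := hasSubgaussianMGF_of_mem_Icc_of_integral_eq_zero (μ := P)
    (X := fun ω => centred Z θ γ (Sum.inl e) (a e.1.1 e.1.2 ω))
    (a := -edgeProb Z θ γ e.1.1 e.1.2) (b := 1 - edgeProb Z θ γ e.1.1 e.1.2)
    (M.measurable_centred (Sum.inl e)).aemeasurable ?_ (M.integral_centred hε (Sum.inl e))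
  · convert! h using 1
    rw [sub_neg_eq_add, sub_add_cancel, nnnorm_one]
    norm_num
  · filter_upwards [M.edge_ae e.2] with ω hω
    have h0 := edgeProb_pos (Z := Z) (θ := θ) (γ := γ) e.1.1 e.1.2
    have h1 := edgeProb_lt_one (Z := Z) (θ := θ) (γ := γ) e.1.1 e.1.2
    rcases hω with h | h <;> simp [centred, h]

/-- Hoeffding's inequality for at most `n` edges. -/
lemma measureReal_lt_abs_sum_edge_le (M : IsModel P Z θ γ ε a eO eI) (hε : 0 < ε)
    (T : Finset (Edge n)) (hT : T.card ≤ n) {L : ℝ} (hL : 0 ≤ L) (hn : 0 < n) :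
    P.real {ω | √(n * L) < |∑ e ∈ T, centred Z θ γ (Sum.inl e) (a e.1.1 e.1.2 ω)|} ≤
      2 * Real.exp (-(2 * L)) := by
  have hind : iIndepFun (fun (e : Edge n) ω => centred Z θ γ (Sum.inl e) (a e.1.1 e.1.2 ω)) P :=
    M.iIndepFun_centred.precomp Sum.inl_injective
  have hind' : iIndepFun
      (fun (e : Edge n) ω => -centred Z θ γ (Sum.inl e) (a e.1.1 e.1.2 ω)) P :=
    hind.comp (fun _ y => -y) fun _ => measurable_neg
  have hn0 : (0 : ℝ) < n := by exact_mod_cast hn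
  have h1 := HasSubgaussianMGF.measure_sum_ge_le_of_iIndepFun hind
    (fun e (_ : e ∈ T) => M.hasSubgaussianMGF_centred hε e) (Real.sqrt_nonneg (n * L))
  have h2 := HasSubgaussianMGF.measure_sum_ge_le_of_iIndepFun hind'
    (fun e (_ : e ∈ T) => (M.hasSubgaussianMGF_centred hε e).neg) (Real.sqrt_nonneg (n * L))
  -- An empty T has variance proxy 0, and division by 0 makes the exponential equal to 1; there the
  -- event itself is empty.
  have h3 : Real.exp (-√(n * L) ^ 2 / (2 * ((∑ _e ∈ T, (1 / 4 : NNReal) : NNReal) : ℝ))) ≤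
      Real.exp (-(2 * L)) ∨ T = ∅ := by
    rcases T.eq_empty_or_nonempty with h | h
    · exact Or.inr h
    · left
      rw [Real.exp_le_exp, Real.sq_sqrt (by positivity), neg_div, neg_le_neg_iff]
      have hc : (0 : ℝ) < T.card := by exact_mod_cast h.card_pos
      have hc' : (T.card : ℝ) ≤ n := by exact_mod_cast hT
      simp only [Finset.sum_const, nsmul_eq_mul, NNReal.coe_mul, NNReal.coe_natCast, NNReal.coe_div,
        NNReal.coe_one, NNReal.coe_ofNat]
      rw [le_div_iff₀ (by positivity)]
      nlinarith
  rcases h3 with h3 | rfl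
  · calc _ ≤ P.real ({ω | √(n * L) ≤ ∑ e ∈ T, centred Z θ γ (Sum.inl e) (a e.1.1 e.1.2 ω)} ∪
          {ω | √(n * L) ≤ ∑ e ∈ T, -centred Z θ γ (Sum.inl e) (a e.1.1 e.1.2 ω)}) := by
          refine measureReal_mono fun ω hω => ?_
          rcases lt_abs.1 (Set.mem_ofPred_eq ▸ hω) with h | h
          · exact Or.inl h.le
          · exact Or.inr (by simpa only [Set.mem_ofPred_eq, Finset.sum_neg_distrib] using h.le)
      _ ≤ _ := measureReal_union_le _ _
      _ ≤ _ := by linarith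
  · simp only [Finset.sum_empty, abs_zero, not_lt_of_ge (Real.sqrt_nonneg _), Set.ofPred_false,
      measureReal_empty]
    positivity

lemma measureReal_lt_abs_row_le (M : IsModel P Z θ γ ε a eO eI) (hε : 0 < ε) {L : ℝ} (hL : 0 ≤ L)
    (hn : 0 < n) (i : Fin n) :
    P.real {ω | √(n * L) < |∑ j, resid Z θ γ (fun i j => a i j ω) i j|} ≤
      2 * Real.exp (-(2 * L)) := by
  have h := M.measureReal_lt_abs_sum_edge_le hε (Finset.univ.filter fun e => e.1.1 = i) ?_ hL hn
  · refine le_trans (le_of_eq ?_) h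
    congr 1
    ext ω
    have : ∑ j, resid Z θ γ (fun i j => a i j ω) i j =
        ∑ e : Edge n with e.1.1 = i, centred Z θ γ (Sum.inl e) (a e.1.1 e.1.2 ω) := by
      rw [Finset.sum_filter]
      simp only [centred, Sum.elim_inl]
      rw [sum_edge (fun k j => if k = i then (a k j ω : ℝ) - edgeProb Z θ γ k j else 0),
        eq_comm, Finset.sum_eq_single i]
      · simp [resid]
      · intro b _ hb; simp [hb]
      · simp
    simp only [Set.mem_ofPred_eq, this]
  · refine (Finset.card_le_card_of_injOn (fun e => e.1.2) (fun _ _ => Finset.mem_univ _) ?_).trans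
      (Finset.card_univ.trans (Fintype.card_fin n)).le
    intro e he e' he' h
    simp only [Finset.coe_filter, Finset.mem_univ, true_and, Set.mem_ofPred_eq] at he he'
    exact Subtype.ext (Prod.ext (he.trans he'.symm) h)

lemma measureReal_lt_abs_col_le (M : IsModel P Z θ γ ε a eO eI) (hε : 0 < ε) {L : ℝ} (hL : 0 ≤ L)
    (hn : 0 < n) (j : Fin n) :
    P.real {ω | √(n * L) < |∑ i, resid Z θ γ (fun i j => a i j ω) i j|} ≤
      2 * Real.exp (-(2 * L)) := by
  have h := M.measureReal_lt_abs_sum_edge_le hε (Finset.univ.filter fun e => e.1.2 = j) ?_ hL hn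
  · refine le_trans (le_of_eq ?_) h
    congr 1
    ext ω
    have : ∑ i, resid Z θ γ (fun i j => a i j ω) i j =
        ∑ e : Edge n with e.1.2 = j, centred Z θ γ (Sum.inl e) (a e.1.1 e.1.2 ω) := by
      rw [Finset.sum_filter]
      simp only [centred, Sum.elim_inl]
      rw [sum_edge (fun i k => if k = j then (a i k ω : ℝ) - edgeProb Z θ γ i k else 0)]
      refine Finset.sum_congr rfl fun i _ => ?_
      rw [Finset.sum_eq_single j]
      · simp [resid]
      · intro b _ hb; simp [hb]
      · simp
    simp only [Set.mem_ofPred_eq, this]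
  · refine (Finset.card_le_card_of_injOn (fun e => e.1.1) (fun _ _ => Finset.mem_univ _) ?_).trans
      (Finset.card_univ.trans (Fintype.card_fin n)).le
    intro e he e' he' h
    simp only [Finset.coe_filter, Finset.mem_univ, true_and, Set.mem_ofPred_eq] at he he'
    exact Subtype.ext (Prod.ext h (he.trans he'.symm))

/-- The good event fails with a small probability. -/
theorem measureReal_not_isGood_le {m q : ℝ} (M : IsModel P Z θ γ ε a eO eI) (hε : 0 < ε)
    (hn : 3 ≤ n) (hW : IsWeight (wgt Z θ γ) m) (hq : 0 < q)
    (hZ : ∀ i j, i ≠ j → ∀ l, |Z i j l| ≤ q) :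
    P.real {ω | ¬ IsGood Z θ γ (fun i j => a i j ω) (fun i => eO i ω) (fun i => eI i ω)
      (√(n * Real.log n)) (2 * n * (1 + kappa ε) ^ 2 * Real.log n)
      (√2 * n * q * (1 + kappa ε) * √(Real.log n) / m ^ 2)} ≤
      4 / n + (1 + p) / Real.log n := by
  have hn3 : (3 : ℝ) ≤ n := by exact_mod_cast hn
  have hn0 : (0 : ℝ) < n := by linarith
  set L := Real.log n with hL
  have hL0 : 0 < L := Real.log_pos (by linarith)
  have hm := hW.pos
  have hm4 := hW.le_quarter hn
  have hκ := kappa_pos hε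
  set K := 1 + kappa ε with hK
  have hK1 : 1 ≤ K := by linarith
  have hσ : lapVar (laplaceParam ε) ≤ K ^ 2 / 2 := (lapVar_le hε).trans (by
    have := pow_le_pow_left₀ hκ.le (by linarith : kappa ε ≤ K) 2
    linarith)
  -- With L = log n each row or column fails with probability at most 2/n², so a union over 2n of
  -- them costs 4/n.
  have hexp : 2 * Real.exp (-(2 * L)) = 2 / n ^ 2 := by
    have : Real.exp (2 * L) = n ^ 2 := by rw [two_mul, Real.exp_add, hL, Real.exp_log hn0, sq]
    rw [Real.exp_neg, this, div_eq_mul_inv]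
  set B := 2 * n * K ^ 2 * L with hB
  set B₂ := √2 * n * q * K * √L / m ^ 2 with hB₂
  have hB0 : 0 < B := by positivity
  have hB₂0 : 0 < B₂ := by positivity
  set E₁ := fun i : Fin n => {ω | √(n * L) < |∑ j, resid Z θ γ (fun i j => a i j ω) i j|}
  set E₂ := fun j : Fin n => {ω | √(n * L) < |∑ i, resid Z θ γ (fun i j => a i j ω) i j|}
  set E₃ := {ω | B < ∑ i, (eO i ω : ℝ) ^ 2 +
      ∑ j, inNoise (fun i => eO i ω) (fun i => eI i ω) j ^ 2}
  set E₄ := fun l : Fin p => {ω | B₂ < |linStat Z θ γ (fun i j => a i j ω) (fun i => eO i ω)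
    (fun i => eI i ω) (covRes Z θ γ l) (-covProj Z θ γ l)|}
  have h1 : P.real (⋃ i, E₁ i) ≤ 2 / n :=
    calc _ ≤ ∑ i, P.real (E₁ i) := measureReal_iUnion_fintype_le _
      _ ≤ ∑ _i : Fin n, 2 / (n : ℝ) ^ 2 := Finset.sum_le_sum fun i _ =>
          (M.measureReal_lt_abs_row_le hε hL0.le (by omega) i).trans hexp.le
      _ = 2 / n := by
          simp only [Finset.sum_const, Finset.card_univ, Fintype.card_fin, nsmul_eq_mul]
          field_simp
  have h2 : P.real (⋃ i, E₂ i) ≤ 2 / n :=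
    calc _ ≤ ∑ i, P.real (E₂ i) := measureReal_iUnion_fintype_le _
      _ ≤ ∑ _i : Fin n, 2 / (n : ℝ) ^ 2 := Finset.sum_le_sum fun i _ =>
          (M.measureReal_lt_abs_col_le hε hL0.le (by omega) i).trans hexp.le
      _ = 2 / n := by
          simp only [Finset.sum_const, Finset.card_univ, Fintype.card_fin, nsmul_eq_mul]
          field_simp
  have h3 : P.real E₃ ≤ 1 / L := by
    refine (M.measureReal_lt_noise_le hε hn hB0).trans ?_
    rw [div_le_div_iff₀ hB0 hL0, hB]
    have := mul_le_mul_of_nonneg_left hσ (by positivity : 0 ≤ 4 * n * L)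
    linarith
  -- Chebyshev with B₂² equal to L times an upper bound 2n²q²K²/m⁴ for the variance.
  have h4 : ∀ l, P.real (E₄ l) ≤ 1 / L := by
    intro l
    refine (M.measureReal_lt_abs_linStat_le hε hn _ _ hB₂0).trans ?_
    have hB₂sq : B₂ ^ 2 = 2 * n ^ 2 * q ^ 2 * K ^ 2 * L / m ^ 4 := by
      rw [hB₂, div_pow, mul_pow, mul_pow, mul_pow, mul_pow, Real.sq_sqrt zero_le_two,
        Real.sq_sqrt hL0.le]
      ring
    rw [div_le_div_iff₀ (by positivity) hL0, one_mul, hB₂sq]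
    have g1 := bil_covRes_self_le (Z := Z) (θ := θ) (γ := γ) hn hW hZ l
    have g2 : sumSq (-covProj Z θ γ l) ≤ 2 * n * (2 * q / m ^ 2) ^ 2 := by
      calc _ ≤ ∑ _r : Idx n, (2 * q / m ^ 2) ^ 2 := Finset.sum_le_sum fun r _ => by
            rw [Pi.neg_apply, neg_sq, ← sq_abs]
            exact pow_le_pow_left₀ (abs_nonneg _) (abs_covProj_le hn hW hq.le hZ l r) 2
        _ ≤ _ := by
            simp only [Finset.sum_const, Finset.card_univ, Fintype.card_sum, Fintype.card_fin,
              nsmul_eq_mul]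
            refine mul_le_mul_of_nonneg_right ?_ (by positivity)
            have : ((n + (n - 1) : ℕ) : ℝ) ≤ ((2 * n : ℕ) : ℝ) := by
              exact_mod_cast (by omega : n + (n - 1) ≤ 2 * n)
            exact this.trans (by push_cast; rfl)
    have g3 : bil (wgt Z θ γ) (covRes Z θ γ l) (covRes Z θ γ l)
        + lapVar (laplaceParam ε) * sumSq (-covProj Z θ γ l) ≤
        n ^ 2 * q ^ 2 / 4 + K ^ 2 / 2 * (2 * n * (2 * q / m ^ 2) ^ 2) :=
      add_le_add g1 (mul_le_mul hσ g2 (Finset.sum_nonneg fun r _ => sq_nonneg _) (by positivity))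
    have hm44 : m ^ 4 ≤ 1 := pow_le_one₀ hm.le (by linarith)
    have g4 : (n : ℝ) ^ 2 * q ^ 2 / 4 ≤ n ^ 2 * q ^ 2 * K ^ 2 / m ^ 4 / 4 := by
      have : (n : ℝ) ^ 2 * q ^ 2 ≤ n ^ 2 * q ^ 2 * K ^ 2 / m ^ 4 := by
        rw [le_div_iff₀ (by positivity)]
        exact mul_le_mul_of_nonneg_left (hm44.trans (one_le_pow₀ hK1)) (by positivity)
      linarith
    -- The noise part is only of order n, and n ≤ n²/3. Together with the edge part, 4/3 + 1/4 is
    -- below 2.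
    have g5 : K ^ 2 / 2 * (2 * n * (2 * q / m ^ 2) ^ 2) ≤
        4 / 3 * (n ^ 2 * q ^ 2 * K ^ 2 / m ^ 4) := by
      have : K ^ 2 / 2 * (2 * n * (2 * q / m ^ 2) ^ 2) =
          4 / 3 * (3 * n * (q ^ 2 * K ^ 2 / m ^ 4)) := by
        field_simp; ring
      rw [this]
      have e2 : (n : ℝ) ^ 2 * q ^ 2 * K ^ 2 / m ^ 4 = n * n * (q ^ 2 * K ^ 2 / m ^ 4) := by ring
      rw [e2]
      gcongr
    have g6 : 0 ≤ (n : ℝ) ^ 2 * q ^ 2 * K ^ 2 / m ^ 4 := by positivity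
    have g7 : bil (wgt Z θ γ) (covRes Z θ γ l) (covRes Z θ γ l)
        + lapVar (laplaceParam ε) * sumSq (-covProj Z θ γ l) ≤
        2 * (n ^ 2 * q ^ 2 * K ^ 2 / m ^ 4) := by linarith
    calc _ ≤ 2 * (n ^ 2 * q ^ 2 * K ^ 2 / m ^ 4) * L := mul_le_mul_of_nonneg_right g7 hL0.le
      _ = _ := by ring
  have h5 : P.real (⋃ l, E₄ l) ≤ p / L :=
    calc _ ≤ ∑ l, P.real (E₄ l) := measureReal_iUnion_fintype_le _
      _ ≤ ∑ _l : Fin p, 1 / L := Finset.sum_le_sum fun l _ => h4 l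
      _ = p / L := by
          simp only [Finset.sum_const, Finset.card_univ, Fintype.card_fin, nsmul_eq_mul]
          ring
  calc _ ≤ P.real (((⋃ i, E₁ i) ∪ (⋃ i, E₂ i)) ∪ (E₃ ∪ ⋃ l, E₄ l)) := by
        refine measureReal_mono fun ω hω => ?_
        by_contra hc
        simp only [Set.mem_union, Set.mem_iUnion, not_or, not_exists] at hc
        obtain ⟨⟨c1, c2⟩, c3, c4⟩ := hc
        exact hω ⟨fun i => not_lt.1 (c1 i), fun i => not_lt.1 (c2 i), not_lt.1 c3,
          fun l => not_lt.1 (c4 l)⟩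
    _ ≤ (P.real (⋃ i, E₁ i) + P.real (⋃ i, E₂ i)) + (P.real E₃ + P.real (⋃ l, E₄ l)) :=
        (measureReal_union_le _ _).trans
          (add_le_add (measureReal_union_le _ _) (measureReal_union_le _ _))
    _ ≤ (2 / n + 2 / n) + (1 / L + p / L) := by gcongr
    _ = _ := by ring

end IsModel

end model

end

section

variable {n p : ℕ}

/-! ### Consequences of the good event -/

section

variable {Z : Fin n → Fin n → Fin p → ℝ} {θ : Idx n → ℝ} {γ : Fin p → ℝ}
  {A : Fin n → Fin n → ℤ} {eO eI : Fin n → ℤ}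

set_option maxHeartbeats 800000 in
/-- On the good event the moment equations have a solution, and the out-parameters are linear
statistics up to a remainder of order `λ q² e^{6ρ} (1 + κ)² log n / n`. -/
theorem IsGood.exists_solution {R K L q lam s : ℝ} (hn : 3 ≤ n) (hp : 1 ≤ p) (hR : 1 ≤ R)
    (hK : 1 ≤ K) (hL : 1 ≤ L) (hW : IsWeight (wgt Z θ γ) (1 / (4 * R))) (hq : 0 < q)
    (hZ : ∀ i j, i ≠ j → ∀ l, |Z i j l| ≤ q) (hH : (H Z θ γ).PosDef)
    (hΛ : rowSumNorm (H Z θ γ)⁻¹ ≤ lam / n ^ 2) (hs : s = q * √lam) (hsR : s * R ≤ √n)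
    (hw : 71000 * p ^ 2 * (s * K * √L * R ^ 3 / √n) < 1 / 4)
    (hgood : IsGood Z θ γ A eO eI (√(n * L)) (2 * n * K ^ 2 * L)
      (√2 * n * q * K * √L / (1 / (4 * R)) ^ 2)) :
    ∃ (θ' : Idx n → ℝ) (γ' : Fin p → ℝ), IsMomentSolution Z A eO eI θ' γ' ∧
      ∀ i, |θ' (Sum.inl i) - θ (Sum.inl i)
        - linStat Z θ γ A eO eI (degreeEffect (sCol Z θ γ i)) (sCol Z θ γ i)
        - linStat Z θ γ A eO eI (degreeEffect (colErr Z θ γ i)) (colErr Z θ γ i)| ≤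
        3 * 10 ^ 10 * p ^ 4 * (s ^ 2 * R ^ 6 * K ^ 2 * L / n) := by
  have hn3 : (3 : ℝ) ≤ n := by exact_mod_cast hn
  have hn0 : (0 : ℝ) < n := by linarith
  have hp1 : (1 : ℝ) ≤ p := by exact_mod_cast hp
  set N := √(n : ℝ) with hN
  have hN0 : 0 < N := Real.sqrt_pos.2 hn0
  have hNn : (n : ℝ) = N ^ 2 := (Real.sq_sqrt hn0.le).symm
  set l := √L with hl
  have hl1 : 1 ≤ l := Real.one_le_sqrt.2 hL
  have hLl : L = l ^ 2 := (Real.sq_sqrt (by linarith)).symm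
  have hs2 : 2 ≤ s := by
    have h4 := four_le_of_rowSumNorm_le hn hW hZ hH hΛ ⟨0, hp⟩
    have e : lam / (n : ℝ) ^ 2 * n ^ 2 * q ^ 2 = lam * q ^ 2 := by field_simp
    rw [e] at h4
    have hlam : 0 ≤ lam := by
      by_contra hc
      push Not at hc
      have := mul_nonneg (neg_nonneg.2 hc.le) (sq_nonneg q)
      linarith
    have : s ^ 2 = lam * q ^ 2 := by rw [hs, mul_pow, Real.sq_sqrt hlam]; ring
    exact (sq_le_sq₀ (by norm_num) (hs ▸ mul_nonneg hq.le (Real.sqrt_nonneg lam))).1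
      (by rw [this]; linarith)
  have hlam : 0 ≤ lam := by
    by_contra hc
    push Not at hc
    rw [Real.sqrt_eq_zero_of_nonpos hc.le, mul_zero] at hs
    linarith
  have hsq : s ^ 2 = lam * q ^ 2 := by rw [hs, mul_pow, Real.sq_sqrt hlam]; ring
  have hsqrtΛ : √(lam / (n : ℝ) ^ 2) = √lam / n := by
    rw [Real.sqrt_div hlam, Real.sqrt_sq hn0.le]
  set k := K * l with hk
  have hk1 : 1 ≤ k := one_le_mul_of_one_le_of_one_le hK hl1
  have hR0 : 0 < R := by linarith
  have hs0 : 0 < s := by linarith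
  have hk0 : 0 < k := by linarith
  have hm : 0 < 1 / (4 * R) := by positivity
  have ht : √(n * L) = N * l := by rw [Real.sqrt_mul hn0.le]
  clear_value k l N
  -- the bounds for the score
  have hsqrt2 : √2 ≤ 3 / 2 := Real.sqrt_le_iff.2 ⟨by norm_num, by norm_num⟩
  have hB₂le : √2 * n * q * K * l / (1 / (4 * R)) ^ 2 ≤ 24 * n * q * k * R ^ 2 := by
    calc _ = √2 * (16 * n * q * k * R ^ 2) := by rw [hk]; field_simp; ring
      _ ≤ 3 / 2 * (16 * n * q * k * R ^ 2) := by gcongr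
      _ = _ := by ring
  have hB₂ : ∀ j, |linStat Z θ γ A eO eI (covRes Z θ γ j) (-covProj Z θ γ j)| ≤
      24 * n * q * k * R ^ 2 := fun j => (hgood.cov j).trans hB₂le
  have hB₁ : ∑ i, (scoreVec Z θ γ A eO eI).1 i ^ 2 + ∑ j, (scoreVec Z θ γ A eO eI).2.1 j ^ 2 ≤
      (3 * n * k) ^ 2 := by
    refine hgood.scoreVec_sq_le.trans ?_
    rw [Real.sq_sqrt (by positivity)]
    have e1 : (n : ℝ) ^ 2 * L ≤ n ^ 2 * K ^ 2 * L := by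
      rw [mul_right_comm]
      exact le_mul_of_one_le_right (by positivity) (one_le_pow₀ hK)
    have e2 : (n : ℝ) * K ^ 2 * L ≤ n ^ 2 * K ^ 2 * L := by
      rw [sq (n : ℝ), mul_assoc (n : ℝ), mul_assoc (n : ℝ), mul_assoc (n : ℝ), mul_assoc (n : ℝ)]
      exact le_mul_of_one_le_left (by positivity) (by linarith)
    have e3 : (3 * n * k) ^ 2 = 9 * (n ^ 2 * K ^ 2 * L) := by rw [hk, hLl]; ring
    have h2 : (0 : ℝ) ≤ n ^ 2 * K ^ 2 * L := by positivity
    rw [e3]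
    linarith
  have hB₃ : ∀ i, |(scoreVec Z θ γ A eO eI).1 i| ≤ 3 * N * k ∧
      |(scoreVec Z θ γ A eO eI).2.1 i| ≤ 3 * N * k := by
    have e : √(n * L) + √(2 * n * K ^ 2 * L) ≤ 3 * N * k := by
      have e1 : √(2 * n * K ^ 2 * L) = √2 * (N * k) := by
        rw [show (2 : ℝ) * n * K ^ 2 * L = 2 * (N * k) ^ 2 by rw [hk, hLl, hNn]; ring,
          Real.sqrt_mul zero_le_two, Real.sqrt_sq (by positivity)]
      have e2 : N * l ≤ N * k := by
        rw [hk]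
        exact mul_le_mul_of_nonneg_left (le_mul_of_one_le_left (by positivity) hK) hN0.le
      have e3 : √2 * (N * k) ≤ 3 / 2 * (N * k) := by gcongr
      have : 0 ≤ N * k := by positivity
      rw [ht, e1]
      linarith
    exact fun i => ⟨(hgood.abs_scoreVec_le i).1.trans e, (hgood.abs_scoreVec_le i).2.trans e⟩
  -- the sizes of the solution
  set w := s * k * R ^ 3 / N with hwdef
  have hw' : 71000 * (p : ℝ) ^ 2 * w < 1 / 4 := by
    convert hw using 3
    rw [hk]; ring
  have hw0 : 0 < w := by rw [hwdef]; positivity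
  -- In e₀, 135 = 3(21 + 24) collects the degree part and the covariate part of the score; b₀ is
  -- exactly p q √Λ e₀. In η, 35000 exceeds 18 · 1900, where 1900 bounds 3/2 + 810 + 1080. The later
  -- 71000 bounds 2η + b₀ in units of p²w.
  set e₀ := 135 * p * N * k * R with he₀def
  set b₀ := 135 * p ^ 2 * s * k * R / N with hb₀def
  set η := 35000 * (p : ℝ) ^ 2 * w with hηdef
  clear_value w e₀ b₀ η
  -- With m = 1/(4R) the radicand is 40R/n, and 40 < 49, R ≤ R².
  have hsqrt : √(10 / (1 / (4 * R) * n)) ≤ 7 * R / N := by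
    rw [Real.sqrt_le_iff]
    refine ⟨by positivity, ?_⟩
    rw [div_pow, ← hNn, div_le_div_iff₀ (by positivity) hn0]
    have : (7 * R) ^ 2 * (1 / (4 * R) * n) = 49 / 4 * (R * n) := by field_simp; norm_num
    have h2 : (n : ℝ) ≤ R * n := le_mul_of_one_le_left hn0.le hR
    rw [this]
    linarith
  have he₀ : 3 * (3 * n * k * √(10 / (1 / (4 * R) * n)) + p * (24 * n * q * k * R ^ 2)
      * √(lam / (n : ℝ) ^ 2)) ≤ e₀ := by
    have e1 : p * (24 * n * q * k * R ^ 2) * √(lam / (n : ℝ) ^ 2) =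
        24 * p * k * R * (s * R) := by rw [hsqrtΛ, hs]; field_simp
    have e2 : 3 * n * k * √(10 / (1 / (4 * R) * n)) ≤ 3 * n * k * (7 * R / N) := by gcongr
    have e3 : 3 * n * k * (7 * R / N) = 21 * (N * k * R) := by rw [hNn]; field_simp; norm_num
    -- Here sR ≤ √n enters: the covariate part of the dual norm has at most the order of the degree
    -- part.
    have e4 : 24 * p * k * R * (s * R) ≤ 24 * p * k * R * N := by gcongr
    have e5 : N * k * R ≤ p * (N * k * R) := le_mul_of_one_le_left (by positivity) hp1
    rw [e1]
    calc _ ≤ 3 * (21 * (p * (N * k * R)) + 24 * p * k * R * N) := by linarith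
      _ = e₀ := by rw [he₀def]; ring
  have hb₀ : p * q * (√(lam / (n : ℝ) ^ 2) * e₀) ≤ b₀ := by
    refine le_of_eq ?_
    rw [hsqrtΛ, he₀def, hb₀def, hs, hNn]; field_simp
  have hη : 9 / (2 * n * (1 / (4 * R))) * (3 * N * k + (3 * e₀ + 2 * n * b₀) / (1 / (4 * R))) ≤
      η := by
    have e1 : 9 / (2 * n * (1 / (4 * R))) * (3 * N * k + (3 * e₀ + 2 * n * b₀) / (1 / (4 * R))) =
        18 * (k / N) * (3 * R + 1620 * p * R ^ 3 + 1080 * p ^ 2 * s * R ^ 3) := by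
      rw [he₀def, hb₀def, hNn]; field_simp; ring
    have e2 : 3 * R ≤ 3 / 2 * (p ^ 2 * s * R ^ 3) := by
      have f1 : R ≤ R ^ 3 := le_self_pow₀ hR (by norm_num)
      have f2 : 2 ≤ (p : ℝ) ^ 2 * s := hs2.trans (le_mul_of_one_le_left hs0.le (one_le_pow₀ hp1))
      have f3 : 2 * R ^ 3 ≤ p ^ 2 * s * R ^ 3 := by gcongr
      linarith
    have e3 : 1620 * p * R ^ 3 ≤ 810 * (p ^ 2 * s * R ^ 3) := by
      have f2 : 2 * (p : ℝ) ≤ p ^ 2 * s := by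
        rw [mul_comm]
        exact mul_le_mul (le_self_pow₀ hp1 two_ne_zero) hs2 (by norm_num) (by positivity)
      have f3 : 2 * (p : ℝ) * R ^ 3 ≤ p ^ 2 * s * R ^ 3 := by gcongr
      linarith
    have e5 : 0 ≤ k / N * ((p : ℝ) ^ 2 * s * R ^ 3) := by positivity
    rw [e1]
    calc _ ≤ 18 * (k / N) * (1900 * (p ^ 2 * s * R ^ 3)) := by
          refine mul_le_mul_of_nonneg_left ?_ (by positivity)
          have : 0 ≤ (p : ℝ) ^ 2 * s * R ^ 3 := by positivity
          linarith
      _ = 34200 * (k / N * (p ^ 2 * s * R ^ 3)) := by ring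
      _ ≤ 35000 * (k / N * (p ^ 2 * s * R ^ 3)) := by linarith
      _ = η := by rw [hηdef, hwdef]; ring
  have hb₀w : b₀ ≤ 135 * (p ^ 2 * w) := by
    have f1 : R ≤ R ^ 3 := le_self_pow₀ hR (by norm_num)
    calc b₀ = 135 * (p ^ 2 * (s * k * R / N)) := by rw [hb₀def]; ring
      _ ≤ _ := by rw [hwdef]; gcongr
  have hpw : 0 ≤ (p : ℝ) ^ 2 * w := by positivity
  have hη4 : η < 1 / 4 := by rw [hηdef]; linarith
  have hb4 : b₀ < 1 / 4 := by linarith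
  obtain ⟨θ', γ', hsol, hE, hh⟩ := exists_isMomentSolution hn hp hW hq hZ hH hΛ (by positivity)
    hB₁ hB₂ hB₃ he₀ hb₀ hη hη4 hb4
  refine ⟨θ', γ', hsol, fun i => ?_⟩
  set η' := 71000 * (p : ℝ) ^ 2 * w with hη'
  clear_value η'
  have hh' : ∀ i j, i ≠ j → |(logit Z θ' γ' - logit Z θ γ) i j| ≤ η' := fun i j hij =>
    (hh i j hij).trans (by rw [hη', hηdef]; linarith)
  have hγ := abs_gamma_sub_le hn hW hq.le hZ hH hΛ hsol hB₂ hE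
    (fun i j hij => (hh' i j hij).trans (by linarith))
  set g := lam / (n : ℝ) ^ 2 * (24 * n * q * k * R ^ 2 + 6 * q * e₀ ^ 2 / (1 / (4 * R)) ^ 2)
    with hg
  clear_value g
  have hc : ∀ i j, i ≠ j → |covComb Z (γ' - γ) i j| ≤ p * q * g := fun i j hij =>
    abs_covComb_le hZ _ hγ hij
  have hg0 : 0 ≤ g := by rw [hg]; positivity
  set Y := s ^ 2 * R ^ 6 * K ^ 2 * L / n with hY
  clear_value Y
  have hY0 : 0 ≤ Y := by rw [hY]; positivity
  have hY2 : Y = (s * k * R ^ 3 / N) ^ 2 := by rw [hY, hk, hNn, hLl]; field_simp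
  have hrem := abs_theta_sub_sub_le (b := p * q * g) (e₀ := e₀) (η := η') hn hW (by rw [he₀def]; positivity)
    (by positivity) hsol hE (by linarith) (by rw [hη']; positivity) hh' hc i
  refine hrem.trans ?_
  -- The covariate term, the quadratic term along the column of S and the quadratic term along the
  -- error are all multiples of p⁴Y; their constants add up to less than 3 · 10¹⁰.
  have r1 : p * q * g * (2 + 1 / (1 / (4 * R)) ^ 2) ≤ 4 * 10 ^ 7 * p ^ 4 * Y := by
    have e1 : p * q * g ≤ 1749624 * p ^ 3 * (s ^ 2 * k ^ 2 * R ^ 4 / N ^ 2) := by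
      have f1 : p * q * g = s ^ 2 / N ^ 2 * (24 * (p * (k * R ^ 2)) + 1749600 * (p ^ 3 * (k ^ 2 * R ^ 4))) := by
        rw [hg, he₀def, hsq, hNn]; field_simp; ring
      have f2 : (p : ℝ) * (k * R ^ 2) ≤ p ^ 3 * (k ^ 2 * R ^ 4) := by
        have g1 : (p : ℝ) ≤ p ^ 3 := le_self_pow₀ hp1 (by norm_num)
        have g2 : k ≤ k ^ 2 := le_self_pow₀ hk1 (by norm_num)
        have g3 : R ^ 2 ≤ R ^ 4 := pow_le_pow_right₀ hR (by norm_num)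
        gcongr
      rw [f1]
      calc _ ≤ s ^ 2 / N ^ 2 * (24 * (p ^ 3 * (k ^ 2 * R ^ 4)) + 1749600 * (p ^ 3 * (k ^ 2 * R ^ 4))) := by
            gcongr
        _ = _ := by ring
    have e2 : 2 + 1 / (1 / (4 * R)) ^ 2 ≤ 18 * R ^ 2 := by
      have : 1 / (1 / (4 * R)) ^ 2 = 16 * R ^ 2 := by field_simp; norm_num
      have h2 := one_le_pow₀ hR (n := 2)
      rw [this]
      linarith
    have e3 : (p : ℝ) ^ 3 ≤ p ^ 4 := pow_le_pow_right₀ hp1 (by norm_num)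
    calc _ ≤ 1749624 * p ^ 3 * (s ^ 2 * k ^ 2 * R ^ 4 / N ^ 2) * (18 * R ^ 2) := by gcongr
      _ = 31493232 * (p ^ 3 * Y) := by rw [hY2]; field_simp; ring
      _ ≤ 31493232 * (p ^ 4 * Y) := by gcongr
      _ ≤ 4 * 10 ^ 7 * (p ^ 4 * Y) := by gcongr; norm_num
      _ = _ := by ring
  have r2 : 4 * η' ^ 2 = 20164000000 * p ^ 4 * Y := by rw [hη', hwdef, hY2]; ring
  have r3 : 2 * η' * e₀ / (n * (1 / (4 * R)) ^ 2) ≤ 4 * 10 ^ 8 * p ^ 4 * Y := by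
    have e1 : 2 * η' * e₀ / (n * (1 / (4 * R)) ^ 2) =
        306720000 * (p ^ 3 * (s * k ^ 2 * R ^ 6 / N ^ 2)) := by
      rw [hη', he₀def, hwdef, hNn]; field_simp; ring
    have e2 : s ≤ s ^ 2 := le_self_pow₀ (by linarith) (by norm_num)
    have e3 : (p : ℝ) ^ 3 ≤ p ^ 4 := pow_le_pow_right₀ hp1 (by norm_num)
    rw [e1]
    calc _ ≤ 306720000 * (p ^ 4 * (s ^ 2 * k ^ 2 * R ^ 6 / N ^ 2)) := by gcongr
      _ = 306720000 * (p ^ 4 * Y) := by rw [hY2]; field_simp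
      _ ≤ 4 * 10 ^ 8 * (p ^ 4 * Y) := by gcongr; norm_num
      _ = _ := by ring
  have hpY : 0 ≤ (p : ℝ) ^ 4 * Y := by positivity
  rw [r2]
  linarith

end

end

section

variable {n p : ℕ}

/-! ### Characteristic functions of sums of the sources -/

lemma norm_prod_sub_prod_le {ι : Type*} (s : Finset ι) (f g : ι → ℂ) (hf : ∀ i, ‖f i‖ ≤ 1)
    (hg : ∀ i, ‖g i‖ ≤ 1) : ‖∏ i ∈ s, f i - ∏ i ∈ s, g i‖ ≤ ∑ i ∈ s, ‖f i - g i‖ := by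
  classical
  induction s using Finset.induction_on with
  | empty => simp
  | insert a s ha ih =>
    rw [Finset.prod_insert ha, Finset.prod_insert ha, Finset.sum_insert ha]
    have e : f a * ∏ i ∈ s, f i - g a * ∏ i ∈ s, g i =
        (f a - g a) * ∏ i ∈ s, f i + g a * (∏ i ∈ s, f i - ∏ i ∈ s, g i) := by ring
    have h1 : ‖∏ i ∈ s, f i‖ ≤ 1 := by
      rw [norm_prod]; exact Finset.prod_le_one (fun i _ => norm_nonneg _) fun i _ => hf i
    rw [e]
    refine (norm_add_le _ _).trans (add_le_add ?_ ?_)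
    · rw [norm_mul]; exact mul_le_of_le_one_right (norm_nonneg _) h1
    · rw [norm_mul]; exact (mul_le_of_le_one_left (norm_nonneg _) (hg a)).trans ih

/-- Taylor for |x| ≤ 1; for |x| > 1 each term is bounded separately and absorbed in |x|³. As the
bound holds for all x, the unbounded noises need no truncation. -/
lemma norm_exp_mul_I_sub_le (x : ℝ) :
    ‖Complex.exp (x * Complex.I) - (1 + x * Complex.I - x ^ 2 / 2)‖ ≤ 4 * |x| ^ 3 := by
  rcases le_or_gt |x| 1 with h | h
  · have h1 : ‖(x * Complex.I : ℂ)‖ ≤ 1 := by simpa using h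
    have h2 := Complex.exp_bound h1 (n := 3) (by norm_num)
    have h3 : ∑ m ∈ Finset.range 3, (x * Complex.I : ℂ) ^ m / (m.factorial : ℂ) =
        1 + x * Complex.I - x ^ 2 / 2 := by
      simp [Finset.sum_range_succ, mul_pow, Complex.I_sq]
      ring
    rw [h3] at h2
    refine h2.trans ?_
    rw [norm_mul, Complex.norm_I, mul_one, Complex.norm_real, Real.norm_eq_abs, mul_comm]
    refine mul_le_mul_of_nonneg_right ?_ (by positivity)
    norm_num [Nat.factorial]
  · have h1 : ‖Complex.exp (x * Complex.I)‖ = 1 := Complex.norm_exp_ofReal_mul_I x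
    have h2 : ‖(1 + x * Complex.I - x ^ 2 / 2 : ℂ)‖ ≤ 1 + |x| + |x| ^ 2 / 2 := by
      refine (norm_sub_le _ _).trans (add_le_add ((norm_add_le _ _).trans (le_of_eq ?_))
        (le_of_eq ?_))
      · simp
      · simp
    have h3 := norm_sub_le (Complex.exp (x * Complex.I)) (1 + x * Complex.I - x ^ 2 / 2)
    have h4 : |x| ≤ |x| ^ 3 := le_self_pow₀ h.le (by norm_num)
    have h5 : |x| ^ 2 ≤ |x| ^ 3 := pow_le_pow_right₀ h.le (by norm_num)
    have h6 : 1 ≤ |x| ^ 3 := one_le_pow₀ h.le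
    linarith

lemma abs_exp_neg_sub_le {y : ℝ} (hy : 0 ≤ y) : |Real.exp (-y) - (1 - y)| ≤ y ^ 2 := by
  rcases le_or_gt y 1 with h | h
  · have := Real.abs_exp_sub_one_sub_id_le (x := -y) (by rwa [abs_neg, abs_of_nonneg hy])
    rw [neg_sq] at this
    convert! this using 2
    ring
  · have h1 := Real.add_one_le_exp (-y)
    have h2 : Real.exp (-y) ≤ 1 := Real.exp_le_one_iff.2 (by linarith)
    rw [abs_of_nonneg (by linarith)]
    nlinarith

/-- Both characteristic functions are compared with 1 - v/2: the linear Taylor term integrates to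
zero, the cubic error costs 4b, and the Gaussian factor differs by at most v². -/
lemma norm_integral_exp_sub_le {Ω : Type*} [MeasurableSpace Ω] {P : Measure Ω}
    [IsProbabilityMeasure P] {Y : Ω → ℝ} {b : ℝ} (hY : MemLp Y 2 P) (h0 : ∫ ω, Y ω ∂P = 0)
    (h3 : Integrable (fun ω => |Y ω| ^ 3) P) (hb : ∫ ω, |Y ω| ^ 3 ∂P ≤ b) :
    ‖∫ ω, Complex.exp (Y ω * Complex.I) ∂P - (Real.exp (-(∫ ω, Y ω ^ 2 ∂P) / 2) : ℂ)‖ ≤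
      4 * b + (∫ ω, Y ω ^ 2 ∂P) ^ 2 := by
  set v := ∫ ω, Y ω ^ 2 ∂P with hv
  have hv0 : 0 ≤ v := integral_nonneg fun ω => sq_nonneg _
  have i1 : Integrable (fun ω => (Y ω : ℂ) * Complex.I) P :=
    ((hY.integrable one_le_two).ofReal).mul_const _
  have i2 : Integrable (fun ω => (Y ω : ℂ) ^ 2 / 2) P := by
    have := (hY.integrable_sq.ofReal (𝕜 := ℂ)).div_const 2
    simpa using this
  have i0 : Integrable (fun ω => Complex.exp (Y ω * Complex.I)) P := by
    refine Integrable.of_bound (C := 1) ?_ (Eventually.of_forall fun ω => ?_)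
    · have := hY.aestronglyMeasurable.aemeasurable
      exact (by fun_prop : AEMeasurable (fun ω => Complex.exp (Y ω * Complex.I)) P).aestronglyMeasurable
    · exact (Complex.norm_exp_ofReal_mul_I _).le
  have i3 : Integrable (fun ω => 1 + (Y ω : ℂ) * Complex.I) P := (integrable_const _).add i1
  have e1 : ∫ ω, (1 + (Y ω : ℂ) * Complex.I - (Y ω : ℂ) ^ 2 / 2) ∂P = 1 - ((v / 2 : ℝ) : ℂ) := by
    rw [integral_sub i3 i2, integral_add (integrable_const _) i1, integral_mul_const,
      integral_div, show ∫ ω, (Y ω : ℂ) ∂P = ((∫ ω, Y ω ∂P : ℝ) : ℂ) from integral_complex_ofReal, h0]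
    have : ∫ ω, (Y ω : ℂ) ^ 2 ∂P = (v : ℂ) := by
      rw [hv, ← integral_complex_ofReal]
      simp
    rw [this]
    simp
  have e2 : ‖∫ ω, Complex.exp (Y ω * Complex.I) ∂P - (1 - (v / 2 : ℝ) : ℂ)‖ ≤ 4 * b := by
    have i4 : Integrable (fun ω => 1 + (Y ω : ℂ) * Complex.I - (Y ω : ℂ) ^ 2 / 2) P := i3.sub i2
    rw [← e1, ← integral_sub i0 i4]
    refine (norm_integral_le_integral_norm _).trans ?_
    calc _ ≤ ∫ ω, 4 * |Y ω| ^ 3 ∂P :=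
          integral_mono (i0.sub i4).norm (h3.const_mul 4) fun ω =>
            norm_exp_mul_I_sub_le (Y ω)
      _ ≤ _ := by rw [integral_const_mul]; linarith
  have e3 : ‖(1 - (v / 2 : ℝ) : ℂ) - (Real.exp (-v / 2) : ℂ)‖ ≤ v ^ 2 := by
    have := abs_exp_neg_sub_le (y := v / 2) (by positivity)
    rw [norm_sub_rev, ← Complex.ofReal_one, ← Complex.ofReal_sub, ← Complex.ofReal_sub,
      Complex.norm_real, Real.norm_eq_abs, neg_div]
    refine this.trans ?_
    nlinarith [sq_nonneg v]
  calc _ = ‖(∫ ω, Complex.exp (Y ω * Complex.I) ∂P - (1 - (v / 2 : ℝ) : ℂ)) +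
        ((1 - (v / 2 : ℝ) : ℂ) - (Real.exp (-v / 2) : ℂ))‖ := by congr 1; ring
    _ ≤ _ := (norm_add_le _ _).trans (add_le_add e2 e3)

/-- Characteristic functions of two random variables that are close off a small event. -/
lemma norm_integral_exp_sub_integral_exp_le {Ω : Type*} [MeasurableSpace Ω] {P : Measure Ω}
    [IsProbabilityMeasure P] {Y Y' : Ω → ℝ} (hY : Measurable Y) (hY' : Measurable Y') {δ : ℝ}
    (hδ : 0 ≤ δ) :
    ‖∫ ω, Complex.exp (Y ω * Complex.I) ∂P - ∫ ω, Complex.exp (Y' ω * Complex.I) ∂P‖ ≤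
      δ + 2 * P.real {ω | δ < |Y ω - Y' ω|} := by
  have hi : ∀ {Y : Ω → ℝ}, Measurable Y →
      Integrable (fun ω => Complex.exp (Y ω * Complex.I)) P := fun hY =>
    Integrable.of_bound (C := 1)
      (by fun_prop : Measurable fun ω => Complex.exp (_ * Complex.I)).aestronglyMeasurable
      (Eventually.of_forall fun ω => (Complex.norm_exp_ofReal_mul_I _).le)
  have hS : MeasurableSet {ω | δ < |Y ω - Y' ω|} :=
    measurableSet_lt measurable_const (by fun_prop)
  rw [← integral_sub (hi hY) (hi hY')]
  refine (norm_integral_le_integral_norm _).trans ?_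
  calc _ ≤ ∫ ω, (δ + {ω | δ < |Y ω - Y' ω|}.indicator (fun _ => (2 : ℝ)) ω) ∂P := by
        refine integral_mono ((hi hY).sub (hi hY')).norm
          ((integrable_const _).add ((integrable_const _).indicator hS)) fun ω => ?_
        by_cases h : δ < |Y ω - Y' ω|
        · have h1 := norm_sub_le (Complex.exp (Y ω * Complex.I)) (Complex.exp (Y' ω * Complex.I))
          rw [Complex.norm_exp_ofReal_mul_I, Complex.norm_exp_ofReal_mul_I] at h1
          simp only [Set.indicator_apply, Set.mem_ofPred_eq, h, if_true]
          linarith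
        · simp only [Set.indicator_apply, Set.mem_ofPred_eq, h, if_false, add_zero]
          have e : Complex.exp (Y ω * Complex.I) - Complex.exp (Y' ω * Complex.I) =
              Complex.exp (Y' ω * Complex.I) *
                (Complex.exp (Complex.I * ((Y ω - Y' ω : ℝ) : ℂ)) - 1) := by
            rw [mul_sub, ← Complex.exp_add, mul_one]
            congr 2
            push_cast
            ring
          rw [e, norm_mul, Complex.norm_exp_ofReal_mul_I, one_mul]
          refine Real.norm_exp_I_mul_ofReal_sub_one_le.trans ?_
          rw [Real.norm_eq_abs]
          exact not_lt.1 h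
    _ = _ := by
        rw [integral_add (integrable_const _) ((integrable_const _).indicator hS),
          integral_indicator_const _ hS]
        simp [mul_comm]

variable {Z : Fin n → Fin n → Fin p → ℝ} {θ : Idx n → ℝ} {γ : Fin p → ℝ} {ε : ℝ}
  {Ω : Type*} [MeasurableSpace Ω] {P : Measure Ω} [IsProbabilityMeasure P]
  {a : Fin n → Fin n → Ω → ℤ} {eO eI : Fin n → Ω → ℤ}

namespace IsModel

/-- Independence makes the characteristic function a product; its factors are exchanged one at a
time for Gaussian ones, all of modulus at most 1, so the individual errors just add. This is
Lyapunov's theorem with explicit error. -/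
lemma norm_integral_exp_sum_sub_le (M : IsModel P Z θ γ ε a eO eI) (hε : 0 < ε)
    (c : Edge n ⊕ (Fin n ⊕ Fin n) → ℝ) :
    ‖∫ ω, Complex.exp ((∑ s, c s * centred Z θ γ s (sources a eO eI s ω) : ℝ) * Complex.I) ∂P
      - (Real.exp (-(∑ s, c s ^ 2 * srcVar Z θ γ ε s) / 2) : ℂ)‖ ≤
      ∑ s, (4 * (|c s| ^ 3 * srcCube Z θ γ ε s) + (c s ^ 2 * srcVar Z θ γ ε s) ^ 2) := by
  set Y := fun s ω => c s * centred Z θ γ s (sources a eO eI s ω) with hYdef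
  have hm : ∀ s, Measurable (Y s) := fun s => (M.measurable_centred s).const_mul (c s)
  have hind : iIndepFun Y P := M.iIndepFun_centred.comp (fun s y => c s * y) fun s => by fun_prop
  have h1 : ∫ ω, Complex.exp ((∑ s, Y s ω : ℝ) * Complex.I) ∂P =
      ∏ s, ∫ ω, Complex.exp (Y s ω * Complex.I) ∂P := by
    have h := congrFun (hind.charFun_map_fun_sum_eq_prod fun s => (hm s).aemeasurable) 1
    have e : ∀ {W : Ω → ℝ}, Measurable W →
        charFun (P.map W) 1 = ∫ ω, Complex.exp (W ω * Complex.I) ∂P := fun hW => by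
      rw [charFun_apply_real, integral_map hW.aemeasurable
        (by fun_prop : Measurable fun x : ℝ => _).aestronglyMeasurable]
      simp
    rw [e (by fun_prop), Finset.prod_apply] at h
    rw [h]
    exact Finset.prod_congr rfl fun s _ => e (hm s)
  have h2 : (Real.exp (-(∑ s, c s ^ 2 * srcVar Z θ γ ε s) / 2) : ℂ) =
      ∏ s, (Real.exp (-(c s ^ 2 * srcVar Z θ γ ε s) / 2) : ℂ) := by
    rw [← Complex.ofReal_prod, ← Real.exp_sum, ← Finset.sum_div, Finset.sum_neg_distrib]
  have hvar : ∀ s, ∫ ω, Y s ω ^ 2 ∂P = c s ^ 2 * srcVar Z θ γ ε s := fun s => by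
    simp only [hYdef, mul_pow, integral_const_mul, M.integral_centred_sq hε]
  rw [h1, h2]
  refine (norm_prod_sub_prod_le _ _ _ (fun s => ?_) fun s => ?_).trans
    (Finset.sum_le_sum fun s _ => ?_)
  · refine (norm_integral_le_integral_norm _).trans (le_of_eq ?_)
    simp [Complex.norm_exp_ofReal_mul_I]
  · rw [Complex.norm_real, Real.norm_eq_abs, abs_of_pos (Real.exp_pos _), Real.exp_le_one_iff,
      ← hvar s]
    have : 0 ≤ ∫ ω, Y s ω ^ 2 ∂P := integral_nonneg fun ω => sq_nonneg _
    linarith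
  · have h3 : (fun ω => |Y s ω| ^ 3) =
        fun ω => |c s| ^ 3 * |centred Z θ γ s (sources a eO eI s ω)| ^ 3 := by
      funext ω; simp only [hYdef, abs_mul, mul_pow]
    rw [← hvar s]
    refine norm_integral_exp_sub_le ((M.memLp_centred hε s).const_mul (c s)) ?_ ?_ ?_
    · simp only [hYdef]
      rw [integral_const_mul, M.integral_centred hε, mul_zero]
    · rw [h3]; exact (M.integrable_centred_cube hε s).const_mul _
    · rw [h3, integral_const_mul]
      exact mul_le_mul_of_nonneg_left (M.integral_centred_cube_le hε s) (by positivity)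

end IsModel

end

section

variable {n p : ℕ}

/-! ### The leading linear statistic -/

variable {Z : Fin n → Fin n → Fin p → ℝ} {θ : Idx n → ℝ} {γ : Fin p → ℝ} {ε R : ℝ}

lemma inv_outW_le (hn : 3 ≤ n) (hR : 1 ≤ R) (hW : IsWeight (wgt Z θ γ) (1 / (4 * R)))
    (i : Fin n) : 1 / outW Z θ γ i ≤ 6 * R / n := by
  have hn0 : (0 : ℝ) < n := by exact_mod_cast (by omega : 0 < n)
  have h := outW_ge hn hW i
  have e : 2 / 3 * n * (1 / (4 * R)) = n / (6 * R) := by field_simp; norm_num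
  rw [e] at h
  rw [← one_div_div (n : ℝ)]
  exact one_div_le_one_div_of_le (by positivity) h

lemma inv_inW_le (hn : 3 ≤ n) (hR : 1 ≤ R) (hW : IsWeight (wgt Z θ γ) (1 / (4 * R)))
    (i : Fin n) : 1 / inW Z θ γ i ≤ 6 * R / n := by
  have hn0 : (0 : ℝ) < n := by exact_mod_cast (by omega : 0 < n)
  have h := inW_ge hn hW i
  have e : 2 / 3 * n * (1 / (4 * R)) = n / (6 * R) := by field_simp; norm_num
  rw [e] at h
  rw [← one_div_div (n : ℝ)]
  exact one_div_le_one_div_of_le (by positivity) h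

/-- An exact inverse would return the entry of S, the first bracket. The deviation comes from the
two crossings of a row with the column N and is of order R²/n². -/
lemma bil_sCol_sCol (hn : 3 ≤ n) {m : ℝ} (hW : IsWeight (wgt Z θ γ) m) {N : Fin n}
    (hN : (N : ℕ) = n - 1) (i j : Fin n) :
    bil (wgt Z θ γ) (degreeEffect (sCol Z θ γ i)) (degreeEffect (sCol Z θ γ j)) =
      ((if i = j then 1 / outW Z θ γ i else 0) + 1 / inW Z θ γ N)
        + (wgt Z θ γ j N * (1 / outW Z θ γ j * (1 / inW Z θ γ N))
          + wgt Z θ γ i N * (1 / outW Z θ γ i * (1 / inW Z θ γ N))) := by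
  rw [degreeEffect_sCol hN j, bil_addFun_single_right, degreeEffect_sCol hN i]
  simp only [addFun, Pi.single_apply, mul_add, Finset.sum_add_distrib, mul_ite, mul_zero,
    Finset.sum_ite_eq', Finset.mem_univ, if_true]
  have e1 : ∑ x, (if j = i then wgt Z θ γ j x / outW Z θ γ j * (1 / outW Z θ γ i) else 0) =
      if i = j then 1 / outW Z θ γ i else 0 := by
    rcases eq_or_ne j i with rfl | h
    · simp only [if_true, ← Finset.sum_mul, sum_outW_div hn hW, one_mul]
    · simp [h, h.symm]
  rw [e1, ← Finset.sum_mul, sum_inW_div hn hW]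
  ring

/-- Each of the 2n - 1 coordinates contains ±1/v_{2n,2n} with the same sign for every i. This gives
the leading term, which times the variance of one noise is s²/v_{2n,2n}²; the rest is of order
R²/n². -/
lemma dotProduct_sCol_sCol (hn : 3 ≤ n) {N : Fin n} (hN : (N : ℕ) = n - 1) (i j : Fin n) :
    sCol Z θ γ i ⬝ᵥ sCol Z θ γ j =
      (2 * n - 1) * (1 / inW Z θ γ N) ^ 2
        + ((if i = j then 1 / outW Z θ γ i * (1 / outW Z θ γ j) else 0)
          + (1 / outW Z θ γ i * (1 / inW Z θ γ N) + 1 / outW Z θ γ j * (1 / inW Z θ γ N))) := by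
  have hNk : ∀ k : Fin (n - 1), inNode k ≠ N := by
    intro k h
    have := congrArg Fin.val h
    rw [inNode_val, hN] at this
    have := k.2
    omega
  rw [sCol_eq hN, sCol_eq hN, dotProduct, Fintype.sum_sum_type]
  simp only [ofAdd, Sum.elim_inl, Sum.elim_inr, Pi.single_eq_same, Pi.single_eq_of_ne (hNk _),
    zero_sub, neg_mul_neg, add_mul, mul_add, Finset.sum_add_distrib, Finset.sum_const,
    Finset.card_univ, Fintype.card_fin, nsmul_eq_mul, ← Finset.sum_mul, ← Finset.mul_sum,
    Finset.sum_pi_single', Finset.mem_univ, if_true]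
  have e1 : ∑ x, (Pi.single i (1 / outW Z θ γ i) : Fin n → ℝ) x *
      (Pi.single j (1 / outW Z θ γ j) : Fin n → ℝ) x =
      if i = j then 1 / outW Z θ γ i * (1 / outW Z θ γ j) else 0 := by
    simp only [Pi.single_apply, ite_mul, zero_mul, Finset.sum_ite_eq', Finset.mem_univ, if_true,
      mul_ite, mul_zero]
    simp only [eq_comm]
  have e2 : ((n - 1 : ℕ) : ℝ) = n - 1 := by rw [Nat.cast_sub (by omega)]; simp
  rw [e1, e2]
  ring

variable {k : ℕ}

/-- The combination of the columns of `S` with coefficients `u`. -/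
def colComb (Z : Fin n → Fin n → Fin p → ℝ) (θ : Idx n → ℝ) (γ : Fin p → ℝ) (e : Fin k → Fin n)
    (u : Fin k → ℝ) : Idx n → ℝ := ∑ i, u i • sCol Z θ γ (e i)

lemma sumSq_colComb (e : Fin k → Fin n) (u : Fin k → ℝ) :
    sumSq (colComb Z θ γ e u) =
      ∑ i, ∑ j, u i * u j * (sCol Z θ γ (e i) ⬝ᵥ sCol Z θ γ (e j)) := by
  have : sumSq (colComb Z θ γ e u) = colComb Z θ γ e u ⬝ᵥ colComb Z θ γ e u := by
    simp only [sumSq, dotProduct, sq]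
  rw [this, colComb, sum_dotProduct]
  refine Finset.sum_congr rfl fun i _ => ?_
  rw [dotProduct_sum]
  refine Finset.sum_congr rfl fun j _ => ?_
  rw [smul_dotProduct, dotProduct_smul, smul_eq_mul, smul_eq_mul, mul_assoc]

lemma bil_degreeEffect_colComb (e : Fin k → Fin n) (u : Fin k → ℝ) :
    bil (wgt Z θ γ) (degreeEffect (colComb Z θ γ e u)) (degreeEffect (colComb Z θ γ e u)) =
      ∑ i, ∑ j, u i * u j *
        bil (wgt Z θ γ) (degreeEffect (sCol Z θ γ (e i))) (degreeEffect (sCol Z θ γ (e j))) := by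
  rw [colComb, degreeEffect_sum, bil_sum_left]
  refine Finset.sum_congr rfl fun i _ => ?_
  rw [bil_sum_right]
  refine Finset.sum_congr rfl fun j _ => ?_
  rw [degreeEffect_smul, degreeEffect_smul, bil_smul_left, bil_smul_right, mul_assoc]

/-- The variance of the leading statistic, up to terms of lower order. -/
lemma abs_variance_colComb_sub_le (hn : 3 ≤ n) (hR : 1 ≤ R)
    (hW : IsWeight (wgt Z θ γ) (1 / (4 * R))) {N : Fin n} (hN : (N : ℕ) = n - 1)
    {e : Fin k → Fin n} (he : Function.Injective e) {u : Fin k → ℝ} {U : ℝ}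
    (hu : ∀ i, |u i| ≤ U) {v : ℝ} (hv : 0 ≤ v) (sSq : ℝ) :
    |bil (wgt Z θ γ) (degreeEffect (colComb Z θ γ e u)) (degreeEffect (colComb Z θ γ e u))
        + v * sumSq (colComb Z θ γ e u)
      - ∑ i, ∑ j, u i * u j * ((if i = j then 1 / outW Z θ γ (e i) else 0)
        + (1 / inW Z θ γ N + sSq / inW Z θ γ N ^ 2))| ≤
      (k * U) ^ 2 * (126 * (1 + v) * (R / n) ^ 2
        + |(2 * n - 1) * v - sSq| / inW Z θ γ N ^ 2) := by
  have hn0 : (0 : ℝ) < n := by exact_mod_cast (by omega : 0 < n)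
  set t : ℝ := 6 * R / n with ht
  have ht0 : 0 ≤ t := by rw [ht]; positivity
  have ho : ∀ i, 0 ≤ 1 / outW Z θ γ i ∧ 1 / outW Z θ γ i ≤ t := fun i =>
    ⟨(one_div_pos.2 (outW_pos hn hW i)).le, inv_outW_le hn hR hW i⟩
  have hI : 0 ≤ 1 / inW Z θ γ N ∧ 1 / inW Z θ γ N ≤ t :=
    ⟨(one_div_pos.2 (inW_pos hn hW N)).le, inv_inW_le hn hR hW N⟩
  have hoI : ∀ i, 0 ≤ 1 / outW Z θ γ i * (1 / inW Z θ γ N) ∧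
      1 / outW Z θ γ i * (1 / inW Z θ γ N) ≤ t * t := fun i =>
    ⟨mul_nonneg (ho i).1 hI.1, mul_le_mul (ho i).2 hI.2 hI.1 ht0⟩
  rw [bil_degreeEffect_colComb, sumSq_colComb, Finset.mul_sum]
  simp only [Finset.mul_sum, ← Finset.sum_add_distrib, ← Finset.sum_sub_distrib]
  -- Here t² = 36(R/n)². The edge crossings give t²/2 and the noise v · 3t², and 126 = 18 + 108.
  set D := 126 * (1 + v) * (R / n) ^ 2 + |(2 * n - 1) * v - sSq| / inW Z θ γ N ^ 2 with hD
  have hU : ∀ i : Fin k, 0 ≤ U := fun i => (abs_nonneg _).trans (hu i)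
  have hterm : ∀ i j, |u i * u j *
        bil (wgt Z θ γ) (degreeEffect (sCol Z θ γ (e i))) (degreeEffect (sCol Z θ γ (e j)))
      + v * (u i * u j * (sCol Z θ γ (e i) ⬝ᵥ sCol Z θ γ (e j)))
      - u i * u j * ((if i = j then 1 / outW Z θ γ (e i) else 0)
        + (1 / inW Z θ γ N + sSq / inW Z θ γ N ^ 2))| ≤ U ^ 2 * D := by
    intro i j
    rw [bil_sCol_sCol hn hW hN, dotProduct_sCol_sCol hn hN]
    simp only [he.eq_iff]
    set x := wgt Z θ γ (e j) N * (1 / outW Z θ γ (e j) * (1 / inW Z θ γ N))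
          + wgt Z θ γ (e i) N * (1 / outW Z θ γ (e i) * (1 / inW Z θ γ N)) with hx
    set y := (if i = j then 1 / outW Z θ γ (e i) * (1 / outW Z θ γ (e j)) else 0)
          + (1 / outW Z θ γ (e i) * (1 / inW Z θ γ N)
            + 1 / outW Z θ γ (e j) * (1 / inW Z θ γ N)) with hy
    have hx0 : 0 ≤ x := add_nonneg (mul_nonneg (hW.nonneg _ _) (hoI _).1)
      (mul_nonneg (hW.nonneg _ _) (hoI _).1)
    have hx1 : x ≤ t * t / 2 := by
      have e1 : ∀ a : Fin n, wgt Z θ γ a N * (1 / outW Z θ γ a * (1 / inW Z θ γ N)) ≤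
          1 / 4 * (t * t) := fun a =>
        mul_le_mul (hW.upper _ _) (hoI a).2 (hoI a).1 (by norm_num)
      have := e1 (e i); have := e1 (e j); linarith
    have hy0 : 0 ≤ y := by
      refine add_nonneg ?_ (add_nonneg (hoI _).1 (hoI _).1)
      split_ifs
      exacts [mul_nonneg (ho _).1 (ho _).1, le_rfl]
    have hy1 : y ≤ 3 * (t * t) := by
      have e1 : (if i = j then 1 / outW Z θ γ (e i) * (1 / outW Z θ γ (e j)) else 0) ≤ t * t := by
        split_ifs
        exacts [mul_le_mul (ho _).2 (ho _).2 (ho _).1 ht0, by positivity]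
      have := (hoI (e i)).2; have := (hoI (e j)).2; linarith
    set d := if i = j then 1 / outW Z θ γ (e i) else 0
    have e2 : u i * u j * (d + 1 / inW Z θ γ N + x)
        + v * (u i * u j * ((2 * n - 1) * (1 / inW Z θ γ N) ^ 2 + y))
        - u i * u j * (d + (1 / inW Z θ γ N + sSq / inW Z θ γ N ^ 2)) =
        u i * u j * (x + v * y + ((2 * n - 1) * v - sSq) / inW Z θ γ N ^ 2) := by
      rw [one_div_pow]; ring
    rw [e2, abs_mul, abs_mul]
    refine mul_le_mul ?_ ?_ (abs_nonneg _) (sq_nonneg _)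
    · rw [sq]; exact mul_le_mul (hu i) (hu j) (abs_nonneg _) (hU i)
    · refine (abs_add_le _ _).trans (add_le_add ?_ ?_)
      · rw [abs_of_nonneg (by positivity)]
        have e3 : v * y ≤ v * (3 * (t * t)) := mul_le_mul_of_nonneg_left hy1 hv
        have e4 : t * t = 36 * (R / n) ^ 2 := by rw [ht]; ring
        have e5 : 0 ≤ v * (R / n) ^ 2 := by positivity
        have e6 : 0 ≤ (R / n) ^ 2 := by positivity
        rw [e4] at hx1 e3
        linarith
      · rw [abs_div, abs_of_nonneg (sq_nonneg (inW Z θ γ N))]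
  refine (Finset.abs_sum_le_sum_abs _ _).trans ?_
  calc _ ≤ ∑ _i : Fin k, ∑ _j : Fin k, U ^ 2 * D := Finset.sum_le_sum fun i _ =>
        (Finset.abs_sum_le_sum_abs _ _).trans (Finset.sum_le_sum fun j _ => hterm i j)
    _ = (k * U) ^ 2 * D := by
        simp only [Finset.sum_const, Finset.card_univ, Fintype.card_fin, nsmul_eq_mul]
        ring

lemma sCol_abs_le (hn : 3 ≤ n) (hR : 1 ≤ R) (hW : IsWeight (wgt Z θ γ) (1 / (4 * R)))
    (i : Fin n) (r : Idx n) : |sCol Z θ γ i r| ≤ 12 * R / n := by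
  obtain ⟨N, hN⟩ := exists_last hn
  have hn0 : (0 : ℝ) < n := by exact_mod_cast (by omega : 0 < n)
  have e : 12 * R / n = 6 * R / n + 6 * R / n := by ring
  have ht0 : 0 ≤ 6 * R / n := by positivity
  have h1 := inv_outW_le hn hR hW i
  have h2 := inv_inW_le hn hR hW N
  have h3 := (one_div_pos.2 (outW_pos hn hW i)).le
  have h4 := (one_div_pos.2 (inW_pos hn hW N)).le
  have hs : ∀ (a : Fin n) (b : ℝ), 0 ≤ b → b ≤ 6 * R / n → ∀ x, |(Pi.single a b : Fin n → ℝ) x| ≤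
      6 * R / n := fun a b h0 hb x => by
    rw [Pi.single_apply]
    split_ifs
    · rwa [abs_of_nonneg h0]
    · rwa [abs_zero]
  rw [sCol_eq hN, e]
  rcases r with a | a
  · exact (abs_add_le _ _).trans (add_le_add (hs _ _ h3 h1 _) (hs _ _ h4 h2 _))
  · exact (abs_sub _ _).trans (add_le_add (hs _ _ h4 h2 _) (hs _ _ h4 h2 _))

lemma degreeEffect_sCol_abs_le (hn : 3 ≤ n) (hR : 1 ≤ R)
    (hW : IsWeight (wgt Z θ γ) (1 / (4 * R))) (i : Fin n) (a b : Fin n) :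
    |degreeEffect (sCol Z θ γ i) a b| ≤ 12 * R / n := by
  obtain ⟨N, hN⟩ := exists_last hn
  have hn0 : (0 : ℝ) < n := by exact_mod_cast (by omega : 0 < n)
  have e : 12 * R / n = 6 * R / n + 6 * R / n := by ring
  have ht0 : 0 ≤ 6 * R / n := by positivity
  have h1 := inv_outW_le hn hR hW i
  have h2 := inv_inW_le hn hR hW N
  have h3 := (one_div_pos.2 (outW_pos hn hW i)).le
  have h4 := (one_div_pos.2 (inW_pos hn hW N)).le
  have hs : ∀ (a : Fin n) (b : ℝ), 0 ≤ b → b ≤ 6 * R / n → ∀ x, |(Pi.single a b : Fin n → ℝ) x| ≤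
      6 * R / n := fun a b h0 hb x => by
    rw [Pi.single_apply]
    split_ifs
    · rwa [abs_of_nonneg h0]
    · rwa [abs_zero]
  rw [degreeEffect_sCol hN, e]
  exact (abs_add_le _ _).trans (add_le_add (hs _ _ h3 h1 _) (hs _ _ h4 h2 _))

lemma abs_srcCoef_colComb_le (hn : 3 ≤ n) (hR : 1 ≤ R)
    (hW : IsWeight (wgt Z θ γ) (1 / (4 * R))) (e : Fin k → Fin n) {u : Fin k → ℝ} {U : ℝ}
    (hU : 0 ≤ U) (hu : ∀ i, |u i| ≤ U) (s : Edge n ⊕ (Fin n ⊕ Fin n)) :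
    |srcCoef (degreeEffect (colComb Z θ γ e u)) (colComb Z θ γ e u) s| ≤
      k * U * (12 * R / n) := by
  have hn0 : (0 : ℝ) < n := by exact_mod_cast (by omega : 0 < n)
  have hsum : ∀ g : Fin k → ℝ, (∀ i, |g i| ≤ 12 * R / n) → |∑ i, u i * g i| ≤
      k * U * (12 * R / n) := fun g hg => by
    calc _ ≤ ∑ i, |u i * g i| := Finset.abs_sum_le_sum_abs _ _
      _ ≤ ∑ _i : Fin k, U * (12 * R / n) := Finset.sum_le_sum fun i _ => by
          rw [abs_mul]; exact mul_le_mul (hu i) (hg i) (abs_nonneg _) hU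
      _ = _ := by simp [mul_assoc]
  have hx : ∀ r, |colComb Z θ γ e u r| ≤ k * U * (12 * R / n) := fun r => by
    rw [colComb, Finset.sum_apply]
    exact hsum _ fun i => sCol_abs_le hn hR hW (e i) r
  rcases s with d | i | j
  · simp only [srcCoef, Sum.elim_inl]
    rw [colComb, degreeEffect_sum, Finset.sum_apply, Finset.sum_apply]
    simp only [degreeEffect_smul, Pi.smul_apply, smul_eq_mul]
    exact hsum _ fun i => degreeEffect_sCol_abs_le hn hR hW (e i) _ _
  · exact hx _
  · simp only [srcCoef, Sum.elim_inr, beta]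
    split_ifs
    · exact hx _
    · rw [abs_zero]; positivity

lemma linStat_colComb {A : Fin n → Fin n → ℤ} {eO eI : Fin n → ℤ} (e : Fin k → Fin n)
    (u : Fin k → ℝ) :
    linStat Z θ γ A eO eI (degreeEffect (colComb Z θ γ e u)) (colComb Z θ γ e u) =
      ∑ i, u i * linStat Z θ γ A eO eI (degreeEffect (sCol Z θ γ (e i))) (sCol Z θ γ (e i)) := by
  rw [colComb, degreeEffect_sum, linStat_sum]
  refine Finset.sum_congr rfl fun i _ => ?_
  rw [degreeEffect_smul, linStat_smul]

/-- The sum of the third moments and squared variances for bounded coefficients. -/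
lemma sum_lyapunov_le {c : Edge n ⊕ (Fin n ⊕ Fin n) → ℝ} {b : ℝ} (hc : ∀ s, |c s| ≤ b)
    (hb : 0 ≤ b) (hε : 0 < ε) :
    ∑ s, (4 * (|c s| ^ 3 * srcCube Z θ γ ε s) + (c s ^ 2 * srcVar Z θ γ ε s) ^ 2) ≤
      (4 * b + b ^ 2 * (1 + lapVar (laplaceParam ε))) * ∑ s, c s ^ 2 * srcVar Z θ γ ε s
        + 8 * n * (b ^ 3 * (12 / (1 - laplaceParam ε) ^ 3)) := by
  set M := 12 / (1 - laplaceParam ε) ^ 3 with hM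
  set v := lapVar (laplaceParam ε) with hv
  have hv0 : 0 ≤ v := lapVar_laplaceParam_nonneg ε
  have hM0 : 0 ≤ M := by
    have : 0 < 1 - laplaceParam ε := by linarith [laplaceParam_lt_one hε]
    positivity
  have hsv : ∀ s, 0 ≤ srcVar Z θ γ ε s ∧ srcVar Z θ γ ε s ≤ 1 + v := by
    intro s
    rcases s with d | s
    · exact ⟨(sigw_pos _).le, (sigw_le _).trans (by linarith)⟩
    · exact ⟨hv0, by change v ≤ 1 + v; linarith⟩
  have hterm : ∀ s, 4 * (|c s| ^ 3 * srcCube Z θ γ ε s) + (c s ^ 2 * srcVar Z θ γ ε s) ^ 2 ≤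
      (4 * b + b ^ 2 * (1 + v)) * (c s ^ 2 * srcVar Z θ γ ε s) +
        Sum.elim (fun _ : Edge n => (0 : ℝ)) (fun _ : Fin n ⊕ Fin n => 4 * (b ^ 3 * M)) s := by
    intro s
    have h1 : (c s ^ 2 * srcVar Z θ γ ε s) ^ 2 ≤ b ^ 2 * (1 + v) * (c s ^ 2 * srcVar Z θ γ ε s) := by
      rw [sq (c s ^ 2 * _)]
      refine mul_le_mul_of_nonneg_right ?_ (mul_nonneg (sq_nonneg _) (hsv s).1)
      refine mul_le_mul ?_ (hsv s).2 (hsv s).1 (sq_nonneg _)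
      rw [← sq_abs]
      exact pow_le_pow_left₀ (abs_nonneg _) (hc s) 2
    -- For edges the third moment is bounded by the variance, so the n² edge terms are paid for by
    -- the total variance. The 2n noises are estimated one by one.
    have h2 : |c s| ^ 3 * srcCube Z θ γ ε s ≤ b * (c s ^ 2 * srcVar Z θ γ ε s) +
        Sum.elim (fun _ : Edge n => (0 : ℝ)) (fun _ : Fin n ⊕ Fin n => b ^ 3 * M) s := by
      rcases s with d | s
      · simp only [srcCube, srcVar, Sum.elim_inl, add_zero]
        rw [pow_succ', sq_abs, mul_assoc]
        exact mul_le_mul_of_nonneg_right (hc _)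
          (mul_nonneg (sq_nonneg _) (sigw_pos _).le)
      · have h3 : 0 ≤ b * (c (Sum.inr s) ^ 2 * srcVar Z θ γ ε (Sum.inr s)) :=
          mul_nonneg hb (mul_nonneg (sq_nonneg _) (hsv _).1)
        have h4 : |c (Sum.inr s)| ^ 3 * M ≤ b ^ 3 * M :=
          mul_le_mul_of_nonneg_right (pow_le_pow_left₀ (abs_nonneg _) (hc _) 3) hM0
        simp only [srcCube, Sum.elim_inr]
        linarith
    rcases s with d | s
    · simp only [Sum.elim_inl] at h2 ⊢
      linarith
    · simp only [Sum.elim_inr] at h2 ⊢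
      linarith
  refine (Finset.sum_le_sum fun s _ => hterm s).trans (le_of_eq ?_)
  rw [Finset.sum_add_distrib, ← Finset.mul_sum]
  congr 1
  simp only [Fintype.sum_sum_type, Sum.elim_inl, Sum.elim_inr, Finset.sum_const_zero,
    Finset.sum_const, Finset.card_univ, Fintype.card_sum, Fintype.card_fin, nsmul_eq_mul]
  push_cast
  ring

/-- The variance of the error of the columns of `S`. -/
lemma variance_colErr_le (hn : 3 ≤ n) (hR : 1 ≤ R) (hW : IsWeight (wgt Z θ γ) (1 / (4 * R)))
    {v : ℝ} (hv : 0 ≤ v) (i : Fin n) :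
    bil (wgt Z θ γ) (degreeEffect (colErr Z θ γ i)) (degreeEffect (colErr Z θ γ i))
      + v * sumSq (colErr Z θ γ i) ≤ 51200 * (1 + v) * R ^ 5 / n ^ 2 := by
  have hn0 : (0 : ℝ) < n := by exact_mod_cast (by omega : 0 < n)
  have h1 := bil_colErr_self_le hn hW i
  have h2 : sumSq (colErr Z θ γ i) ≤ _ := sum_sq_le_bil_degreeEffect hn hW (colErr Z θ γ i)
  set E := bil (wgt Z θ γ) (degreeEffect (colErr Z θ γ i)) (degreeEffect (colErr Z θ γ i))
  have e1 : (1 / (n * (1 / (4 * R)) ^ 2)) ^ 2 = 256 * R ^ 4 / n ^ 2 := by field_simp; norm_num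
  have e2 : 50 / (1 / (4 * R)) * E = 200 * R * E := by field_simp; ring
  rw [e1] at h1
  rw [e2] at h2
  have hR0 : 0 < R := by linarith
  calc E + v * sumSq (colErr Z θ γ i) ≤ E + v * (200 * R * E) := by gcongr
    _ = (1 + v * (200 * R)) * E := by ring
    _ ≤ (1 + v * (200 * R)) * (256 * R ^ 4 / n ^ 2) := by gcongr
    _ ≤ (200 * R * (1 + v)) * (256 * R ^ 4 / n ^ 2) := by
        gcongr
        nlinarith
    _ = _ := by ring

end

section

variable {n p k : ℕ}

/-! ### Characteristic function of the estimator -/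

lemma abs_exp_neg_sub_exp_neg_le {x y : ℝ} (hx : 0 ≤ x) (hy : 0 ≤ y) :
    |Real.exp (-x) - Real.exp (-y)| ≤ |x - y| := by
  wlog h : x ≤ y generalizing x y
  · rw [abs_sub_comm, abs_sub_comm x]
    exact this hy hx (le_of_not_ge h)
  have h1 : Real.exp (-y) ≤ Real.exp (-x) := Real.exp_le_exp.2 (by linarith)
  have h2 := Real.add_one_le_exp (x - y)
  have h3 : Real.exp (-y) = Real.exp (-x) * Real.exp (x - y) := by
    rw [← Real.exp_add]; congr 1; ring
  have h4 : Real.exp (-x) ≤ 1 := Real.exp_le_one_iff.2 (by linarith)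
  have h5 := Real.exp_pos (-x)
  rw [abs_of_nonneg (by linarith), abs_of_nonpos (by linarith), h3]
  nlinarith

section fixed

variable {Z : Fin n → Fin n → Fin p → ℝ} {θ : Idx n → ℝ} {γ : Fin p → ℝ} {ε R : ℝ}
  {Ω : Type*} [MeasurableSpace Ω] {P : Measure Ω} [IsProbabilityMeasure P]
  {a : Fin n → Fin n → Ω → ℤ} {eO eI : Fin n → Ω → ℤ}

/-- The four error groups are: the linearisation remainder with tolerance δ for the error columns;
the probabilities that this fails; the Lyapunov error of the leading statistic; and the discrepancy
d between its variance and the target τ. -/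
theorem IsModel.norm_integral_exp_sub_le (M : IsModel P Z θ γ ε a eO eI) (hε : 0 < ε) (hn : 3 ≤ n)
    (hR : 1 ≤ R) (hW : IsWeight (wgt Z θ γ) (1 / (4 * R))) (hk : 1 ≤ k)
    (e : Fin k → Fin n) {u : Fin k → ℝ} {U : ℝ} (hU : 0 < U)
    (hu : ∀ i, |u i| ≤ U) {X : Ω → Fin k → ℝ} (hX : Measurable X) {G : Ω → Prop} {rem : ℝ}
    (hrem : 0 ≤ rem)
    (hG : ∀ ω, G ω → ∀ i, |X ω i
      - linStat Z θ γ (fun i j => a i j ω) (fun i => eO i ω) (fun i => eI i ω)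
        (degreeEffect (sCol Z θ γ (e i))) (sCol Z θ γ (e i))
      - linStat Z θ γ (fun i j => a i j ω) (fun i => eO i ω) (fun i => eI i ω)
        (degreeEffect (colErr Z θ γ (e i))) (colErr Z θ γ (e i))| ≤ rem)
    {δ τ d : ℝ} (hδ : 0 < δ) (hτ : 0 ≤ τ)
    (hd : |bil (wgt Z θ γ) (degreeEffect (colComb Z θ γ e u)) (degreeEffect (colComb Z θ γ e u))
        + lapVar (laplaceParam ε) * sumSq (colComb Z θ γ e u) - τ| ≤ d) :
    ‖∫ ω, Complex.exp ((∑ i, u i * X ω i : ℝ) * Complex.I) ∂P - (Real.exp (-τ / 2) : ℂ)‖ ≤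
      (k * U * rem + δ)
      + 2 * (P.real {ω | ¬ G ω}
        + k * (51200 * (1 + lapVar (laplaceParam ε)) * R ^ 5 / n ^ 2 / (δ / (k * U)) ^ 2))
      + ((4 * (k * U * (12 * R / n))
          + (k * U * (12 * R / n)) ^ 2 * (1 + lapVar (laplaceParam ε))) * (τ + d)
        + 8 * n * ((k * U * (12 * R / n)) ^ 3 * (12 / (1 - laplaceParam ε) ^ 3)))
      + d := by
  have hn0 : (0 : ℝ) < n := by exact_mod_cast (by omega : 0 < n)
  have hk0 : (0 : ℝ) < k := by exact_mod_cast hk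
  set v := lapVar (laplaceParam ε) with hv
  have hv0 : 0 ≤ v := lapVar_laplaceParam_nonneg ε
  set lin := fun (f : Fin n → Fin n → ℝ) (x : Idx n → ℝ) (ω : Ω) =>
    linStat Z θ γ (fun i j => a i j ω) (fun i => eO i ω) (fun i => eI i ω) f x with hlin
  have hlinm : ∀ f x, Measurable (lin f x) := fun f x => by
    simp only [hlin, linStat_eq_sum_sources hn]
    exact Finset.measurable_sum _ fun s _ => (M.measurable_centred s).const_mul _
  set x := colComb Z θ γ e u with hx
  set τ' := bil (wgt Z θ γ) (degreeEffect x) (degreeEffect x) + v * sumSq x with hτ'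
  have hτ'0 : 0 ≤ τ' := add_nonneg (bil_self_nonneg hW _)
    (mul_nonneg hv0 (Finset.sum_nonneg fun r _ => sq_nonneg _))
  set W := fun ω => ∑ i, u i * X ω i with hWdef
  have hWm : Measurable W := by fun_prop
  have h1 := norm_integral_exp_sub_integral_exp_le (P := P) hWm (hlinm (degreeEffect x) x)
    (δ := k * U * rem + δ) (by positivity)
  have h2 : P.real {ω | k * U * rem + δ < |W ω - lin (degreeEffect x) x ω|} ≤
      P.real {ω | ¬ G ω} + k * (51200 * (1 + v) * R ^ 5 / n ^ 2 / (δ / (k * U)) ^ 2) := by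
    set E := fun i : Fin k =>
      {ω | δ / (k * U) < |lin (degreeEffect (colErr Z θ γ (e i))) (colErr Z θ γ (e i)) ω|}
    have g1 : ∀ i, P.real (E i) ≤ 51200 * (1 + v) * R ^ 5 / n ^ 2 / (δ / (k * U)) ^ 2 := fun i =>
      (M.measureReal_lt_abs_linStat_le hε hn _ _ (by positivity)).trans
        (div_le_div_of_nonneg_right (variance_colErr_le hn hR hW hv0 (e i)) (by positivity))
    have g2 : P.real (⋃ i, E i) ≤ k * (51200 * (1 + v) * R ^ 5 / n ^ 2 / (δ / (k * U)) ^ 2) :=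
      calc _ ≤ ∑ i, P.real (E i) := measureReal_iUnion_fintype_le _
        _ ≤ ∑ _i : Fin k, _ := Finset.sum_le_sum fun i _ => g1 i
        _ = _ := by simp
    refine le_trans (measureReal_mono ?_) ((measureReal_union_le {ω | ¬ G ω} (⋃ i, E i)).trans
      (add_le_add le_rfl g2))
    intro ω hω
    by_contra hc
    simp only [Set.mem_union, Set.mem_iUnion, not_or, not_exists] at hc
    obtain ⟨c1, c2⟩ := hc
    have hω' : k * U * rem + δ < |W ω - lin (degreeEffect x) x ω| := hω
    refine absurd hω' (not_lt.2 ?_)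
    have c1' : G ω := not_not.1 c1
    have e1 : W ω - lin (degreeEffect x) x ω = ∑ i, u i *
        (X ω i - lin (degreeEffect (sCol Z θ γ (e i))) (sCol Z θ γ (e i)) ω) := by
      simp only [hWdef, hlin, hx, linStat_colComb, mul_sub, Finset.sum_sub_distrib]
    rw [e1]
    have e2 : ∀ i, |X ω i - lin (degreeEffect (sCol Z θ γ (e i))) (sCol Z θ γ (e i)) ω| ≤
        rem + δ / (k * U) := fun i => by
      have f1 := hG ω c1' i
      have f2 : |lin (degreeEffect (colErr Z θ γ (e i))) (colErr Z θ γ (e i)) ω| ≤ δ / (k * U) :=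
        not_lt.1 (c2 i)
      have f3 := abs_add_le (X ω i - lin (degreeEffect (sCol Z θ γ (e i))) (sCol Z θ γ (e i)) ω
        - lin (degreeEffect (colErr Z θ γ (e i))) (colErr Z θ γ (e i)) ω)
        (lin (degreeEffect (colErr Z θ γ (e i))) (colErr Z θ γ (e i)) ω)
      rw [sub_add_cancel] at f3
      exact f3.trans (add_le_add f1 f2)
    calc _ ≤ ∑ i, |u i * _| := Finset.abs_sum_le_sum_abs _ _
      _ ≤ ∑ _i : Fin k, U * (rem + δ / (k * U)) := Finset.sum_le_sum fun i _ => by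
          rw [abs_mul]; exact mul_le_mul (hu i) (e2 i) (abs_nonneg _) hU.le
      _ = k * U * rem + δ := by
          simp only [Finset.sum_const, Finset.card_univ, Fintype.card_fin, nsmul_eq_mul]
          field_simp
  have h3 := M.norm_integral_exp_sum_sub_le hε (srcCoef (degreeEffect x) x)
  rw [sum_srcCoef_sq_mul_srcVar hn] at h3
  simp only [← linStat_eq_sum_sources hn] at h3
  have h4 := sum_lyapunov_le (Z := Z) (θ := θ) (γ := γ)
    (abs_srcCoef_colComb_le hn hR hW e hU.le hu) (by positivity) hε
  rw [sum_srcCoef_sq_mul_srcVar hn] at h4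
  rw [← hx, ← hv, ← hτ'] at h4
  rw [← hv, ← hτ'] at h3
  have h5 : ‖(Real.exp (-τ' / 2) : ℂ) - (Real.exp (-τ / 2) : ℂ)‖ ≤ d := by
    rw [← Complex.ofReal_sub, Complex.norm_real, Real.norm_eq_abs, neg_div, neg_div]
    refine (abs_exp_neg_sub_exp_neg_le (by positivity) (by positivity)).trans ?_
    rw [← sub_div, abs_div, abs_two]
    have := abs_nonneg (τ' - τ)
    linarith
  have h6 : τ' ≤ τ + d := by have := (abs_le.1 hd).2; linarith
  have hM0 : 0 < 1 - laplaceParam ε := by linarith [laplaceParam_lt_one hε]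
  have h7 : (4 * (k * U * (12 * R / n)) + (k * U * (12 * R / n)) ^ 2 * (1 + v)) * τ' ≤
      (4 * (k * U * (12 * R / n)) + (k * U * (12 * R / n)) ^ 2 * (1 + v)) * (τ + d) :=
    mul_le_mul_of_nonneg_left h6 (by positivity)
  have e3 : ∫ ω, Complex.exp ((W ω : ℝ) * Complex.I) ∂P - (Real.exp (-τ / 2) : ℂ) =
      (∫ ω, Complex.exp (W ω * Complex.I) ∂P -
        ∫ ω, Complex.exp (lin (degreeEffect x) x ω * Complex.I) ∂P)
      + (∫ ω, Complex.exp (lin (degreeEffect x) x ω * Complex.I) ∂P - (Real.exp (-τ' / 2) : ℂ))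
      + ((Real.exp (-τ' / 2) : ℂ) - (Real.exp (-τ / 2) : ℂ)) := by ring
  rw [e3]
  refine (norm_add₃_le).trans ?_
  linarith

end fixed

/-! ### A criterion for asymptotic normality -/

open scoped MatrixOrder in
lemma posDef_invSqrt {C : Matrix (Fin k) (Fin k) ℝ} (hC : C.PosDef) :
    ((CFC.sqrt C)⁻¹)ᵀ = (CFC.sqrt C)⁻¹ ∧ (CFC.sqrt C)⁻¹ * C * (CFC.sqrt C)⁻¹ = 1 := by
  have h1 : (CFC.sqrt C).PosSemidef := Matrix.nonneg_iff_posSemidef.1 (CFC.sqrt_nonneg C)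
  have h2 : CFC.sqrt C * CFC.sqrt C = C := CFC.sqrt_mul_sqrt_self C hC.posSemidef.nonneg
  have hdet : IsUnit (CFC.sqrt C).det := by
    have h3 : (CFC.sqrt C).det * (CFC.sqrt C).det = C.det := by rw [← Matrix.det_mul, h2]
    have h4 := hC.det_pos
    rw [isUnit_iff_ne_zero]
    intro h
    rw [h, mul_zero] at h3
    exact h4.ne h3
  constructor
  · rw [Matrix.transpose_nonsing_inv]
    congr 1
    exact h1.isHermitian
  · nth_rewrite 2 [← h2]
    rw [← mul_assoc, Matrix.nonsing_inv_mul _ hdet, one_mul, Matrix.mul_nonsing_inv _ hdet]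

open scoped MatrixOrder in
/-- Asymptotic normality follows from the convergence of the characteristic functions along all
directions of fixed asymptotic variance. -/
theorem asymptoticallyNormal_of_charFun {Ω : ℕ → Type*} [∀ n, MeasurableSpace (Ω n)]
    (P : ∀ n, Measure (Ω n)) [∀ n, IsProbabilityMeasure (P n)]
    {X : ∀ n, Ω n → EuclideanSpace ℝ (Fin k)} {C : ℕ → Matrix (Fin k) (Fin k) ℝ}
    (hX : ∀ n, Measurable (X n)) (hC : ∀ᶠ n in atTop, (C n).PosDef)
    (h : ∀ (u : ℕ → Fin k → ℝ) (c : ℝ), 0 ≤ c → (∀ᶠ n in atTop, u n ⬝ᵥ C n *ᵥ u n = c) →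
      Tendsto (fun n => ∫ ω, Complex.exp ((∑ i, u n i * X n ω i : ℝ) * Complex.I) ∂(P n)) atTop
        (𝓝 (Real.exp (-c / 2) : ℂ))) :
    AsymptoticallyNormal P X C := by
  refine ⟨hC, ?_⟩
  have hm : ∀ n, Measurable fun ω => Matrix.toEuclideanCLM (𝕜 := ℝ) (CFC.sqrt (C n))⁻¹ (X n ω) :=
    fun n => (ContinuousLinearMap.measurable _).comp (hX n)
  refine ⟨fun n => (hm n).aemeasurable, by fun_prop, ?_⟩
  refine ProbabilityMeasure.tendsto_of_tendsto_charFun fun t => ?_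
  simp only [ProbabilityMeasure.coe_mk, Measure.map_id, charFun_stdGaussian]
  -- The direction C_n^(-1/2) t varies with n but has constant variance ‖t‖² under C_n.
  have key := h (fun n => (CFC.sqrt (C n))⁻¹ *ᵥ WithLp.ofLp t) (‖t‖ ^ 2) (sq_nonneg _) ?_
  · have e : Complex.exp (-(‖t‖ : ℂ) ^ 2 / 2) = (Real.exp (-‖t‖ ^ 2 / 2) : ℂ) := by
      push_cast; rfl
    rw [e]
    refine key.congr' ?_
    filter_upwards [hC] with n hn
    rw [charFun_apply, integral_map (hm n).aemeasurable
      (Continuous.aestronglyMeasurable (by fun_prop))]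
    refine integral_congr_ae (Eventually.of_forall fun ω => ?_)
    simp only
    congr 3
    rw [EuclideanSpace.inner_eq_star_dotProduct, Matrix.ofLp_toEuclideanCLM]
    rw [star_trivial, Matrix.dotProduct_mulVec, ← Matrix.mulVec_transpose, (posDef_invSqrt hn).1]
    rfl
  · filter_upwards [hC] with n hn
    rw [Matrix.mulVec_mulVec, Matrix.dotProduct_mulVec, ← Matrix.mulVec_transpose,
      Matrix.mulVec_mulVec, Matrix.transpose_mul, (posDef_invSqrt hn).1]
    have hCt : (C n)ᵀ = C n := hn.isHermitian
    rw [hCt, (posDef_invSqrt hn).2, Matrix.one_mulVec, EuclideanSpace.norm_sq_eq]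
    simp [dotProduct, sq]

end

section

variable {n p k : ℕ}

/-! ### Consequences of the assumptions for one graph -/

section fixed

variable {Z : Fin n → Fin n → Fin p → ℝ} {θ : Idx n → ℝ} {γ : Fin p → ℝ} {ε ε₁ ε₂ lam : ℝ}

lemma abs_le_covBound (i j : Fin n) (hij : i ≠ j) (l : Fin p) : |Z i j l| ≤ covBound Z := by
  have h1 : ‖Z i j‖ ≤ covBound Z := le_ciSup (f := fun e : Edge n => ‖Z e.1.1 e.1.2‖)
    (Set.finite_range _).bddAbove ⟨(i, j), hij⟩
  exact (norm_le_pi_norm (Z i j) l).trans h1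

lemma covBound_nonneg : 0 ≤ covBound Z := Real.iSup_nonneg fun _ => norm_nonneg _

lemma rho_nonneg (hε₁ : 0 < ε₁) (hε₂ : 0 < ε₂) : 0 ≤ rho Z θ γ ε₁ ε₂ := by
  have h1 := covBound_nonneg (Z := Z)
  have h2 : 0 ≤ ⨆ e : Edge n, |degreeEffect θ e.1.1 e.1.2| :=
    Real.iSup_nonneg fun _ => abs_nonneg _
  unfold rho
  positivity

lemma abs_logit_le_rho (hε₁ : 0 < ε₁) (hε₂ : 0 < ε₂) (i j : Fin n) (hij : i ≠ j) :
    |logit Z θ γ i j| ≤ rho Z θ γ ε₁ ε₂ := by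
  have h1 : |degreeEffect θ i j| ≤ ⨆ e : Edge n, |degreeEffect θ e.1.1 e.1.2| :=
    le_ciSup (f := fun e : Edge n => |degreeEffect θ e.1.1 e.1.2|)
      (Set.finite_range _).bddAbove ⟨(i, j), hij⟩
  have h2 : |Z i j ⬝ᵥ γ| ≤ p * covBound Z * ‖γ‖ :=
    abs_covComb_le (Z := Z) (fun i j hij l => abs_le_covBound i j hij l) γ
      (fun l => norm_le_pi_norm γ l) hij
  have h3 : 0 ≤ p * covBound Z * ε₂ := by
    have := covBound_nonneg (Z := Z)
    positivity
  have := abs_add_le (Z i j ⬝ᵥ γ) (degreeEffect θ i j)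
  unfold logit rho
  linarith

/-- The standing assumptions on one graph. -/
structure IsRegular (Z : Fin n → Fin n → Fin p → ℝ) (θ : Idx n → ℝ) (γ : Fin p → ℝ)
    (ε ε₁ ε₂ lam : ℝ) : Prop where
  three_le : 3 ≤ n
  one_le_log : 1 ≤ Real.log n
  pos : 0 < ε
  pos₁ : 0 < ε₁
  pos₂ : 0 < ε₂
  posDef : (H Z θ γ).PosDef
  norm_inv_le : rowSumNorm (H Z θ γ)⁻¹ ≤ lam / (n : ℝ) ^ 2

/-- The rate `λ q² e^{12ρ} (1 + κ)² log n / √n`. -/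
def rate (Z : Fin n → Fin n → Fin p → ℝ) (θ : Idx n → ℝ) (γ : Fin p → ℝ)
    (ε ε₁ ε₂ lam : ℝ) : ℝ :=
  lam * covBound Z ^ 2 * Real.exp (12 * rho Z θ γ ε₁ ε₂) * (1 + kappa ε) ^ 2
    / (√n / Real.log n)

namespace IsRegular

lemma one_le_exp_rho (h : IsRegular Z θ γ ε ε₁ ε₂ lam) : 1 ≤ Real.exp (rho Z θ γ ε₁ ε₂) :=
  Real.one_le_exp (rho_nonneg h.pos₁ h.pos₂)

lemma isWeight (h : IsRegular Z θ γ ε ε₁ ε₂ lam) :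
    IsWeight (wgt Z θ γ) (1 / (4 * Real.exp (rho Z θ γ ε₁ ε₂))) := by
  have := isWeight_wgt (Z := Z) (θ := θ) (γ := γ) (abs_logit_le_rho h.pos₁ h.pos₂)
  rwa [Real.exp_neg, show (Real.exp (rho Z θ γ ε₁ ε₂))⁻¹ / 4 =
    1 / (4 * Real.exp (rho Z θ γ ε₁ ε₂)) by field_simp] at this

lemma four_le (h : IsRegular Z θ γ ε ε₁ ε₂ lam) (hp : 1 ≤ p) : 4 ≤ lam * covBound Z ^ 2 := by
  have h4 := four_le_of_rowSumNorm_le h.three_le h.isWeight abs_le_covBound h.posDef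
    h.norm_inv_le ⟨0, hp⟩
  have hn0 : (n : ℝ) ≠ 0 := by have := h.three_le; exact_mod_cast (by omega : n ≠ 0)
  rwa [div_mul_cancel₀ _ (pow_ne_zero 2 hn0)] at h4

lemma covBound_pos (h : IsRegular Z θ γ ε ε₁ ε₂ lam) (hp : 1 ≤ p) : 0 < covBound Z := by
  refine covBound_nonneg.lt_of_ne fun h0 => ?_
  have := h.four_le hp
  rw [← h0] at this
  norm_num at this

lemma lam_nonneg (h : IsRegular Z θ γ ε ε₁ ε₂ lam) (hp : 1 ≤ p) : 0 ≤ lam := by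
  by_contra hc
  push Not at hc
  have h1 := h.four_le hp
  have h2 := mul_nonneg (neg_nonneg.2 hc.le) (sq_nonneg (covBound Z))
  linarith

lemma rate_mul_sqrt (h : IsRegular Z θ γ ε ε₁ ε₂ lam) :
    rate Z θ γ ε ε₁ ε₂ lam * √n =
      lam * covBound Z ^ 2 * Real.exp (rho Z θ γ ε₁ ε₂) ^ 12 * (1 + kappa ε) ^ 2 * Real.log n := by
  have hn0 : (0 : ℝ) < n := by have := h.three_le; exact_mod_cast (by omega : 0 < n)
  have hs : √(n : ℝ) ≠ 0 := (Real.sqrt_pos.2 hn0).ne'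
  have hL : Real.log n ≠ 0 := by have := h.one_le_log; linarith
  rw [rate, ← Real.exp_nat_mul]
  push_cast
  field_simp

/-- The rate dominates `e^{12ρ} (1 + κ)² / √n`. -/
lemma exp_rho_le_rate (h : IsRegular Z θ γ ε ε₁ ε₂ lam) (hp : 1 ≤ p) :
    Real.exp (rho Z θ γ ε₁ ε₂) ^ 12 * (1 + kappa ε) ^ 2 ≤ rate Z θ γ ε ε₁ ε₂ lam * √n := by
  rw [h.rate_mul_sqrt]
  have h1 := h.four_le hp
  have h2 := h.one_le_log
  have h3 : 0 ≤ Real.exp (rho Z θ γ ε₁ ε₂) ^ 12 * (1 + kappa ε) ^ 2 := by positivity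
  calc _ = 1 * (Real.exp (rho Z θ γ ε₁ ε₂) ^ 12 * (1 + kappa ε) ^ 2) * 1 := by ring
    _ ≤ (lam * covBound Z ^ 2) * (Real.exp (rho Z θ γ ε₁ ε₂) ^ 12 * (1 + kappa ε) ^ 2)
        * Real.log n := by
        refine mul_le_mul (mul_le_mul_of_nonneg_right (by linarith) h3) h2 zero_le_one ?_
        exact mul_nonneg (by linarith) h3
    _ = _ := by ring

/-- On the good event the estimator exists, and its out-parameters are linear statistics up to a
remainder that is small compared with `1 / √n`. -/
lemma exists_solution (h : IsRegular Z θ γ ε ε₁ ε₂ lam) (hp : 1 ≤ p)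
    (hrate : rate Z θ γ ε ε₁ ε₂ lam ≤ 1 / (300000 * p ^ 2) ^ 2)
    {A : Fin n → Fin n → ℤ} {eO eI : Fin n → ℤ}
    (hgood : IsGood Z θ γ A eO eI (√(n * Real.log n)) (2 * n * (1 + kappa ε) ^ 2 * Real.log n)
      (√2 * n * covBound Z * (1 + kappa ε) * √(Real.log n)
        / (1 / (4 * Real.exp (rho Z θ γ ε₁ ε₂))) ^ 2)) :
    ∃ (θ' : Idx n → ℝ) (γ' : Fin p → ℝ), IsMomentSolution Z A eO eI θ' γ' ∧
      ∀ i, |θ' (Sum.inl i) - θ (Sum.inl i)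
        - linStat Z θ γ A eO eI (degreeEffect (sCol Z θ γ i)) (sCol Z θ γ i)
        - linStat Z θ γ A eO eI (degreeEffect (colErr Z θ γ i)) (colErr Z θ γ i)| ≤
        3 * 10 ^ 10 * p ^ 4 * (rate Z θ γ ε ε₁ ε₂ lam / √n) := by
  have hn3 : (3 : ℝ) ≤ n := by exact_mod_cast h.three_le
  have hn0 : (0 : ℝ) < n := by linarith
  have hp1 : (1 : ℝ) ≤ p := by exact_mod_cast hp
  have hlam := h.lam_nonneg hp
  have hq := h.covBound_pos hp
  have hL := h.one_le_log
  have hκ := kappa_pos h.pos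
  have hR := h.one_le_exp_rho
  have hmul := h.rate_mul_sqrt
  have hfour := h.four_le hp
  set x := rate Z θ γ ε ε₁ ε₂ lam with hx
  set R := Real.exp (rho Z θ γ ε₁ ε₂) with hRdef
  set q := covBound Z with hqdef
  set K := 1 + kappa ε with hK
  set L := Real.log n with hLdef
  have hK1 : 1 ≤ K := by linarith
  set s := q * √lam with hs
  have hs2 : s ^ 2 = lam * q ^ 2 := by rw [hs, mul_pow, Real.sq_sqrt hlam]; ring
  have hs0 : 0 ≤ s := by positivity
  set N := √(n : ℝ) with hN
  have hN0 : 0 < N := Real.sqrt_pos.2 hn0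
  have hN1 : 1 ≤ N := Real.one_le_sqrt.2 (by linarith)
  have hNn : (n : ℝ) = N ^ 2 := (Real.sq_sqrt hn0.le).symm
  have hR0 : 0 < R := by linarith
  have hL0 : 0 < L := by linarith
  rw [← hs2] at hmul
  clear_value N x
  have hx1 : x ≤ 1 := hrate.trans (by
    rw [div_le_one (by positivity)]
    have : 1 ≤ (p : ℝ) ^ 2 := one_le_pow₀ hp1
    exact one_le_pow₀ (by linarith))
  have hxN : s ^ 2 * R ^ 6 * K ^ 2 * L ≤ x * N := by
    rw [hmul]
    have : R ^ 6 ≤ R ^ 12 := pow_le_pow_right₀ hR (by norm_num)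
    gcongr
  have hsR : s * R ≤ N := by
    -- The bound sR ≤ √n follows from the smallness of the rate alone, since s²R² ≤ x√n.
    refine (sq_le_sq₀ (by positivity) hN0.le).1 ?_
    calc (s * R) ^ 2 = s ^ 2 * R ^ 2 * 1 * 1 := by ring
      _ ≤ s ^ 2 * R ^ 6 * K ^ 2 * L := by
          have h1 : R ^ 2 ≤ R ^ 6 := pow_le_pow_right₀ hR (by norm_num)
          have h2 : 1 ≤ K ^ 2 := one_le_pow₀ hK1
          gcongr
      _ ≤ x * N := hxN
      _ ≤ 1 * N := by gcongr
      _ ≤ N ^ 2 := by rw [sq, one_mul]; exact le_mul_of_one_le_left hN0.le hN1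
  -- The threshold for the rate is chosen so that 71000/300000 = 71/300 lies below 1/4, the size of
  -- the box.
  have hw : 71000 * (p : ℝ) ^ 2 * (s * K * √L * R ^ 3 / N) < 1 / 4 := by
    have h1 : (s * K * √L * R ^ 3 / N) ^ 2 ≤ (1 / (300000 * (p : ℝ) ^ 2)) ^ 2 := by
      calc _ = s ^ 2 * R ^ 6 * K ^ 2 * √L ^ 2 / N ^ 2 := by ring
        _ = s ^ 2 * R ^ 6 * K ^ 2 * L / N ^ 2 := by rw [Real.sq_sqrt hL0.le]
        _ ≤ x * N / N ^ 2 := by gcongr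
        _ = x / N := by field_simp
        _ ≤ x := div_le_self (by
            have : 0 ≤ x * N := by rw [hmul]; positivity
            exact nonneg_of_mul_nonneg_left this hN0) hN1
        _ ≤ _ := by rw [div_pow, one_pow]; exact hrate
    have h2 : s * K * √L * R ^ 3 / N ≤ 1 / (300000 * (p : ℝ) ^ 2) :=
      (sq_le_sq₀ (by positivity) (by positivity)).1 h1
    calc _ ≤ 71000 * (p : ℝ) ^ 2 * (1 / (300000 * (p : ℝ) ^ 2)) := by gcongr
      _ = 71 / 300 := by field_simp; norm_num
      _ < _ := by norm_num
  obtain ⟨θ', γ', hsol, hrem⟩ := IsGood.exists_solution h.three_le hp hR hK1 hL h.isWeight hq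
    abs_le_covBound h.posDef h.norm_inv_le hs (hN ▸ hsR) (hN ▸ hw) hgood
  refine ⟨θ', γ', hsol, fun i => (hrem i).trans ?_⟩
  refine mul_le_mul_of_nonneg_left ?_ (by positivity)
  rw [div_le_div_iff₀ hn0 hN0, hNn]
  calc _ ≤ x * N * N := by gcongr
    _ = _ := by ring

end IsRegular

variable {Ω : Type*} [MeasurableSpace Ω] {P : Measure Ω} [IsProbabilityMeasure P]
  {a : Fin n → Fin n → Ω → ℤ} {eO eI : Fin n → Ω → ℤ}

/-- The variance of the noise in the last equation. -/
lemma IsModel.noiseVariance_eq (M : IsModel P Z θ γ ε a eO eI) (hε : 0 < ε) (hn : 1 ≤ n) :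
    noiseVariance P eO eI = (2 * n - 1) * lapVar (laplaceParam ε) := by
  set N : Fin n := ⟨n - 1, by omega⟩ with hN
  set c : Edge n ⊕ (Fin n ⊕ Fin n) → ℝ := Sum.elim (fun _ => 0)
    (Sum.elim (fun _ => 1) (fun j => if (j : ℕ) < n - 1 then -1 else 0)) with hc
  have hk : ∀ k : Fin (n - 1), ((inNode k : Fin n) : ℕ) < n - 1 := fun k => by
    rw [inNode_val]; exact k.2
  have h1 : (fun ω => ∑ i, (eO i ω : ℝ) - ∑ i : Fin (n - 1), (eI (inNode i) ω : ℝ)) =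
      fun ω => ∑ s, c s * centred Z θ γ s (sources a eO eI s ω) := by
    funext ω
    simp only [Fintype.sum_sum_type, hc, Sum.elim_inl, Sum.elim_inr, zero_mul,
      Finset.sum_const_zero, zero_add, one_mul]
    rw [sum_eq_sum_inNode_add (N := N) rfl (fun j : Fin n =>
      (if (j : ℕ) < n - 1 then (-1 : ℝ) else 0) * _)]
    simp only [hk, if_true, hN, lt_irrefl, if_false, zero_mul, add_zero, neg_one_mul,
      Finset.sum_neg_distrib]
    rw [← sub_eq_add_neg]
    rfl
  rw [noiseVariance, h1, M.variance_sum_centred hε]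
  simp only [Fintype.sum_sum_type, hc, srcVar, Sum.elim_inl, Sum.elim_inr]
  rw [sum_eq_sum_inNode_add (N := N) rfl (fun j : Fin n =>
      (if (j : ℕ) < n - 1 then (-1 : ℝ) else 0) ^ 2 * _)]
  simp only [hk, if_true, hN, lt_irrefl, if_false]
  simp [Nat.cast_sub hn]
  ring

lemma lapVar_eq (hε : 0 < ε) : lapVar (laplaceParam ε) =
    2 * Real.exp (-2 / kappa ε) / (1 - Real.exp (-2 / kappa ε)) ^ 2 := by
  have : -2 / kappa ε = -ε / 2 := by unfold kappa; field_simp; norm_num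
  rw [this]
  rfl

/-- The noise parameter is bounded by the variance of the noise. -/
lemma kappa_sq_le (hε : 0 < ε) : kappa ε ^ 2 ≤ 4 + 6 * lapVar (laplaceParam ε) := by
  have hκ := kappa_pos hε
  have hv := lapVar_laplaceParam_nonneg ε
  -- For κ ≤ 2 the constant 4 suffices. Otherwise ε/2 < 1, so r ≥ 1/3 and 1 - r ≤ ε/2, and the
  -- variance 2r/(1 - r)² is at least κ²/6.
  rcases le_or_gt (kappa ε) 2 with h | h
  · nlinarith
  · have e1 : ε / 2 = 2 / kappa ε := by unfold kappa; field_simp; norm_num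
    have h1 : ε / 2 < 1 := by rw [e1, div_lt_one hκ]; exact h
    set r := laplaceParam ε with hr
    have hr1 : r < 1 := laplaceParam_lt_one hε
    have h2 : 1 - r ≤ ε / 2 := by
      have := Real.add_one_le_exp (-ε / 2)
      rw [hr, laplaceParam]; linarith
    have h3 : 1 / 3 ≤ r := by
      have e2 : Real.exp 1 < 3 := Real.exp_one_lt_d9.trans (by norm_num)
      have e3 : Real.exp (-1) ≤ r := Real.exp_le_exp.2 (by linarith)
      rw [Real.exp_neg] at e3
      refine le_trans ?_ e3
      rw [one_div]
      exact inv_anti₀ (Real.exp_pos _) e2.le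
    have h4 : kappa ε ^ 2 = 4 / (ε / 2) ^ 2 := by unfold kappa; field_simp; norm_num
    have h5 : 4 / (ε / 2) ^ 2 ≤ 4 / (1 - r) ^ 2 :=
      div_le_div_of_nonneg_left (by norm_num) (by have : 0 < 1 - r := by linarith
                                                  positivity)
        (pow_le_pow_left₀ (by linarith) h2 2)
    have h6 : 4 / (1 - r) ^ 2 ≤ 6 * lapVar r := by
      rw [lapVar, ← mul_div_assoc]
      refine div_le_div_of_nonneg_right ?_ (sq_nonneg _)
      linarith
    linarith

/-! ### The asymptotic covariance -/

/-- The covariance of case (i) is that of case (ii) without noise variance, so one limit theorem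
covers both. -/
lemma blockS_eq_noisyBlock (W : Matrix (Idx n) (Idx n) ℝ) : blockS k W = noisyBlock k W 0 := by
  unfold blockS noisyBlock
  split_ifs with h
  · ext i j
    simp only [Matrix.submatrix_apply, S, Matrix.of_apply, lead, Matrix.add_apply,
      Matrix.smul_apply, Matrix.vecMulVec_apply, Pi.one_apply, mul_one, smul_eq_mul, zero_div,
      add_zero, Matrix.diagonal_apply, (Fin.castLE_injective h).eq_iff]
  · rfl

/-- The quadratic form of the asymptotic covariance. -/
lemma dotProduct_noisyBlock (h : k ≤ n) {N : Fin n} (hN : (N : ℕ) = n - 1) (sSq : ℝ)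
    (u : Fin k → ℝ) :
    u ⬝ᵥ noisyBlock k (V Z θ γ) sSq *ᵥ u =
      ∑ i, ∑ j, u i * u j * ((if i = j then 1 / outW Z θ γ (Fin.castLE h i) else 0)
        + (1 / inW Z θ γ N + sSq / inW Z θ γ N ^ 2)) := by
  have hv : vLast (V Z θ γ) = inW Z θ γ N := vLast_V hN
  have ho : ∀ i, V Z θ γ (lead h i) (lead h i) = outW Z θ γ (Fin.castLE h i) := fun i => by
    rw [lead, V_inl_inl, if_pos rfl]; rfl
  rw [noisyBlock, dif_pos h, hv]
  simp only [dotProduct, Matrix.mulVec, Matrix.add_apply, Matrix.smul_apply,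
    Matrix.vecMulVec_apply, Pi.one_apply, mul_one, smul_eq_mul, Matrix.diagonal_apply, ho,
    Finset.mul_sum]
  exact Finset.sum_congr rfl fun i _ => Finset.sum_congr rfl fun j _ => by ring

lemma dotProduct_noisyBlock_eq (h : k ≤ n) {N : Fin n} (hN : (N : ℕ) = n - 1) (sSq : ℝ)
    (u : Fin k → ℝ) :
    u ⬝ᵥ noisyBlock k (V Z θ γ) sSq *ᵥ u =
      ∑ i, u i ^ 2 / outW Z θ γ (Fin.castLE h i)
        + (1 / inW Z θ γ N + sSq / inW Z θ γ N ^ 2) * (∑ i, u i) ^ 2 := by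
  rw [dotProduct_noisyBlock h hN]
  simp only [mul_add, mul_ite, mul_zero, Finset.sum_add_distrib, Finset.sum_ite_eq,
    Finset.mem_univ, if_true]
  rw [sq (∑ i, u i), Finset.sum_mul_sum, Finset.mul_sum]
  simp only [Finset.mul_sum, ← Finset.sum_add_distrib]
  refine Finset.sum_congr rfl fun i _ => ?_
  congr 1
  · ring
  · exact Finset.sum_congr rfl fun j _ => by ring

/-- A row has total weight at most n/4, so 1/v_ii ≥ 4/n and the rank-one part only helps. Directions
of bounded variance have coordinates O(√n), so a remainder in the out-parameters is harmless when it
is o(1/√n). -/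
lemma sq_le_dotProduct_noisyBlock {m : ℝ} (hn : 3 ≤ n) (hW : IsWeight (wgt Z θ γ) m) (h : k ≤ n)
    {sSq : ℝ} (hs : 0 ≤ sSq) (u : Fin k → ℝ) (i : Fin k) :
    u i ^ 2 ≤ n / 4 * (u ⬝ᵥ noisyBlock k (V Z θ γ) sSq *ᵥ u) := by
  obtain ⟨N, hN⟩ := exists_last hn
  have hn0 : (0 : ℝ) < n := by exact_mod_cast (by omega : 0 < n)
  rw [dotProduct_noisyBlock_eq h hN]
  have hI := inW_pos hn hW N
  have h1 : u i ^ 2 / outW Z θ γ (Fin.castLE h i) ≤ ∑ i, u i ^ 2 / outW Z θ γ (Fin.castLE h i) :=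
    Finset.single_le_sum (f := fun i => u i ^ 2 / outW Z θ γ (Fin.castLE h i))
      (fun i _ => div_nonneg (sq_nonneg _) (outW_pos hn hW _).le) (Finset.mem_univ i)
  have h2 : 0 ≤ (1 / inW Z θ γ N + sSq / inW Z θ γ N ^ 2) * (∑ i, u i) ^ 2 := by positivity
  have h3 : outW Z θ γ (Fin.castLE h i) ≤ n / 4 := hW.row_le _
  have h4 : u i ^ 2 / (n / 4) ≤ u i ^ 2 / outW Z θ γ (Fin.castLE h i) :=
    div_le_div_of_nonneg_left (sq_nonneg _) (outW_pos hn hW _) h3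
  have h5 : u i ^ 2 = n / 4 * (u i ^ 2 / (n / 4)) := by field_simp
  rw [h5]
  refine mul_le_mul_of_nonneg_left ?_ (by positivity)
  linarith

lemma posDef_noisyBlock {m : ℝ} (hn : 3 ≤ n) (hW : IsWeight (wgt Z θ γ) m) (h : k ≤ n)
    {sSq : ℝ} (hs : 0 ≤ sSq) : (noisyBlock k (V Z θ γ) sSq).PosDef := by
  have hn0 : (0 : ℝ) < n := by exact_mod_cast (by omega : 0 < n)
  refine Matrix.PosDef.of_dotProduct_mulVec_pos ?_ fun u hu => ?_
  · ext i j
    rw [noisyBlock, dif_pos h]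
    simp only [Matrix.conjTranspose_apply, Matrix.add_apply, Matrix.diagonal_apply,
      Matrix.smul_apply, Matrix.vecMulVec_apply, Pi.one_apply, star_trivial]
    rcases eq_or_ne i j with rfl | hij
    · rfl
    · simp [hij, hij.symm]
  · rw [star_trivial]
    obtain ⟨i, hi⟩ := Function.ne_iff.1 hu
    have h1 := sq_le_dotProduct_noisyBlock hn hW h hs u i
    have h2 : 0 < u i ^ 2 := by have : u i ≠ 0 := hi; positivity
    exact pos_of_mul_pos_right (h2.trans_le h1) (by positivity)

end fixed

end

section

variable {n p : ℕ}
variable {k : ℕ}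

/-! ### The estimator for one graph -/

section fixed

variable {Z : Fin n → Fin n → Fin p → ℝ} {θ : Idx n → ℝ} {γ : Fin p → ℝ} {ε ε₁ ε₂ lam : ℝ}
  {Ω : Type*} [MeasurableSpace Ω] {P : Measure Ω} [IsProbabilityMeasure P]
  {a : Fin n → Fin n → Ω → ℤ} {eO eI : Fin n → Ω → ℤ}

/-- The moment equations fail to have a solution with small probability only. -/
lemma IsRegular.measureReal_not_exists_le (h : IsRegular Z θ γ ε ε₁ ε₂ lam) (hp : 1 ≤ p)
    (M : IsModel P Z θ γ ε a eO eI)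
    (hrate : rate Z θ γ ε ε₁ ε₂ lam ≤ 1 / (300000 * p ^ 2) ^ 2) :
    P.real {ω | ¬ ∃ θ' γ', IsMomentSolution Z (fun i j => a i j ω) (fun i => eO i ω)
      (fun i => eI i ω) θ' γ'} ≤ 4 / n + (1 + p) / Real.log n := by
  refine le_trans (measureReal_mono ?_) (M.measureReal_not_isGood_le h.pos h.three_le h.isWeight
    (h.covBound_pos hp) abs_le_covBound)
  intro ω hω hg
  obtain ⟨θ', γ', hs, -⟩ := h.exists_solution hp hrate hg
  exact hω ⟨θ', γ', hs⟩

/-- The characteristic function of the estimator for one graph. -/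
lemma IsRegular.norm_integral_exp_sub_le (h : IsRegular Z θ γ ε ε₁ ε₂ lam) (hp : 1 ≤ p)
    (M : IsModel P Z θ γ ε a eO eI)
    (hrate : rate Z θ γ ε ε₁ ε₂ lam ≤ 1 / (300000 * p ^ 2) ^ 2)
    {θhat : Ω → Idx n → ℝ} {γhat : Ω → Fin p → ℝ} (hmeas : Measurable θhat)
    (hest : ∀ ω, (∃ θ' γ', IsMomentSolution Z (fun i j => a i j ω) (fun i => eO i ω)
        (fun i => eI i ω) θ' γ') →
      IsMomentSolution Z (fun i j => a i j ω) (fun i => eO i ω) (fun i => eI i ω)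
        (θhat ω) (γhat ω))
    (hk : 1 ≤ k) (hkn : k ≤ n) {sSq c b v₀ M₀ g δ : ℝ} (hs : 0 ≤ sSq) (hb : 1 ≤ b)
    (hcb : c ≤ b ^ 2) (hv₀ : lapVar (laplaceParam ε) ≤ v₀)
    (hM₀ : 12 / (1 - laplaceParam ε) ^ 3 ≤ M₀)
    (hg : n * |(2 * n - 1) * lapVar (laplaceParam ε) - sSq| / vLast (V Z θ γ) ^ 2 ≤ g)
    (hδ : 0 < δ) {u : Fin k → ℝ} (hu : u ⬝ᵥ noisyBlock k (V Z θ γ) sSq *ᵥ u = c) :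
    ‖∫ ω, Complex.exp ((∑ i, u i * (θhat ω (lead hkn i) - θ (lead hkn i)) : ℝ) * Complex.I) ∂P
        - (Real.exp (-c / 2) : ℂ)‖ ≤
      (k * b * (3 * 10 ^ 10 * p ^ 4) * rate Z θ γ ε ε₁ ε₂ lam + δ)
      + 2 * ((4 / n + (1 + p) / Real.log n)
        + k * (51200 * (1 + v₀) * (k * b) ^ 2 / δ ^ 2 * rate Z θ γ ε ε₁ ε₂ lam))
      + ((4 * (12 * (k * b) * rate Z θ γ ε ε₁ ε₂ lam)
          + (12 * (k * b) * rate Z θ γ ε ε₁ ε₂ lam) ^ 2 * (1 + v₀))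
          * (c + (k * b) ^ 2 * (126 * (1 + v₀) * rate Z θ γ ε ε₁ ε₂ lam + g))
        + 8 * ((12 * (k * b)) ^ 3 * M₀) * rate Z θ γ ε ε₁ ε₂ lam)
      + (k * b) ^ 2 * (126 * (1 + v₀) * rate Z θ γ ε ε₁ ε₂ lam + g) := by
  have hn := h.three_le
  have hn3 : (3 : ℝ) ≤ n := by exact_mod_cast hn
  have hn0 : (0 : ℝ) < n := by linarith
  have hk0 : (0 : ℝ) < k := by exact_mod_cast hk
  have hκ := kappa_pos h.pos
  have hR := h.one_le_exp_rho
  have hW := h.isWeight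
  have hxN := h.exp_rho_le_rate hp
  obtain ⟨N, hN⟩ := exists_last hn
  have hI := inW_pos hn hW N
  have hvI : vLast (V Z θ γ) = inW Z θ γ N := vLast_V hN
  rw [hvI] at hg
  have hvar := dotProduct_noisyBlock (Z := Z) (θ := θ) (γ := γ) hkn hN sSq u
  rw [hu] at hvar
  have hc0 : 0 ≤ c := by
    have h1 := sq_le_dotProduct_noisyBlock hn hW hkn hs u ⟨0, hk⟩
    rw [hu] at h1
    exact nonneg_of_mul_nonneg_right (h := (sq_nonneg _).trans h1) (by positivity)
  have hv := lapVar_laplaceParam_nonneg ε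
  have hr0 : 0 < 1 - laplaceParam ε := by linarith [laplaceParam_lt_one h.pos]
  have hM0 : 0 ≤ 12 / (1 - laplaceParam ε) ^ 3 := by positivity
  have hv₀0 : 0 ≤ v₀ := hv.trans hv₀
  have hM₀0 : 0 ≤ M₀ := hM0.trans hM₀
  have hsq : ∀ i, u i ^ 2 ≤ n / 4 * c := fun i => hu ▸ sq_le_dotProduct_noisyBlock hn hW hkn hs u i
  set s := √(n : ℝ) with hsdef
  have hs0 : 0 < s := Real.sqrt_pos.2 hn0
  have hs1 : 1 ≤ s := Real.one_le_sqrt.2 (by linarith)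
  have hns : (n : ℝ) = s ^ 2 := (Real.sq_sqrt hn0.le).symm
  have hb0 : 0 < b := by linarith
  have hui : ∀ i, |u i| ≤ b * s := fun i => by
    refine abs_le_of_sq_le_sq ?_ (by positivity)
    calc u i ^ 2 ≤ n / 4 * c := hsq i
      _ ≤ n * c := by nlinarith
      _ ≤ n * b ^ 2 := by gcongr
      _ = (b * s) ^ 2 := by rw [hns]; ring
  have hd := abs_variance_colComb_sub_le hn hR hW hN (Fin.castLE_injective hkn) hui hv sSq
  rw [← hvar] at hd
  set G : Ω → Prop := fun ω => IsGood Z θ γ (fun i j => a i j ω) (fun i => eO i ω)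
    (fun i => eI i ω) (√(n * Real.log n)) (2 * n * (1 + kappa ε) ^ 2 * Real.log n)
    (√2 * n * covBound Z * (1 + kappa ε) * √(Real.log n)
      / (1 / (4 * Real.exp (rho Z θ γ ε₁ ε₂))) ^ 2) with hGdef
  have hGP : P.real {ω | ¬ G ω} ≤ 4 / n + (1 + p) / Real.log n :=
    M.measureReal_not_isGood_le h.pos hn hW (h.covBound_pos hp) abs_le_covBound
  have hG : ∀ ω, G ω → ∀ i : Fin k, |(θhat ω (lead hkn i) - θ (lead hkn i))
      - linStat Z θ γ (fun i j => a i j ω) (fun i => eO i ω) (fun i => eI i ω)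
        (degreeEffect (sCol Z θ γ (Fin.castLE hkn i))) (sCol Z θ γ (Fin.castLE hkn i))
      - linStat Z θ γ (fun i j => a i j ω) (fun i => eO i ω) (fun i => eI i ω)
        (degreeEffect (colErr Z θ γ (Fin.castLE hkn i))) (colErr Z θ γ (Fin.castLE hkn i))| ≤
      3 * 10 ^ 10 * p ^ 4 * (rate Z θ γ ε ε₁ ε₂ lam / s) := by
    intro ω hω i
    obtain ⟨θ', γ', hsol, hrem⟩ := h.exists_solution hp hrate hω
    -- By uniqueness the estimator is the solution constructed near the truth, so the expansion
    -- applies to it.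
    have := (IsMomentSolution.unique hn hW h.posDef h.norm_inv_le hsol
      (hest ω ⟨θ', γ', hsol⟩)).1
    rw [← this]
    exact hrem _
  clear_value G
  set R := Real.exp (rho Z θ γ ε₁ ε₂) with hRdef
  set x := rate Z θ γ ε ε₁ ε₂ lam with hxdef
  have hR0 : 0 < R := by linarith
  have hR12 : R ^ 12 ≤ x * s := by
    refine le_trans (le_mul_of_one_le_right (by positivity) ?_) hxN
    exact one_le_pow₀ (by linarith)
  have hx0 : 0 ≤ x := nonneg_of_mul_nonneg_left ((by positivity : 0 ≤ R ^ 12).trans hR12) hs0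
  have hX : Measurable fun ω => fun i : Fin k => θhat ω (lead hkn i) - θ (lead hkn i) := by
    fun_prop
  -- Since λq² ≥ 4 and log n ≥ 1, every power of R up to the twelfth, divided by √n, is at most the
  -- rate. All error terms then become multiples of the single small quantity x.
  have hRp : ∀ j ≤ 12, R ^ j / s ≤ x := fun j hj => by
    rw [div_le_iff₀ hs0]
    exact (pow_le_pow_right₀ hR hj).trans hR12
  have hRq : ∀ j ≤ 12, R ^ j / s ^ 2 ≤ x := fun j hj => by
    refine le_trans ?_ (hRp j hj)
    exact div_le_div_of_nonneg_left (by positivity) hs0 (by nlinarith)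
  have hdle : (k * (b * s)) ^ 2 * (126 * (1 + lapVar (laplaceParam ε)) * (R / n) ^ 2
        + |(2 * n - 1) * lapVar (laplaceParam ε) - sSq| / inW Z θ γ N ^ 2) ≤
      (k * b) ^ 2 * (126 * (1 + v₀) * x + g) := by
    have e : (k * (b * s)) ^ 2 * (126 * (1 + lapVar (laplaceParam ε)) * (R / n) ^ 2
        + |(2 * n - 1) * lapVar (laplaceParam ε) - sSq| / inW Z θ γ N ^ 2) =
        (k * b) ^ 2 * (126 * (1 + lapVar (laplaceParam ε)) * (R ^ 2 / s ^ 2)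
        + n * |(2 * n - 1) * lapVar (laplaceParam ε) - sSq| / inW Z θ γ N ^ 2) := by
      have : (R / n) ^ 2 = R ^ 2 / s ^ 2 / s ^ 2 := by rw [hns]; field_simp
      rw [this, mul_div_assoc, show (n : ℝ) * (|(2 * n - 1) * lapVar (laplaceParam ε) - sSq|
        / inW Z θ γ N ^ 2) = s ^ 2 * (|(2 * n - 1) * lapVar (laplaceParam ε) - sSq|
        / inW Z θ γ N ^ 2) by rw [← hns]]
      field_simp
    rw [e]
    have := hRq 2 (by norm_num)
    gcongr
  set d := (k * b) ^ 2 * (126 * (1 + v₀) * x + g) with hddef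
  have key := M.norm_integral_exp_sub_le h.pos hn hR hW hk (Fin.castLE hkn)
    (by positivity : 0 < b * s) hui hX (by positivity) hG hδ hc0 (hd.trans hdle)
  have hd0 : 0 ≤ d := (abs_nonneg _).trans (hd.trans hdle)
  clear_value d x R s
  refine key.trans ?_
  have t1 : k * (b * s) * (3 * 10 ^ 10 * (p : ℝ) ^ 4 * (x / s)) =
      k * b * (3 * 10 ^ 10 * p ^ 4) * x := by field_simp
  have t2 : 51200 * (1 + lapVar (laplaceParam ε)) * R ^ 5 / n ^ 2 / (δ / (k * (b * s))) ^ 2 ≤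
      51200 * (1 + v₀) * (k * b) ^ 2 / δ ^ 2 * x := by
    calc _ = 51200 * (1 + lapVar (laplaceParam ε)) * (k * b) ^ 2 / δ ^ 2 * (R ^ 5 / s ^ 2) := by
          rw [hns]; field_simp
      _ ≤ _ := by
          have := hRq 5 (by norm_num)
          gcongr
  have t3 : k * (b * s) * (12 * R / n) ≤ 12 * (k * b) * x := by
    calc _ = 12 * (k * b) * (R ^ 1 / s) := by rw [hns]; field_simp
      _ ≤ _ := by
          have := hRp 1 (by norm_num)
          gcongr
  have t4 : 8 * n * ((k * (b * s) * (12 * R / n)) ^ 3 * (12 / (1 - laplaceParam ε) ^ 3)) ≤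
      8 * ((12 * (k * b)) ^ 3 * M₀) * x := by
    calc _ = 8 * ((12 * (k * b)) ^ 3 * (12 / (1 - laplaceParam ε) ^ 3)) * (R ^ 3 / s) := by
          rw [hns]; field_simp
      _ ≤ _ := by
          have := hRp 3 (by norm_num)
          gcongr
  rw [t1]
  have t5 : 0 ≤ k * (b * s) * (12 * R / n) := by positivity
  gcongr

end fixed

end

section

/-! ### Sequences of graphs -/

lemma tendsto_badProb (p : ℕ) :
    Tendsto (fun n : ℕ => 4 / (n : ℝ) + (1 + p) / Real.log n) atTop (𝓝 0) := by
  have h1 : Tendsto (fun n : ℕ => (n : ℝ)) atTop atTop := tendsto_natCast_atTop_atTop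
  have h2 : Tendsto (fun n : ℕ => Real.log n) atTop atTop := Real.tendsto_log_atTop.comp h1
  simpa using (h1.const_div_atTop 4).add (h2.const_div_atTop (1 + (p : ℝ)))

lemma measurable_firstCoords {n k : ℕ} : Measurable (firstCoords k : (Idx n → ℝ) → _) := by
  unfold firstCoords
  split_ifs with h
  · exact (PiLp.continuous_toLp 2 _).measurable.comp
      (measurable_pi_lambda _ fun i => measurable_pi_apply _)
  · exact measurable_const

section sequence

variable {Ω : ℕ → Type*} [∀ n, MeasurableSpace (Ω n)] {P : ∀ n, Measure (Ω n)}
  [∀ n, IsProbabilityMeasure (P n)] {p : ℕ} {Z : ∀ n, Fin n → Fin n → Fin p → ℝ}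
  {θ : ∀ n, Idx n → ℝ} {γ : ℕ → Fin p → ℝ} {ε ε₁ ε₂ lam : ℕ → ℝ}
  {a : ∀ n, Fin n → Fin n → Ω n → ℤ} {eOut eIn : ∀ n, Fin n → Ω n → ℤ}
  {θhat : ∀ n, Ω n → Idx n → ℝ} {γhat : ∀ n, Ω n → Fin p → ℝ}

theorem tendsto_measure_exists_isMomentSolution (hp : 1 ≤ p)
    (hmodel : ∀ n, IsModel (P n) (Z n) (θ n) (γ n) (ε n) (a n) (eOut n) (eIn n))
    (hreg : ∀ᶠ n in atTop, IsRegular (Z n) (θ n) (γ n) (ε n) (ε₁ n) (ε₂ n) (lam n))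
    (hrate : Tendsto (fun n => rate (Z n) (θ n) (γ n) (ε n) (ε₁ n) (ε₂ n) (lam n)) atTop (𝓝 0)) :
    Tendsto (fun n => P n {ω | ∃ θ' γ', IsMomentSolution (Z n)
        (fun i j => a n i j ω) (fun i => eOut n i ω) (fun i => eIn n i ω) θ' γ'})
      atTop (𝓝 1) := by
  have hp0 : (0 : ℝ) < p := by exact_mod_cast hp
  have hlow : Tendsto (fun n : ℕ => 1 - ENNReal.ofReal (4 / (n : ℝ) + (1 + p) / Real.log n)) atTop
      (𝓝 1) := by
    have h1 := (ENNReal.continuous_ofReal.tendsto 0).comp (tendsto_badProb p)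
    have h2 := ENNReal.Tendsto.sub (tendsto_const_nhds (x := (1 : ENNReal))) h1
      (Or.inl ENNReal.one_ne_top)
    simpa using h2
  refine tendsto_of_tendsto_of_tendsto_of_le_of_le' hlow tendsto_const_nhds ?_
    (Eventually.of_forall fun n => prob_le_one)
  filter_upwards [hreg, hrate.eventually_le_const
    (by positivity : (0 : ℝ) < 1 / (300000 * (p : ℝ) ^ 2) ^ 2)] with n hn hr
  have h1 := hn.measureReal_not_exists_le hp (hmodel n) hr
  rw [tsub_le_iff_right]
  have h2 : P n {ω | ¬ ∃ θ' γ', IsMomentSolution (Z n) (fun i j => a n i j ω)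
      (fun i => eOut n i ω) (fun i => eIn n i ω) θ' γ'} ≤
      ENNReal.ofReal (4 / (n : ℝ) + (1 + p) / Real.log n) := by
    rw [← ofReal_measureReal]
    exact ENNReal.ofReal_le_ofReal h1
  refine le_trans ?_ (add_le_add le_rfl h2)
  rw [← measure_univ (μ := P n)]
  refine (measure_mono fun ω _ => ?_).trans (measure_union_le _ _)
  exact em _

/-- The estimator is asymptotically normal when the noise is of bounded scale and `sSq` is close
enough to the variance of the noise in the last equation. -/
theorem asymptoticallyNormal_firstCoords (hp : 1 ≤ p)
    (hmodel : ∀ n, IsModel (P n) (Z n) (θ n) (γ n) (ε n) (a n) (eOut n) (eIn n))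
    (hreg : ∀ᶠ n in atTop, IsRegular (Z n) (θ n) (γ n) (ε n) (ε₁ n) (ε₂ n) (lam n))
    (hrate : Tendsto (fun n => rate (Z n) (θ n) (γ n) (ε n) (ε₁ n) (ε₂ n) (lam n)) atTop (𝓝 0))
    (hmeas : ∀ n, Measurable (θhat n))
    (hest : ∀ n ω, (∃ θ' γ', IsMomentSolution (Z n) (fun i j => a n i j ω)
        (fun i => eOut n i ω) (fun i => eIn n i ω) θ' γ') →
      IsMomentSolution (Z n) (fun i j => a n i j ω)
        (fun i => eOut n i ω) (fun i => eIn n i ω) (θhat n ω) (γhat n ω))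
    {κ₀ : ℝ} (hκ : ∀ᶠ n in atTop, kappa (ε n) ≤ κ₀) {sSq : ℕ → ℝ} (hs : ∀ᶠ n in atTop, 0 ≤ sSq n)
    (hsSq : Tendsto (fun n : ℕ => n * |(2 * n - 1) * lapVar (laplaceParam (ε n)) - sSq n|
      / vLast (V (Z n) (θ n) (γ n)) ^ 2) atTop (𝓝 0)) {k : ℕ} (hk : 1 ≤ k) :
    AsymptoticallyNormal P (fun n ω => firstCoords k (θhat n ω - θ n))
      (fun n => noisyBlock k (V (Z n) (θ n) (γ n)) (sSq n)) := by
  have hp0 : (0 : ℝ) < p := by exact_mod_cast hp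
  refine asymptoticallyNormal_of_charFun P
    (fun n => measurable_firstCoords.comp ((hmeas n).sub_const _)) ?_ ?_
  · filter_upwards [hreg, hs, eventually_ge_atTop k] with n hn hsn hkn
    exact posDef_noisyBlock hn.three_le hn.isWeight hkn hsn
  intro u c hc hu
  set b := √c + 1 with hbdef
  have hb : 1 ≤ b := by linarith [Real.sqrt_nonneg c]
  have hcb : c ≤ b ^ 2 := by
    have := Real.sq_sqrt hc
    nlinarith [Real.sqrt_nonneg c]
  set v₀ := κ₀ ^ 2 / 2 with hv₀
  set M₀ := 12 / (1 - Real.exp (-2 / κ₀)) ^ 3 with hM₀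
  -- The error bound as a continuous function of three null sequences: the rate, the failure
  -- probability and the variance discrepancy. At the origin it equals δ, later taken as half the
  -- tolerance.
  set Φ : ℝ → ℝ × ℝ × ℝ → ℝ := fun δ y =>
      (k * b * (3 * 10 ^ 10 * p ^ 4) * y.1 + δ)
      + 2 * (y.2.1 + k * (51200 * (1 + v₀) * (k * b) ^ 2 / δ ^ 2 * y.1))
      + ((4 * (12 * (k * b) * y.1) + (12 * (k * b) * y.1) ^ 2 * (1 + v₀))
          * (c + (k * b) ^ 2 * (126 * (1 + v₀) * y.1 + y.2.2))
        + 8 * ((12 * (k * b)) ^ 3 * M₀) * y.1)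
      + (k * b) ^ 2 * (126 * (1 + v₀) * y.1 + y.2.2) with hΦ
  have hΦt : ∀ δ, Tendsto (fun n : ℕ => Φ δ
      (rate (Z n) (θ n) (γ n) (ε n) (ε₁ n) (ε₂ n) (lam n),
        4 / (n : ℝ) + (1 + p) / Real.log n,
        n * |(2 * n - 1) * lapVar (laplaceParam (ε n)) - sSq n|
          / vLast (V (Z n) (θ n) (γ n)) ^ 2)) atTop (𝓝 δ) := fun δ => by
    have hcont : Continuous (Φ δ) := by fun_prop
    have h0 : Φ δ (0, 0, 0) = δ := by simp [hΦ]
    have := (hcont.tendsto (0, 0, 0)).comp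
      (hrate.prodMk_nhds ((tendsto_badProb p).prodMk_nhds hsSq))
    rwa [h0] at this
  rw [Metric.tendsto_nhds]
  intro η hη
  filter_upwards [hreg, hs, hκ, hu, eventually_ge_atTop k, hrate.eventually_le_const
    (by positivity : (0 : ℝ) < 1 / (300000 * (p : ℝ) ^ 2) ^ 2),
    (hΦt (η / 2)).eventually_lt_const (half_lt_self hη)] with n hn hsn hκn hun hkn hr hlt
  rw [dist_eq_norm]
  refine lt_of_le_of_lt ?_ hlt
  have hκ0 := kappa_pos hn.pos
  have hv : lapVar (laplaceParam (ε n)) ≤ v₀ := by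
    refine (lapVar_le hn.pos).trans ?_
    rw [hv₀]
    gcongr
  -- Bounded κ keeps 1 - r away from 0, so the third moments of the noises are uniformly bounded.
  have hM : 12 / (1 - laplaceParam (ε n)) ^ 3 ≤ M₀ := by
    have h1 : laplaceParam (ε n) ≤ Real.exp (-2 / κ₀) := by
      rw [laplaceParam, show -ε n / 2 = -2 / kappa (ε n) by
        have := hn.pos
        unfold kappa; field_simp; norm_num]
      refine Real.exp_le_exp.2 ?_
      rw [neg_div, neg_div]
      exact neg_le_neg (div_le_div_of_nonneg_left (by norm_num) hκ0 hκn)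
    have h2 : Real.exp (-2 / κ₀) < 1 := by
      rw [Real.exp_lt_one_iff, neg_div]
      exact neg_lt_zero.2 (div_pos two_pos (hκ0.trans_le hκn))
    exact div_le_div_of_nonneg_left (by norm_num) (pow_pos (sub_pos.2 h2) 3)
      (pow_le_pow_left₀ (sub_pos.2 h2).le (by linarith) 3)
  have key := hn.norm_integral_exp_sub_le hp (hmodel n) hr (hmeas n) (hest n) hk hkn hsn hb hcb hv
    hM le_rfl (half_pos hη) hun
  convert! key using 5
  rename_i ω
  simp [firstCoords, hkn]

/-- The asymptotic covariance does not see a noise of small scale. -/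
lemma tendsto_noise_div_vLast_sq
    (hreg : ∀ᶠ n in atTop, IsRegular (Z n) (θ n) (γ n) (ε n) (ε₁ n) (ε₂ n) (lam n))
    (hκ : Tendsto (fun n : ℕ => kappa (ε n)
        * Real.exp (rho (Z n) (θ n) (γ n) (ε₁ n) (ε₂ n)) * √(Real.log n)) atTop (𝓝 0)) :
    Tendsto (fun n : ℕ => n * |(2 * n - 1) * lapVar (laplaceParam (ε n)) - 0|
      / vLast (V (Z n) (θ n) (γ n)) ^ 2) atTop (𝓝 0) := by
  have h0 : Tendsto (fun n : ℕ => 36 * (kappa (ε n)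
      * Real.exp (rho (Z n) (θ n) (γ n) (ε₁ n) (ε₂ n)) * √(Real.log n)) ^ 2) atTop (𝓝 0) := by
    simpa using (hκ.pow 2).const_mul 36
  refine squeeze_zero' (Eventually.of_forall fun n => by positivity) ?_ h0
  filter_upwards [hreg] with n hn
  obtain ⟨N, hN⟩ := exists_last hn.three_le
  have hn3 : (3 : ℝ) ≤ n := by exact_mod_cast hn.three_le
  have hI := inW_pos hn.three_le hn.isWeight N
  have hI2 := inv_inW_le hn.three_le hn.one_le_exp_rho hn.isWeight N
  have hR := hn.one_le_exp_rho
  have hL := hn.one_le_log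
  have hv := lapVar_laplaceParam_nonneg (ε n)
  have hvl := lapVar_le hn.pos
  have hκ0 := kappa_pos hn.pos
  rw [show vLast (V (Z n) (θ n) (γ n)) = inW (Z n) (θ n) (γ n) N from vLast_V hN, sub_zero,
    abs_of_nonneg (mul_nonneg (by linarith) hv)]
  set R := Real.exp (rho (Z n) (θ n) (γ n) (ε₁ n) (ε₂ n))
  set I := inW (Z n) (θ n) (γ n) N
  set v := lapVar (laplaceParam (ε n))
  calc n * ((2 * n - 1) * v) / I ^ 2 = n * ((2 * n - 1) * v) * (1 / I) ^ 2 := by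
        rw [one_div, inv_pow, div_eq_mul_inv]
    _ ≤ n * (2 * n * (kappa (ε n) ^ 2 / 2)) * (6 * R / n) ^ 2 := by
        have : 0 ≤ 1 / I := by positivity
        have : 2 * (n : ℝ) - 1 ≤ 2 * n := by linarith
        gcongr
    _ = 36 * (kappa (ε n) ^ 2 * R ^ 2 * 1) := by
        have : (n : ℝ) ≠ 0 := by positivity
        field_simp
        norm_num
    -- The factor log n ≥ 1 is inserted only to reach the square of the quantity assumed to vanish.
    _ ≤ 36 * (kappa (ε n) ^ 2 * R ^ 2 * Real.log n) := by gcongr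
    _ = _ := by rw [mul_pow, mul_pow, Real.sq_sqrt (by linarith)]

/-- The noise has bounded scale when its variance is at most of the order of `v_{2n,2n}`. -/
lemma exists_kappa_le {c : ℝ}
    (hmodel : ∀ n, IsModel (P n) (Z n) (θ n) (γ n) (ε n) (a n) (eOut n) (eIn n))
    (hreg : ∀ᶠ n in atTop, IsRegular (Z n) (θ n) (γ n) (ε n) (ε₁ n) (ε₂ n) (lam n))
    (hc : Tendsto (fun n : ℕ => √(noiseVariance (P n) (eOut n) (eIn n))
        / √(vLast (V (Z n) (θ n) (γ n)))) atTop (𝓝 c)) :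
    ∃ κ₀, ∀ᶠ n in atTop, kappa (ε n) ≤ κ₀ := by
  refine ⟨4 + 6 * (c ^ 2 + 1), ?_⟩
  filter_upwards [hreg, (hc.pow 2).eventually_le_const (lt_add_one _)] with n hn hle
  obtain ⟨N, hN⟩ := exists_last hn.three_le
  have hn3 : (3 : ℝ) ≤ n := by exact_mod_cast hn.three_le
  have hI := inW_pos hn.three_le hn.isWeight N
  -- As v_{2n,2n} ≤ n/4, the convergent ratio forces (2n - 1)σ² ≤ (c² + 1)n/4 with σ² the variance
  -- of one noise. So σ² is bounded, and with it κ.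
  have hI2 : inW (Z n) (θ n) (γ n) N ≤ n / 4 := hn.isWeight.swap.row_le N
  have hv := lapVar_laplaceParam_nonneg (ε n)
  have hκ := kappa_sq_le hn.pos
  rw [show vLast (V (Z n) (θ n) (γ n)) = inW (Z n) (θ n) (γ n) N from vLast_V hN, div_pow,
    Real.sq_sqrt hI.le, (hmodel n).noiseVariance_eq hn.pos (by have := hn.three_le; omega),
    Real.sq_sqrt (mul_nonneg (by linarith) hv), div_le_iff₀ hI] at hle
  have h1 : n * lapVar (laplaceParam (ε n)) ≤ n * (c ^ 2 + 1) := by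
    calc _ ≤ (2 * n - 1) * lapVar (laplaceParam (ε n)) := by gcongr; linarith
      _ ≤ (c ^ 2 + 1) * (n / 4) := hle.trans (by gcongr)
      _ ≤ _ := by nlinarith [mul_nonneg (by linarith : (0 : ℝ) ≤ n) (by positivity : 0 ≤ c ^ 2 + 1)]
  have h2 := le_of_mul_le_mul_left h1 (by linarith)
  nlinarith [sq_nonneg c]

end sequence

end

end PrivateBeta

end

/-! ### Existence and asymptotic normality: conclusion -/

theorem theorem2 {Ω : ℕ → Type*} [∀ n, MeasurableSpace (Ω n)]
    (P : ∀ n, Measure (Ω n)) [∀ n, IsProbabilityMeasure (P n)]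
    (p : ℕ) (hp : 1 ≤ p)
    -- covariates, true parameters, privacy parameters, radii of the neighbourhoods
    (Z : ∀ n, Fin n → Fin n → Fin p → ℝ)
    (θ : ∀ n, PrivateBeta.Idx n → ℝ) (γ : ℕ → Fin p → ℝ)
    (ε ε₁ ε₂ lam : ℕ → ℝ)
    (hε : ∀ n, 0 < ε n) (hε₁ : ∀ n, 0 < ε₁ n) (hε₂ : ∀ n, 0 < ε₂ n)
    (hq : ∃ q : ℝ, ∀ n, PrivateBeta.covBound (Z n) ≤ q)
    -- edges and noises
    (a : ∀ n, Fin n → Fin n → Ω n → ℤ) (eOut eIn : ∀ n, Fin n → Ω n → ℤ)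
    (hmodel : ∀ n, PrivateBeta.IsModel (P n) (Z n) (θ n) (γ n) (ε n) (a n) (eOut n) (eIn n))
    -- the moment estimator
    (θhat : ∀ n, Ω n → PrivateBeta.Idx n → ℝ) (γhat : ∀ n, Ω n → Fin p → ℝ)
    (hmeas : ∀ n, Measurable (θhat n))
    (hest : ∀ n ω,
      (∃ θ' γ', PrivateBeta.IsMomentSolution (Z n) (fun i j => a n i j ω)
        (fun i => eOut n i ω) (fun i => eIn n i ω) θ' γ') →
      PrivateBeta.IsMomentSolution (Z n) (fun i j => a n i j ω)
        (fun i => eOut n i ω) (fun i => eIn n i ω) (θhat n ω) (γhat n ω))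
    -- positive definiteness of `H` and the bound `λₙ / n²` on its inverse
    (hH : ∀ᶠ n in atTop, ∀ θ' : PrivateBeta.Idx n → ℝ, ‖θ' - θ n‖ ≤ ε₁ n →
      (PrivateBeta.H (Z n) θ' (γ n)).PosDef ∧
      PrivateBeta.rowSumNorm (PrivateBeta.H (Z n) θ' (γ n))⁻¹ ≤ lam n / (n : ℝ) ^ 2)
    (hrate1 : (fun n : ℕ => lam n ^ 2 * PrivateBeta.covBound (Z n)
        * Real.exp (18 * PrivateBeta.rho (Z n) (θ n) (γ n) (ε₁ n) (ε₂ n))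
        * (1 + PrivateBeta.kappa (ε n)) ^ 2)
      =o[atTop] fun n : ℕ => (n : ℝ) / Real.log n)
    (hrate2 : (fun n : ℕ => lam n * PrivateBeta.covBound (Z n) ^ 2
        * Real.exp (12 * PrivateBeta.rho (Z n) (θ n) (γ n) (ε₁ n) (ε₂ n))
        * (1 + PrivateBeta.kappa (ε n)) ^ 2)
      =o[atTop] fun n : ℕ => Real.sqrt n / Real.log n) :
    -- the estimator exists with probability tending to one
    Tendsto (fun n => P n {ω | ∃ θ' γ', PrivateBeta.IsMomentSolution (Z n)
        (fun i j => a n i j ω) (fun i => eOut n i ω) (fun i => eIn n i ω) θ' γ'})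
      atTop (𝓝 1) ∧
    -- (i)
    (Tendsto (fun n : ℕ => PrivateBeta.kappa (ε n)
        * Real.exp (PrivateBeta.rho (Z n) (θ n) (γ n) (ε₁ n) (ε₂ n)) * Real.sqrt (Real.log n))
        atTop (𝓝 0) →
      ∀ k : ℕ, 1 ≤ k →
        PrivateBeta.AsymptoticallyNormal P
          (fun n ω => PrivateBeta.firstCoords k (θhat n ω - θ n))
          (fun n => PrivateBeta.blockS k (PrivateBeta.V (Z n) (θ n) (γ n)))) ∧
    -- (ii)
    (∀ n : ℕ, 1 ≤ n → PrivateBeta.noiseVariance (P n) (eOut n) (eIn n) =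
      2 * (2 * n - 1) * Real.exp (-2 / PrivateBeta.kappa (ε n))
        / (1 - Real.exp (-2 / PrivateBeta.kappa (ε n))) ^ 2) ∧
    (∀ c : ℝ,
      Tendsto (fun n : ℕ => Real.sqrt (PrivateBeta.noiseVariance (P n) (eOut n) (eIn n))
        / Real.sqrt (PrivateBeta.vLast (PrivateBeta.V (Z n) (θ n) (γ n)))) atTop (𝓝 c) →
      ∀ k : ℕ, 1 ≤ k →
        PrivateBeta.AsymptoticallyNormal P
          (fun n ω => PrivateBeta.firstCoords k (θhat n ω - θ n))
          (fun n => PrivateBeta.noisyBlock k (PrivateBeta.V (Z n) (θ n) (γ n))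
            (PrivateBeta.noiseVariance (P n) (eOut n) (eIn n)))) := by
  have hrate : Tendsto (fun n => PrivateBeta.rate (Z n) (θ n) (γ n) (ε n) (ε₁ n) (ε₂ n) (lam n))
      atTop (𝓝 0) := hrate2.tendsto_div_nhds_zero
  have hlog : Tendsto (fun n : ℕ => Real.log n) atTop atTop :=
    Real.tendsto_log_atTop.comp tendsto_natCast_atTop_atTop
  have hreg : ∀ᶠ n in atTop,
      PrivateBeta.IsRegular (Z n) (θ n) (γ n) (ε n) (ε₁ n) (ε₂ n) (lam n) := by
    filter_upwards [hH, hlog.eventually_ge_atTop 1, eventually_ge_atTop 3] with n hn hL h3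
    -- The centre of the neighbourhood is enough: all forms are evaluated at the true parameter, and
    -- other parameters are reached through secant slopes.
    have h0 := hn (θ n) (by simpa using (hε₁ n).le)
    exact ⟨h3, hL, hε n, hε₁ n, hε₂ n, h0.1, h0.2⟩
  refine ⟨PrivateBeta.tendsto_measure_exists_isMomentSolution hp hmodel hreg hrate, ?_, ?_, ?_⟩
  · intro hκ k hk
    -- Both e^ρ and √(log n) are eventually at least 1, so the product bounds κ.
    have hκ1 : ∀ᶠ n in atTop, PrivateBeta.kappa (ε n) ≤ 1 := by
      filter_upwards [hreg, hκ.eventually_le_const one_pos] with n hn hle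
      refine le_trans ?_ hle
      have h1 := hn.one_le_exp_rho
      have h2 : 1 ≤ √(Real.log n) := Real.one_le_sqrt.2 hn.one_le_log
      have h3 := (PrivateBeta.kappa_pos hn.pos).le
      rw [mul_assoc]
      exact le_mul_of_one_le_right h3 (one_le_mul_of_one_le_of_one_le h1 h2)
    simp only [PrivateBeta.blockS_eq_noisyBlock]
    exact PrivateBeta.asymptoticallyNormal_firstCoords hp hmodel hreg hrate hmeas hest hκ1
      (Eventually.of_forall fun _ => le_rfl)
      (PrivateBeta.tendsto_noise_div_vLast_sq hreg hκ) hk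
  · intro n hn
    rw [(hmodel n).noiseVariance_eq (hε n) hn, PrivateBeta.lapVar_eq (hε n)]
    ring
  · intro c hc k hk
    obtain ⟨κ₀, hκ₀⟩ := PrivateBeta.exists_kappa_le hmodel hreg hc
    refine PrivateBeta.asymptoticallyNormal_firstCoords hp hmodel hreg hrate hmeas hest hκ₀
      (sSq := fun n => PrivateBeta.noiseVariance (P n) (eOut n) (eIn n))
      (Eventually.of_forall fun n => variance_nonneg _ _) ?_ hk
    -- With the exact noise variance in the covariance the discrepancy is identically zero for n ≥
    -- 1.
    refine tendsto_const_nhds.congr' ?_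
    filter_upwards [eventually_ge_atTop 1] with n hn
    rw [(hmodel n).noiseVariance_eq (hε n) hn, sub_self, abs_zero, mul_zero, zero_div]
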